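/- Let $d\ge 1$ and let $\Omega\subset\mathbb R^d$ be a bounded open set with $C^\infty$ boundary and exterior unit normal $n$. Let $M\in(0,+\infty]$, let $\mathsf m:[0,M)\to[0,\infty)$ be continuous and concave, strictly positive on $(0,M)$, let $U\in W^{2,1}_{loc}(0,M)$ be convex, and set $$P(r)=\int_0^r \mathsf m(z)U''(z)\,dz,\qquad H(r)=H_0+\int_0^r P'(z)\mathsf m'(z)\,dz\qquad (H_0\ge 0 \text{ a constant}),$$ where $\mathsf mU''$ and $P'\mathsf m'$ are assumed to belong to $L^1_{loc}([0,M))$. Let $0<m_0\le m_1<M$ and assume that $P$ and $\mathsf m$ are $C^\infty$ on $[m_0,m_1]$ (derivatives of $P,\mathsf m$ at values in $[m_0,m_1]$ are taken within this interval). Let $\rho_s$, $s\in[0,1]$, satisfy $\rho\in C^\infty([0,1]\times\overline\Omega)$, $m_0\le\rho_s\le m_1$, with $\int_\Omega\rho_s\,dx$ independent of $s$. Let $\rho_{s,t}=S_{st}\rho_s$ for $t\ge 0$, where $\tau\mapsto S_\tau\rho_s=u(\tau)$ is the weak solution of $\partial_\tau u=\Delta P(u)$ in $(0,\infty)\times\Omega$,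 $\partial_nP(u)=0$ on $\partial\Omega$, $u(0)=\rho_s$; that is, $u\in L^\infty((0,\infty)\times\Omega)\cap C^0([0,\infty);L^1(\Omega))$ has values in $[0,M)$, $P(u)\in L^\infty((0,\infty)\times\Omega)\cap L^2_{loc}([0,\infty);W^{1,2}(\Omega))$, and $\int_0^\infty\!\int_\Omega(u\,\partial_\tau\varphi-\nabla P(u)\cdot\nabla\varphi)\,dx\,d\tau=0$ for all $\varphi\in C_c^\infty((0,\infty)\times\mathbb R^d)$. Assume that $(s,t,x)\mapsto\rho_{s,t}(x)$ belongs to $C^\infty([0,1]\times(0,\infty)\times\overline\Omega)$. (Here $C^\infty$ on such a set means being the restriction of a $C^\infty$ function defined on an open neighbourhood.) For $s\in[0,1]$, $t>0$ let $\zeta_{s,t}\in C^\infty(\overline\Omega)$ solve $$-\nabla\cdot(\mathsf m(\rho_{s,t})\nabla\zeta_{s,t})=\partial_s\rho_{s,t}\ \text{in }\Omega,\qquad \nabla\zeta_{s,t}\cdot n=0\ \text{on }\partial\Omega,\qquad \int_\Omega\zeta_{s,t}\,dx=0,$$ and put $A_{s,t}=\int_\Omega\mathsf m(\rho_{s,t})|\nabla\zeta_{s,t}|^2\,dx$.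 Then for every $(s,t)\in[0,1]\times(0,\infty)$ the function $A_{s,\cdot}$ is differentiable at $t$, all integrands involved are integrable, and, writing $\rho=\rho_{s,t}$, $\zeta=\zeta_{s,t}$, $$\begin{aligned}\frac12\frac{\partial}{\partial t}A_{s,t}={}&-\int_\Omega\nabla P(\rho)\cdot\nabla\zeta\,dx-s\int_\Omega\Big(\big(P'(\rho)\mathsf m(\rho)-H(\rho)\big)(\Delta\zeta)^2+H(\rho)|D^2\zeta|^2\Big)dx\\&+\frac s2\int_\Omega P'(\rho)\mathsf m''(\rho)|\nabla\rho|^2|\nabla\zeta|^2\,dx+\frac s2\int_{\partial\Omega}H(\rho)\,\nabla|\nabla\zeta|^2\cdot n\,d\mathscr H^{d-1},\end{aligned}$$ where $|D^2\zeta|$ is the Frobenius norm of the Hessian and $\mathscr H^{d-1}$ is the $(d-1)$-dimensional Hausdorff measure, normalised to be the surface measure. -/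

import Mathlib

open Set Filter MeasureTheory
open scoped Topology ContDiff Gradient Laplacian

noncomputable section

/-! ### Smooth domains, normals, smoothness up to the boundary -/

/-- `f` is of class `C^∞` on the (possibly not open) set `S`, in the sense that it is
`C^∞` on some open neighbourhood of `S`. A function given on `S` only is smooth on `S` when it is the
restriction of such an `f`; its derivatives at points of `S` are those of `f`. -/
def SmoothOnNhd {F : Type*} [NormedAddCommGroup F] [NormedSpace ℝ F] (f : F → ℝ) (S : Set F) :
    Prop :=
  ∃ V : Set F, IsOpen V ∧ S ⊆ V ∧ ContDiffOn ℝ ∞ f V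

/-- `ψ` is a smooth function with `∇ψ(x) ≠ 0` and `Ω = {ψ < 0}` near `x`. -/
def IsBoundaryDefining {d : ℕ} (Ω : Set (EuclideanSpace ℝ (Fin d))) (x : EuclideanSpace ℝ (Fin d))
    (ψ : EuclideanSpace ℝ (Fin d) → ℝ) : Prop :=
  ContDiff ℝ ∞ ψ ∧ ∇ ψ x ≠ 0 ∧ ∀ᶠ y in 𝓝 x, (y ∈ Ω ↔ ψ y < 0)

/-- A bounded open set with `C^∞` boundary, lying locally on one side of its boundary. -/
structure IsSmoothBoundedDomain {d : ℕ} (Ω : Set (EuclideanSpace ℝ (Fin d))) : Prop where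
  isOpen : IsOpen Ω
  isBounded : Bornology.IsBounded Ω
  smooth_boundary : ∀ x ∈ frontier Ω, ∃ ψ, IsBoundaryDefining Ω x ψ

open Classical in
/-- The exterior unit normal at a boundary point: `∇ψ / |∇ψ|` for any local defining
function `ψ` (the value does not depend on `ψ`). -/
def outerNormal {d : ℕ} (Ω : Set (EuclideanSpace ℝ (Fin d))) (x : EuclideanSpace ℝ (Fin d)) :
    EuclideanSpace ℝ (Fin d) :=
  if h : ∃ ψ, IsBoundaryDefining Ω x ψ then ‖∇ h.choose x‖⁻¹ • ∇ h.choose x else 0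

/-- The divergence of a vector field. -/
def divergence {d : ℕ} (F : EuclideanSpace ℝ (Fin d) → EuclideanSpace ℝ (Fin d))
    (x : EuclideanSpace ℝ (Fin d)) : ℝ :=
  ∑ i : Fin d, (fderiv ℝ F x (EuclideanSpace.single i 1)) i

/-- The squared Frobenius norm `|D²f|² = ∑ᵢⱼ (∂ᵢ∂ⱼ f)²` of the Hessian. -/
def hessianNormSq {d : ℕ} (f : EuclideanSpace ℝ (Fin d) → ℝ) (x : EuclideanSpace ℝ (Fin d)) : ℝ :=
  ∑ i : Fin d, ∑ j : Fin d,
    (fderiv ℝ (fderiv ℝ f) x (EuclideanSpace.single i 1) (EuclideanSpace.single j 1)) ^ 2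

/-! ### Mobility, energy density, pressure, and the function `H` -/

/-- The interval `[0, M)`, where `M` may be `+∞`. -/
def densityRange (M : EReal) : Set ℝ := {r | 0 ≤ r ∧ (r : EReal) < M}

/-- The open interval `(0, M)`, where `M` may be `+∞`. -/
def densityRangeInterior (M : EReal) : Set ℝ := {r | 0 < r ∧ (r : EReal) < M}

/-- A concave mobility: continuous and concave on `[0, M)`, strictly positive on `(0, M)`. -/
structure IsMobility (M : EReal) (m : ℝ → ℝ) : Prop where
  threshold_pos : 0 < M
  continuousOn : ContinuousOn m (densityRange M)
  concaveOn : ConcaveOn ℝ (densityRange M) m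
  pos : ∀ r ∈ densityRangeInterior M, 0 < m r

/-- The pressure `P(r) = ∫₀^r m(z) U''(z) dz`. -/
def pressure (m U : ℝ → ℝ) (r : ℝ) : ℝ := ∫ z in (0 : ℝ)..r, m z * deriv (deriv U) z

/-- A convex density function `U ∈ W^{2,1}_loc(0, M)` (that is, `U` is differentiable and `U'` is
locally absolutely continuous) such that `m U''` and `P' m'` belong to `L¹_loc([0, M))`. -/
structure IsEnergyDensity (M : EReal) (m U : ℝ → ℝ) : Prop where
  convexOn : ConvexOn ℝ (densityRangeInterior M) U
  differentiableOn : DifferentiableOn ℝ U (densityRangeInterior M)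
  absolutelyContinuous_deriv : ∀ a ∈ densityRangeInterior M, ∀ b ∈ densityRangeInterior M,
    AbsolutelyContinuousOnInterval (deriv U) a b
  integrable_pressure : ∀ r ∈ densityRange M,
    IntervalIntegrable (fun z => m z * deriv (deriv U) z) volume 0 r
  integrable_auxiliary : ∀ r ∈ densityRange M,
    IntervalIntegrable (fun z => deriv (pressure m U) z * deriv m z) volume 0 r

/-- The function `H(r) = H₀ + ∫₀^r P'(z) m'(z) dz`. -/
def auxiliaryH (m U : ℝ → ℝ) (H₀ : ℝ) (r : ℝ) : ℝ :=
  H₀ + ∫ z in (0 : ℝ)..r, deriv (pressure m U) z * deriv m z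

/-! ### Bounded weak solutions of the Neumann problem for `∂ₜu = ΔP(u)` -/

/-- `g` is the weak gradient of `f` in `Ω`. -/
def HasWeakGradient {d : ℕ} (Ω : Set (EuclideanSpace ℝ (Fin d)))
    (f : EuclideanSpace ℝ (Fin d) → ℝ)
    (g : EuclideanSpace ℝ (Fin d) → EuclideanSpace ℝ (Fin d)) : Prop :=
  LocallyIntegrableOn f Ω ∧ LocallyIntegrableOn g Ω ∧
    ∀ φ : EuclideanSpace ℝ (Fin d) → ℝ, ContDiff ℝ ∞ φ → HasCompactSupport φ → tsupport φ ⊆ Ω →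
      ∫ x in Ω, f x • ∇ φ x = - ∫ x in Ω, φ x • g x

/-- `u` is the weak solution with initial datum `u₀` of `∂ₜu = ΔP(u)` in `(0, ∞) × Ω`,
`∂ₙP(u) = 0` on `(0, ∞) × ∂Ω`:
`u ∈ L^∞((0,∞) × Ω) ∩ C⁰([0,∞); L¹(Ω))` takes values in `[0, M)`,
`P(u) ∈ L^∞((0,∞) × Ω) ∩ L²_loc([0,∞); W^{1,2}(Ω))`, `u(0) = u₀`, and
`∫₀^∞ ∫_Ω (u ∂ₜφ - ∇P(u) · ∇φ) dx dt = 0` for all `φ ∈ C_c^∞((0,∞) × ℝᵈ)`. -/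
structure IsWeakDiffusionSolution {d : ℕ} (M : EReal) (P : ℝ → ℝ)
    (Ω : Set (EuclideanSpace ℝ (Fin d))) (u₀ : EuclideanSpace ℝ (Fin d) → ℝ)
    (u : ℝ → EuclideanSpace ℝ (Fin d) → ℝ) : Prop where
  mem_range : ∀ᵐ p ∂((volume.restrict (Ioi (0 : ℝ))).prod (volume.restrict Ω)),
    u p.1 p.2 ∈ densityRange M
  bounded : MemLp (fun p : ℝ × EuclideanSpace ℝ (Fin d) => u p.1 p.2) ⊤
    ((volume.restrict (Ioi (0 : ℝ))).prod (volume.restrict Ω))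
  pressure_bounded : MemLp (fun p : ℝ × EuclideanSpace ℝ (Fin d) => P (u p.1 p.2)) ⊤
    ((volume.restrict (Ioi (0 : ℝ))).prod (volume.restrict Ω))
  integrable : ∀ t, 0 ≤ t → IntegrableOn (u t) Ω
  continuous_L1 : ∀ t, 0 ≤ t →
    Tendsto (fun τ => ∫ x in Ω, |u τ x - u t x|) (𝓝[Ici 0] t) (𝓝 0)
  initial : u 0 =ᵐ[volume.restrict Ω] u₀
  weak_equation : ∃ g : ℝ → EuclideanSpace ℝ (Fin d) → EuclideanSpace ℝ (Fin d),
    (∀ T, 0 < T → MemLp (fun p : ℝ × EuclideanSpace ℝ (Fin d) => g p.1 p.2) 2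
      ((volume.restrict (Ioc 0 T)).prod (volume.restrict Ω))) ∧
    (∀ᵐ t ∂(volume.restrict (Ioi (0 : ℝ))), HasWeakGradient Ω (fun x => P (u t x)) (g t)) ∧
    ∀ φ : ℝ × EuclideanSpace ℝ (Fin d) → ℝ, ContDiff ℝ ∞ φ → HasCompactSupport φ →
      tsupport φ ⊆ Ioi 0 ×ˢ univ →
      ∫ t in Ioi (0 : ℝ), ∫ x in Ω,
        (u t x * deriv (fun τ => φ (τ, x)) t - inner ℝ (g t x) (∇ (fun y => φ (t, y)) x)) = 0

/-! ### The Neumann potential and the action -/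

/-- `z ∈ C^∞(closure Ω)` solves `-∇·(m(r) ∇z) = f` in `Ω`, `∇z · n = 0` on `∂Ω`, `∫_Ω z dx = 0`. -/
structure IsNeumannPotential {d : ℕ} (m : ℝ → ℝ) (Ω : Set (EuclideanSpace ℝ (Fin d)))
    (r f z : EuclideanSpace ℝ (Fin d) → ℝ) : Prop where
  smooth : SmoothOnNhd z (closure Ω)
  equation : ∀ x ∈ Ω, - divergence (fun y => m (r y) • ∇ z y) x = f x
  neumann : ∀ x ∈ frontier Ω, inner ℝ (∇ z x) (outerNormal Ω x) = 0
  mean_zero : ∫ x in Ω, z x = 0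

/-- The action `∫_Ω m(r) |∇z|² dx`. -/
def action {d : ℕ} (m : ℝ → ℝ) (Ω : Set (EuclideanSpace ℝ (Fin d)))
    (r z : EuclideanSpace ℝ (Fin d) → ℝ) : ℝ :=
  ∫ x in Ω, m (r x) * ‖∇ z x‖ ^ 2

end

open Set Filter MeasureTheory
open scoped Topology ContDiff Gradient Laplacian

noncomputable section

/-! ### Cutoffs and extensions -/

/-! Fix `s` and write ζ_τ, ρ_τ for the potential and the density at time τ, and A for the action.
Testing the Neumann problem gives ∫ m(ρ_τ) ∇ζ_τ·∇ξ = ∫ ∂ₛρ_τ ξ for every smooth ξ. With ξ = ζ_t,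
completing the square yields A(τ) = 2 ∫ ∂ₛρ_τ ζ_t − ∫ m(ρ_τ)|∇ζ_t|² + ∫ m(ρ_τ)|∇(ζ_τ − ζ_t)|². The
last term is O((τ − t)²) by an energy estimate, so A is differentiable although nothing is known
about the dependence of ζ on time (`IsSmoothBoundedDomain.hasDerivAt_action`). The other two terms
involve ζ_t only. The flow satisfies ∂ₜρ = s ΔP(ρ) with no flux. Differentiating its weak form in s
gives ∂ₜ ∫ ∂ₛρ ξ = −∫ ∇P(ρ)·∇ξ − s ∫ ∇(P'(ρ) ∂ₛρ)·∇ξ, whose first term comes from the explicit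
factor s; testing the weak form with m'(ρ)|∇ζ|² gives the derivative of the weight m(ρ).

The remaining terms carry a factor s and form an identity at a fixed time
(`IsSmoothBoundedDomain.integral_identity`). One replaces ∂ₛρ by −∇·(m∇ζ), applies Bochner's formula
½Δ|∇ζ|² = |D²ζ|² + ∇ζ·∇Δζ, and integrates by parts. Since H' = P'm', the products with ∇ρ·∇|∇ζ|² and
with Δζ ∇ρ·∇ζ are absorbed in the divergences of H∇|∇ζ|² and HΔζ∇ζ. The Neumann condition kills all
boundary terms except that of H∇|∇ζ|².

Two analytic inputs are needed. The divergence theorem for the Hausdorff surface measure is proved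
with an error: in a chart where ∂Ω is a graph of slope at most ε, the formula holds up to O(ε)
∫_{∂Ω}|f|. These errors add up without loss under a partition of unity, and ε tends to 0 at the end,
so no area formula is required.

The second input is the bound m₀ ≤ ρ_{s,t} ≤ m₁, because P and m are smooth on [m₀, m₁] only
(`IsWeakDiffusionSolution.mem_Icc_of_initial`). As P is nondecreasing, the weak gradient of P(u)
pairs nonnegatively with ∇η(u) for nondecreasing η; hence a convex entropy vanishing exactly on [m₀,
m₁] does not increase, and L¹ continuity makes it start at 0. Afterwards P and m may be replaced by
C³ functions on ℝ and the weak equation holds at every positive time. -/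

theorem exists_contDiff_cutoff {F : Type*} [NormedAddCommGroup F] [NormedSpace ℝ F]
    [FiniteDimensional ℝ F] {K V : Set F} (hK : IsCompact K) (hV : IsOpen V) (hKV : K ⊆ V) :
    ∃ χ : F → ℝ, ContDiff ℝ ∞ χ ∧ HasCompactSupport χ ∧ tsupport χ ⊆ V ∧
      (∀ x, χ x ∈ Icc (0 : ℝ) 1) ∧ ∀ᶠ x in 𝓝ˢ K, χ x = 1 := by
  obtain ⟨L, hL, hKL, hLV⟩ := exists_compact_between hK hV hKV
  obtain ⟨L', hL', hKL', hLV'⟩ := exists_compact_between hK isOpen_interior hKL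
  obtain ⟨χ, h1, h2, h3, h4⟩ := exists_contMDiff_support_eq_eq_one_iff
    (modelWithCornersSelf ℝ F) (n := ⊤) isOpen_interior hL'.isClosed hLV'
  have hs : tsupport χ ⊆ L := by
    rw [tsupport, h3]
    exact closure_minimal interior_subset hL.isClosed
  refine ⟨χ, contMDiff_iff_contDiff.1 h1, HasCompactSupport.of_support_subset_isCompact hL
    ((subset_tsupport χ).trans hs), hs.trans hLV, fun x => h2 ⟨x, rfl⟩, ?_⟩
  filter_upwards [(isOpen_interior (s := L')).mem_nhdsSet.2 hKL'] with x hx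
  exact (h4 x).1 (interior_subset hx)

/-- Multiplication by a cutoff. Equality on a neighbourhood of `K`, not only on `K`, makes all
derivatives agree at the points of `K`, so data smooth up to the boundary can be replaced by
globally smooth data. -/
theorem ContDiffOn.exists_contDiff_eventuallyEq_nhdsSet {F G : Type*} [NormedAddCommGroup F]
    [NormedSpace ℝ F] [FiniteDimensional ℝ F] [NormedAddCommGroup G] [NormedSpace ℝ G]
    {n : ℕ∞} {f : F → G} {K V : Set F} (hf : ContDiffOn ℝ n f V)
    (hK : IsCompact K) (hV : IsOpen V) (hKV : K ⊆ V) :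
    ∃ f' : F → G, ContDiff ℝ n f' ∧ HasCompactSupport f' ∧ tsupport f' ⊆ V ∧
      f' =ᶠ[𝓝ˢ K] f := by
  obtain ⟨χ, h1, h2, h3, -, h5⟩ := exists_contDiff_cutoff hK hV hKV
  refine ⟨fun x => χ x • f x, ?_, h2.smul_right, (tsupport_smul_subset_left χ f).trans h3, ?_⟩
  · rw [contDiff_iff_contDiffAt]
    intro x
    by_cases hx : x ∈ tsupport χ
    · exact (h1.of_le (by exact_mod_cast le_top)).contDiffAt.smul
        (hf.contDiffAt (hV.mem_nhds (h3 hx)))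
    · have : (fun x => χ x • f x) =ᶠ[𝓝 x] fun _ => 0 := by
        filter_upwards [(isClosed_tsupport χ).isOpen_compl.mem_nhds hx] with y hy
        simp [image_eq_zero_of_notMem_tsupport hy]
      exact contDiffAt_const.congr_of_eventuallyEq this
  · filter_upwards [h5] with x hx
    simp [hx]

/-! ### Orthogonal coordinates adapted to a unit vector -/

section NormalCoord

variable {E : Type*} [NormedAddCommGroup E] [InnerProductSpace ℝ E]

/-- The coordinates `(y, r) ↦ y + r ν` with `y` orthogonal to `ν`. -/
def normalCoord (ν : E) : ((ℝ ∙ ν)ᗮ × ℝ) →L[ℝ] E :=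
  (ℝ ∙ ν)ᗮ.subtypeL.comp (ContinuousLinearMap.fst ℝ _ _) +
    (ContinuousLinearMap.snd ℝ (ℝ ∙ ν)ᗮ ℝ).smulRight ν

theorem normalCoord_apply (ν : E) (p : (ℝ ∙ ν)ᗮ × ℝ) :
    normalCoord ν p = (p.1 : E) + p.2 • ν := by
  simp [normalCoord]

/-- The inverse of `normalCoord`. -/
def normalCoordInv (ν : E) : E →L[ℝ] ((ℝ ∙ ν)ᗮ × ℝ) :=
  (ℝ ∙ ν)ᗮ.orthogonalProjectionOnto.prod (innerSL ℝ ν)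

theorem normalCoordInv_normalCoord {ν : E} (hν : ‖ν‖ = 1) (p : (ℝ ∙ ν)ᗮ × ℝ) :
    normalCoordInv ν (normalCoord ν p) = p := by
  have h1 : inner ℝ ν (p.1 : E) = 0 := Submodule.mem_orthogonal_singleton_iff_inner_right.1 p.1.2
  have h2 : (ℝ ∙ ν)ᗮ.orthogonalProjectionOnto ν = 0 := by
    rw [Submodule.orthogonalProjectionOnto_eq_zero_iff, Submodule.orthogonal_orthogonal]
    exact Submodule.mem_span_singleton_self ν
  ext
  · simp [normalCoordInv, normalCoord_apply, h2]
  · simp [normalCoordInv, normalCoord_apply, inner_add_right, h1, inner_smul_right, hν]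

theorem normalCoord_normalCoordInv {ν : E} (hν : ‖ν‖ = 1) (x : E) :
    normalCoord ν (normalCoordInv ν x) = x := by
  have h := Submodule.starProjection_add_starProjection_orthogonal (K := ℝ ∙ ν) x
  rw [Submodule.starProjection_unit_singleton ℝ hν] at h
  conv_rhs => rw [← h]
  simp [normalCoord_apply, normalCoordInv, add_comm]

/-- `normalCoord` as a continuous linear equivalence. -/
def normalCoordEquiv {ν : E} (hν : ‖ν‖ = 1) : ((ℝ ∙ ν)ᗮ × ℝ) ≃L[ℝ] E :=
  ContinuousLinearEquiv.equivOfInverse (normalCoord ν) (normalCoordInv ν)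
    (normalCoordInv_normalCoord hν) (normalCoord_normalCoordInv hν)

/-- Since `y` is orthogonal to the unit vector `ν`, the map is a linear isometry for the L² norm on
the product, and passing between that norm and the product structure preserves volume. -/
theorem measurePreserving_normalCoord [FiniteDimensional ℝ E] [MeasurableSpace E] [BorelSpace E] {ν : E} (hν : ‖ν‖ = 1) :
    MeasurePreserving (normalCoord ν) (volume : Measure ((ℝ ∙ ν)ᗮ × ℝ)) volume := by
  let e : WithLp 2 ((ℝ ∙ ν)ᗮ × ℝ) ≃ₗᵢ[ℝ] E :=
    { toFun := fun p => normalCoord ν p.ofLp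
      invFun := fun x => WithLp.toLp 2 (normalCoordInv ν x)
      map_add' := fun p q => by simp
      map_smul' := fun c p => by simp
      left_inv := fun p => by simp [normalCoordInv_normalCoord hν]
      right_inv := fun x => by simp [normalCoord_normalCoordInv hν]
      norm_map' := fun p => by
        have h1 : inner ℝ ((p.fst : (ℝ ∙ ν)ᗮ) : E) (p.snd • ν) = 0 := by
          rw [inner_smul_right, Submodule.mem_orthogonal_singleton_iff_inner_left.1 p.fst.2, mul_zero]
        have h2 := norm_add_sq_real ((p.fst : (ℝ ∙ ν)ᗮ) : E) (p.snd • ν)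
        have h3 := WithLp.prod_norm_sq_eq_of_L2 p
        rw [← sq_eq_sq₀ (norm_nonneg _) (norm_nonneg _), h3]
        change ‖normalCoord ν p.ofLp‖ ^ 2 = _
        rw [normalCoord_apply]
        change ‖((p.fst : (ℝ ∙ ν)ᗮ) : E) + p.snd • ν‖ ^ 2 = _
        rw [h2, h1, norm_smul, hν]
        simp }
  have h := e.measurePreserving.comp (WithLp.volume_preserving_toLp (ℝ ∙ ν)ᗮ ℝ)
  exact h

end NormalCoord

/-! ### The boundary of a smooth domain as a graph -/

theorem ContDiff.continuous_gradient {F : Type*} [NormedAddCommGroup F] [InnerProductSpace ℝ F]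
    [CompleteSpace F] {f : F → ℝ} {n : ℕ∞ω} (hf : ContDiff ℝ n f) (hn : n ≠ 0) :
    Continuous (∇ f) :=
  (InnerProductSpace.toDual ℝ F).symm.continuous.comp (hf.continuous_fderiv hn)

section Boundary

variable {d : ℕ} {Ω : Set (EuclideanSpace ℝ (Fin d))} {x : EuclideanSpace ℝ (Fin d)}
  {ψ φ : EuclideanSpace ℝ (Fin d) → ℝ}

theorem IsBoundaryDefining.eventually (h : IsBoundaryDefining Ω x ψ) :
    ∀ᶠ y in 𝓝 x, IsBoundaryDefining Ω y ψ := by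
  obtain ⟨h1, h2, h3⟩ := h
  have hc : Continuous (∇ ψ) := h1.continuous_gradient (by simp)
  filter_upwards [h3.eventually_nhds, hc.continuousAt.eventually_ne h2] with y hy hy'
  exact ⟨h1, hy', hy⟩

theorem IsBoundaryDefining.eq_zero (h : IsBoundaryDefining Ω x ψ) (hx : x ∈ frontier Ω) :
    ψ x = 0 := by
  obtain ⟨h1, h2, h3⟩ := h
  rcases lt_trichotomy (ψ x) 0 with hlt | heq | hgt
  · have : Ω ∈ 𝓝 x := by
      filter_upwards [h3, h1.continuous.continuousAt.eventually_lt_const hlt] with y hy hy'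
      exact hy.2 hy'
    exact absurd (mem_interior_iff_mem_nhds.2 this) hx.2
  · exact heq
  · have : ∀ᶠ y in 𝓝 x, y ∉ Ω := by
      filter_upwards [h3, h1.continuous.continuousAt.eventually_const_lt hgt] with y hy hy' h
      exact absurd (hy.1 h) hy'.not_gt
    have h4 := mem_closure_iff_frequently.1 hx.1
    exact absurd this h4

theorem hasDerivAt_comp_add_smul (hψ : ContDiff ℝ ∞ ψ) (v : EuclideanSpace ℝ (Fin d)) (r : ℝ) :
    HasDerivAt (fun r : ℝ => ψ (x + r • v)) (inner ℝ (∇ ψ (x + r • v)) v) r := by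
  have h1 := ((hψ.differentiable (by simp)) (x + r • v)).hasFDerivAt
  have h2 : HasDerivAt (fun r : ℝ => x + r • v) v r := by
    simpa using ((hasDerivAt_id r).smul_const v).const_add x
  rw [inner_gradient_left]
  exact h1.comp_hasDerivAt r h2

/-- A direction pointing inwards for one defining function points weakly inwards for another. -/
theorem IsBoundaryDefining.inner_nonpos (h : IsBoundaryDefining Ω x ψ)
    (h' : IsBoundaryDefining Ω x φ) (hx : x ∈ frontier Ω) {v : EuclideanSpace ℝ (Fin d)}
    (hv : inner ℝ (∇ ψ x) v < 0) : inner ℝ (∇ φ x) v ≤ 0 := by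
  by_contra! hpos
  have t : Tendsto (fun r : ℝ => x + r • v) (𝓝[>] 0) (𝓝 x) := by
    have : Continuous fun r : ℝ => x + r • v := by fun_prop
    simpa using (this.tendsto 0).mono_left nhdsWithin_le_nhds
  have d1 := hasDerivAt_comp_add_smul (x := x) h.1 v 0
  have d2 := hasDerivAt_comp_add_smul (x := x) h'.1 v 0
  rw [zero_smul, add_zero] at d1 d2
  have e1 := (hasDerivAt_iff_tendsto_slope.1 d1).eventually_lt_const hv
  have e2 := (hasDerivAt_iff_tendsto_slope.1 d2).eventually_const_lt hpos
  have hle : 𝓝[>] (0 : ℝ) ≤ 𝓝[≠] 0 := nhdsWithin_mono _ fun r hr => (ne_of_gt hr)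
  obtain ⟨r, hr1, hr2, hr3, hr4, hr5⟩ := ((e1.filter_mono hle).and ((e2.filter_mono hle).and
    ((t.eventually h.2.2).and ((t.eventually h'.2.2).and self_mem_nhdsWithin)))).exists
  have hr0 : (0 : ℝ) < r := hr5
  simp only [slope_def_field, zero_smul, add_zero, sub_zero, h.eq_zero hx, h'.eq_zero hx] at hr1 hr2
  have k1 : ψ (x + r • v) < 0 := by
    by_contra! hc
    exact absurd hr1 (not_lt.2 (div_nonneg hc hr0.le))
  have k2 : 0 < φ (x + r • v) := by
    by_contra! hc
    exact absurd hr2 (not_lt.2 (div_nonpos_of_nonpos_of_nonneg hc hr0.le))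
  exact absurd (hr4.1 (hr3.2 k1)) k2.not_gt

/-- Independence of the chosen defining function. If two unit normals `a ≠ b` occurred, then `b - a`
would point strictly inwards for the first and strictly outwards for the second, against
`IsBoundaryDefining.inner_nonpos`. -/
theorem IsBoundaryDefining.outerNormal_eq (h : IsBoundaryDefining Ω x ψ) (hx : x ∈ frontier Ω) :
    outerNormal Ω x = ‖∇ ψ x‖⁻¹ • ∇ ψ x := by
  have hex : ∃ ψ, IsBoundaryDefining Ω x ψ := ⟨ψ, h⟩
  rw [outerNormal, dif_pos hex]
  have h' := hex.choose_spec
  set φ := hex.choose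
  have ha : 0 < ‖∇ φ x‖ := norm_pos_iff.2 h'.2.1
  have hb : 0 < ‖∇ ψ x‖ := norm_pos_iff.2 h.2.1
  set a := ‖∇ φ x‖⁻¹ • ∇ φ x with ha'
  set b := ‖∇ ψ x‖⁻¹ • ∇ ψ x with hb'
  have na : ‖a‖ = 1 := by rw [ha', norm_smul, norm_inv, norm_norm, inv_mul_cancel₀ ha.ne']
  have nb : ‖b‖ = 1 := by rw [hb', norm_smul, norm_inv, norm_norm, inv_mul_cancel₀ hb.ne']
  have ea : ∇ φ x = ‖∇ φ x‖ • a := by rw [ha', smul_smul, mul_inv_cancel₀ ha.ne', one_smul]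
  have eb : ∇ ψ x = ‖∇ ψ x‖ • b := by rw [hb', smul_smul, mul_inv_cancel₀ hb.ne', one_smul]
  by_contra hne
  have hlt : inner ℝ a b < 1 := inner_lt_one_iff_real_of_norm_eq_one na nb |>.2 hne
  have k := h'.inner_nonpos h hx (v := b - a) (by
    rw [ea, inner_smul_left, inner_sub_right, real_inner_self_eq_norm_sq, na]
    exact mul_neg_of_pos_of_neg ha (by linarith))
  rw [eb, inner_smul_left, inner_sub_right, real_inner_self_eq_norm_sq, nb, real_inner_comm] at k
  exact absurd k (not_le.2 (mul_pos hb (by linarith)))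

theorem IsSmoothBoundedDomain.norm_outerNormal (hΩ : IsSmoothBoundedDomain Ω)
    (hx : x ∈ frontier Ω) : ‖outerNormal Ω x‖ = 1 := by
  obtain ⟨ψ, h⟩ := hΩ.smooth_boundary x hx
  rw [h.outerNormal_eq hx, norm_smul, norm_inv, norm_norm,
    inv_mul_cancel₀ (norm_ne_zero_iff.2 h.2.1)]

theorem IsSmoothBoundedDomain.continuousOn_outerNormal (hΩ : IsSmoothBoundedDomain Ω) :
    ContinuousOn (outerNormal Ω) (frontier Ω) := by
  intro x hx
  obtain ⟨ψ, h⟩ := hΩ.smooth_boundary x hx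
  have hc : Continuous (∇ ψ) := h.1.continuous_gradient (by simp)
  have h1 : ContinuousAt (fun y => ‖∇ ψ y‖⁻¹ • ∇ ψ y) x :=
    (hc.norm.continuousAt.inv₀ (norm_ne_zero_iff.2 h.2.1)).smul hc.continuousAt
  refine h1.continuousWithinAt.congr_of_eventuallyEq ?_ (h.outerNormal_eq hx)
  filter_upwards [mem_nhdsWithin_of_mem_nhds h.eventually, self_mem_nhdsWithin] with y hy hy'
  exact hy.outerNormal_eq hy'

theorem IsSmoothBoundedDomain.isCompact_frontier (hΩ : IsSmoothBoundedDomain Ω) :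
    IsCompact (frontier Ω) :=
  Metric.isCompact_of_isClosed_isBounded isClosed_frontier
    (hΩ.isBounded.closure.subset frontier_subset_closure)

theorem IsSmoothBoundedDomain.isCompact_closure (hΩ : IsSmoothBoundedDomain Ω) :
    IsCompact (closure Ω) :=
  hΩ.isBounded.isCompact_closure

/-- In the box `B × I` (in the coordinates `normalCoord ν`) the set `Ω` is the strict subgraph of
`g`, which has slope at most `ε`; its boundary is the graph, with normal `ε`-close to `ν`. -/
structure IsGraphChart (Ω : Set (EuclideanSpace ℝ (Fin d))) (ν : EuclideanSpace ℝ (Fin d))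
    (ε : NNReal) (g : (ℝ ∙ ν)ᗮ → ℝ) (B : Set (ℝ ∙ ν)ᗮ) (I : Set ℝ) : Prop where
  norm_eq : ‖ν‖ = 1
  isOpen_base : IsOpen B
  isBounded_base : Bornology.IsBounded B
  isOpen_fibre : IsOpen I
  contDiff : ContDiff ℝ 1 g
  lipschitz : LipschitzOnWith ε g B
  mem_fibre : ∀ y ∈ B, g y ∈ I
  mem_iff : ∀ y ∈ B, ∀ r ∈ I, (normalCoord ν (y, r) ∈ Ω ↔ r < g y)
  frontier_iff : ∀ y ∈ B, ∀ r ∈ I, (normalCoord ν (y, r) ∈ frontier Ω ↔ r = g y)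
  normal_near : ∀ y ∈ B, ‖outerNormal Ω (normalCoord ν (y, g y)) - ν‖ ≤ ε

/-- The implicit function theorem applied to a defining function, solved for the coordinate along
the normal `ν` at `x` itself. With this choice the graph is horizontal at `x`, so its slope and the
deviation of the normal are as small as desired nearby. -/
theorem IsSmoothBoundedDomain.exists_isGraphChart (hΩ : IsSmoothBoundedDomain Ω)
    (hx : x ∈ frontier Ω) {ε : NNReal} (hε : 0 < ε) :
    ∃ (ν : EuclideanSpace ℝ (Fin d)) (g : (ℝ ∙ ν)ᗮ → ℝ) (B : Set (ℝ ∙ ν)ᗮ) (I : Set ℝ),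
      IsGraphChart Ω ν ε g B I ∧ x ∈ normalCoord ν '' (B ×ˢ I) := by
  obtain ⟨ψ, h⟩ := hΩ.smooth_boundary x hx
  have hG : Continuous (∇ ψ) := h.1.continuous_gradient (by simp)
  set ν := outerNormal Ω x with hν
  have hν1 : ‖ν‖ = 1 := hΩ.norm_outerNormal hx
  have hpos : 0 < ‖∇ ψ x‖ := norm_pos_iff.2 h.2.1
  have hνψ : ∇ ψ x = ‖∇ ψ x‖ • ν := by
    rw [hν, h.outerNormal_eq hx, smul_smul, mul_inv_cancel₀ hpos.ne', one_smul]
  set T := normalCoord ν with hT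
  set u := normalCoordInv ν x with hu
  have hTu : T u = x := normalCoord_normalCoordInv hν1 x
  have hTν : ∀ y r, T (y, r) = T (y, 0) + r • ν := fun y r => by
    simp [hT, normalCoord_apply]
  let Ψ : (ℝ ∙ ν)ᗮ × ℝ → ℝ := fun p => ψ (T p)
  have hΨ : ContDiff ℝ ∞ Ψ := h.1.comp T.contDiff
  have hfd : ∀ p, fderiv ℝ Ψ p = (fderiv ℝ ψ (T p)).comp T := fun p => by
    have := (((h.1.differentiable (by simp)) (T p)).hasFDerivAt.comp p T.hasFDerivAt).fderiv
    exact this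
  have hΨu : Ψ u = 0 := by simp only [Ψ, hTu]; exact h.eq_zero hx
  have hder : ∀ y r, HasDerivAt (fun r => Ψ (y, r)) (inner ℝ (∇ ψ (T (y, r))) ν) r := by
    intro y r
    have := hasDerivAt_comp_add_smul (x := T (y, 0)) h.1 ν r
    simp only [← hTν] at this
    exact this
  have hνin : inner ℝ (∇ ψ x) ν = ‖∇ ψ x‖ := by
    rw [hνψ, inner_smul_left, real_inner_self_eq_norm_sq, hν1, norm_smul, hν1]; simp
  have cdf : ContDiffAt ℝ ∞ Ψ u := hΨ.contDiffAt
  have hinr : (fderiv ℝ Ψ u).comp (ContinuousLinearMap.inr ℝ (ℝ ∙ ν)ᗮ ℝ) =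
      (ContinuousLinearEquiv.unitsEquivAut ℝ (Units.mk0 ‖∇ ψ x‖ hpos.ne') : ℝ →L[ℝ] ℝ) := by
    ext
    simp only [hfd, hTu, ContinuousLinearMap.comp_apply, ContinuousLinearMap.inr_apply,
      ← inner_gradient_left]
    rw [hTν, show ((0 : (ℝ ∙ ν)ᗮ), (0 : ℝ)) = 0 from rfl, map_zero]
    simp [hνin]
  have if2 : ((fderiv ℝ Ψ u).comp (ContinuousLinearMap.inr ℝ (ℝ ∙ ν)ᗮ ℝ)).IsInvertible :=
    ⟨_, hinr.symm⟩
  have hn : (∞ : ℕ∞ω) ≠ 0 := by simp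
  set g₀ := cdf.implicitFunction hn if2 with hg₀
  have hg0u : g₀ u.1 = u.2 := cdf.implicitFunction_apply_self hn if2
  have hg0c : ContDiffAt ℝ ∞ g₀ u.1 := cdf.contDiffAt_implicitFunction hn if2
  -- `∇ψ x` is parallel to `ν`, so the tangential derivative of `Ψ` vanishes at `u`. A strict
  -- derivative equal to zero gives Lipschitz constant `ε` on some neighbourhood.
  have hg0s : HasStrictFDerivAt g₀ (0 : (ℝ ∙ ν)ᗮ →L[ℝ] ℝ) u.1 := by
    have hinl : (fderiv ℝ Ψ u).comp (ContinuousLinearMap.inl ℝ (ℝ ∙ ν)ᗮ ℝ) = 0 := by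
      ext y
      simp only [hfd, hTu, ContinuousLinearMap.comp_apply, ContinuousLinearMap.inl_apply,
        ← inner_gradient_left]
      rw [hνψ, inner_smul_left, hT, normalCoord_apply]
      have hy : inner ℝ ν (y : EuclideanSpace ℝ (Fin d)) = 0 :=
        Submodule.mem_orthogonal_singleton_iff_inner_right.1 y.2
      simp [hy]
    have := cdf.hasStrictFDerivAt_implicitFunction hn if2
    rw [hinl, ContinuousLinearMap.comp_zero, neg_zero] at this
    exact this
  obtain ⟨N, hN, hlip⟩ := hg0s.exists_lipschitzOnWith_of_nnnorm_lt ε (by simpa using hε)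
  -- a global `C^1` representative
  obtain ⟨O, hO, hgO⟩ : ∃ O ∈ 𝓝 u.1, ContDiffOn ℝ 1 g₀ O := by
    have := hg0c.contDiffOn (m := 1) (by exact_mod_cast le_top) (by simp)
    obtain ⟨O, hO, h'⟩ := this
    exact ⟨O, by simpa using hO, h'⟩
  obtain ⟨O', hO'O, hO'o, hO'u⟩ := mem_nhds_iff.1 hO
  obtain ⟨g, hg1, -, -, hgg⟩ := ContDiffOn.exists_contDiff_eventuallyEq_nhdsSet (n := 1)
    (hgO.mono hO'O) (isCompact_singleton (x := u.1)) hO'o (by simpa using hO'u)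
  rw [nhdsSet_singleton] at hgg
  -- neighbourhoods
  have hTc : Tendsto T (𝓝 u) (𝓝 x) := by
    have := T.continuous.tendsto u
    rwa [hTu] at this
  have A1 : ∀ᶠ p in 𝓝 u, IsBoundaryDefining Ω (T p) ψ := hTc.eventually h.eventually
  have A2 : ∀ᶠ p in 𝓝 u, 0 < inner ℝ (∇ ψ (T p)) ν := by
    have c : Continuous fun p => inner ℝ (∇ ψ (T p)) ν :=
      (hG.comp T.continuous).inner continuous_const
    refine c.continuousAt.eventually_const_lt ?_
    change 0 < inner ℝ (∇ ψ (T u)) ν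
    rw [hTu, hνin]; exact hpos
  have A3 : ∀ᶠ p in 𝓝 u, ‖‖∇ ψ (T p)‖⁻¹ • ∇ ψ (T p) - ν‖ < ε := by
    have c1 : ContinuousAt (fun p => ∇ ψ (T p)) u := (hG.comp T.continuous).continuousAt
    have c : ContinuousAt (fun p => ‖‖∇ ψ (T p)‖⁻¹ • ∇ ψ (T p) - ν‖) u :=
      (((c1.norm.inv₀ (by rw [hTu]; exact hpos.ne')).smul c1).sub continuousAt_const).norm
    refine c.eventually_lt_const ?_
    change ‖‖∇ ψ (T u)‖⁻¹ • ∇ ψ (T u) - ν‖ < ε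
    rw [hTu, ← h.outerNormal_eq hx, ← hν, sub_self, norm_zero]
    exact_mod_cast hε
  rw [← Prod.mk.eta (p := u), nhds_prod_eq] at A1 A2 A3
  obtain ⟨pa, hpa, pb, hpb, hpab⟩ := eventually_prod_iff.1 (A1.and (A2.and A3))
  obtain ⟨δ, hδ, hδI⟩ := Metric.eventually_nhds_iff_ball.1 hpb
  set I := Metric.ball u.2 δ with hI
  have B1 : ∀ᶠ y in 𝓝 u.1, g y ∈ I := by
    have : Tendsto g (𝓝 u.1) (𝓝 u.2) := by
      have := hg1.continuous.tendsto u.1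
      rwa [hgg.self_of_nhds, hg0u] at this
    exact this.eventually (Metric.ball_mem_nhds _ hδ)
  have B2 : ∀ᶠ y in 𝓝 u.1, Ψ (y, g y) = 0 := by
    filter_upwards [cdf.eventually_apply_implicitFunction hn if2, hgg] with y hy hy'
    rw [hy', hy, hΨu]
  obtain ⟨δ', hδ', hB⟩ := Metric.eventually_nhds_iff_ball.1
    (hpa.and (B1.and (B2.and (hgg.and (eventually_mem_set.2 hN)))))
  set B := Metric.ball u.1 δ' with hBdef
  -- Along each fibre `Ψ` increases strictly and vanishes at `g y`, so its sign is decided by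
  -- comparing `r` with `g y`.
  have hmono : ∀ y ∈ B, StrictMonoOn (fun r => Ψ (y, r)) I := by
    intro y hy
    refine strictMonoOn_of_deriv_pos (convex_ball _ _)
      (fun r _ => (hder y r).continuousAt.continuousWithinAt) fun r hr => ?_
    rw [Metric.isOpen_ball.interior_eq] at hr
    rw [(hder y r).deriv]
    exact (hpab (hB y hy).1 (hδI r hr)).2.1
  have hmem : ∀ y ∈ B, ∀ r ∈ I, (T (y, r) ∈ Ω ↔ r < g y) := by
    intro y hy r hr
    have h1 := (hpab (hB y hy).1 (hδI r hr)).1.2.2.self_of_nhds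
    rw [h1]
    have h2 := (hB y hy).2.2.1
    have h3 := (hmono y hy).lt_iff_lt hr (hB y hy).2.1
    simp only [h2] at h3
    exact h3
  have hfr : ∀ y ∈ B, ∀ r ∈ I, (T (y, r) ∈ frontier Ω ↔ r = g y) := by
    intro y hy r hr
    have h1 := (hpab (hB y hy).1 (hδI r hr)).1
    have h2 := (hB y hy).2.2.1
    constructor
    · intro hf
      have h3 : Ψ (y, r) = Ψ (y, g y) := (h1.eq_zero hf).trans h2.symm
      exact (hmono y hy).injOn hr (hB y hy).2.1 h3
    · rintro rfl
      refine ⟨?_, fun hi => ?_⟩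
      · rw [mem_closure_iff_frequently]
        have ht : Tendsto (fun r => T (y, r)) (𝓝[<] g y) (𝓝 (T (y, g y))) := by
          have c : Continuous fun r => T (y, r) := by fun_prop
          exact (c.tendsto _).mono_left nhdsWithin_le_nhds
        refine ht.frequently (Eventually.frequently ?_)
        filter_upwards [self_mem_nhdsWithin,
          mem_nhdsWithin_of_mem_nhds (Metric.isOpen_ball.mem_nhds (hB y hy).2.1)] with r hr1 hr2
        exact (hmem y hy r hr2).2 hr1
      · exact lt_irrefl _ ((hmem y hy _ hr).1 (interior_subset hi))
  refine ⟨ν, g, B, I, ⟨hν1, Metric.isOpen_ball, Metric.isBounded_ball, Metric.isOpen_ball, hg1, ?_, ?_, hmem, hfr, ?_⟩, ?_⟩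
  · intro y hy z hz
    rw [(hB y hy).2.2.2.1, (hB z hz).2.2.2.1]
    exact hlip (hB y hy).2.2.2.2 (hB z hz).2.2.2.2
  · exact fun y hy => (hB y hy).2.1
  · intro y hy
    have h1 := hpab (hB y hy).1 (hδI _ (hB y hy).2.1)
    rw [h1.1.outerNormal_eq ((hfr y hy _ (hB y hy).2.1).2 rfl)]
    exact h1.2.2.le
  · exact ⟨u, ⟨Metric.mem_ball_self hδ', Metric.mem_ball_self hδ⟩, hTu⟩

end Boundary

/-! ### Integration by parts over a subgraph -/

section Subgraph

theorem integral_fderiv_apply_eq_zero {F : Type*} [NormedAddCommGroup F] [NormedSpace ℝ F]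
    [MeasurableSpace F] [BorelSpace F] [FiniteDimensional ℝ F] {μ : Measure F}
    [μ.IsAddHaarMeasure] {f : F → ℝ} (hf : ContDiff ℝ 1 f) (hc : HasCompactSupport f) (v : F) :
    ∫ x, fderiv ℝ f x v ∂μ = 0 := by
  have h1 : Integrable f μ := hf.continuous.integrable_of_hasCompactSupport hc
  have h2 : Integrable (fun x => fderiv ℝ f x v) μ :=
    ((hf.continuous_fderiv one_ne_zero).clm_apply continuous_const).integrable_of_hasCompactSupport
      (hc.fderiv_apply ℝ v)
  have := integral_mul_fderiv_eq_neg_fderiv_mul_of_integrable (μ := μ) (f := fun _ : F => (1 : ℝ))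
    (g := f) (v := v) (by simp) (by simpa using h2) (by simpa using h1)
    (fun x _ => differentiableAt_const _) (fun x _ => (hf.differentiable one_ne_zero) x)
  simpa using this

variable {V : Type*} [NormedAddCommGroup V] [InnerProductSpace ℝ V] [FiniteDimensional ℝ V]
  [MeasurableSpace V] [BorelSpace V]

theorem setIntegral_halfSpace (φ : V × ℝ → ℝ) (hφ : Integrable φ) :
    ∫ p in {p : V × ℝ | p.2 < 0}, φ p = ∫ y, ∫ r in Iic (0 : ℝ), φ (y, r) := by
  have h : {p : V × ℝ | p.2 < 0} = univ ×ˢ Iio (0 : ℝ) := by ext p; simp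
  rw [h, Measure.volume_eq_prod, setIntegral_prod _ hφ.integrableOn, Measure.restrict_univ]
  simp_rw [integral_Iic_eq_integral_Iio]

theorem setIntegral_halfSpace_symm (φ : V × ℝ → ℝ) (hφ : Integrable φ) :
    ∫ p in {p : V × ℝ | p.2 < 0}, φ p = ∫ r in Iio (0 : ℝ), ∫ y, φ (y, r) := by
  have h : {p : V × ℝ | p.2 < 0} = univ ×ˢ Iio (0 : ℝ) := by ext p; simp
  rw [h, Measure.volume_eq_prod, ← Measure.prod_restrict, Measure.restrict_univ]
  refine integral_prod_symm _ ?_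
  have := hφ.integrableOn (s := univ ×ˢ Iio (0 : ℝ))
  rwa [IntegrableOn, Measure.volume_eq_prod, ← Measure.prod_restrict, Measure.restrict_univ] at this

omit [InnerProductSpace ℝ V] [FiniteDimensional ℝ V] [MeasurableSpace V] [BorelSpace V] in
theorem HasCompactSupport.comp_prodMk_left {k : V × ℝ → ℝ} (hc : HasCompactSupport k) (y : V) :
    HasCompactSupport fun r => k (y, r) :=
  hc.comp_isClosedEmbedding (Topology.IsClosedEmbedding.of_continuous_injective_isClosedMap
    (by fun_prop) (fun a b h => by simpa using h)
    (isClosedMap_prodMk_left y))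

omit [InnerProductSpace ℝ V] [FiniteDimensional ℝ V] [MeasurableSpace V] [BorelSpace V] in
theorem HasCompactSupport.comp_prodMk_right {k : V × ℝ → ℝ} (hc : HasCompactSupport k) (r : ℝ) :
    HasCompactSupport fun y => k (y, r) :=
  hc.comp_isClosedEmbedding (Topology.IsClosedEmbedding.of_continuous_injective_isClosedMap
    (by fun_prop) (fun a b h => by simpa using h)
    (isClosedMap_prodMk_right r))

/-- The fundamental theorem of calculus on each fibre. The weight `θ` is constant along fibres, so
mere continuity suffices; it will be a derivative of the graph function. -/
theorem setIntegral_halfSpace_fderiv_snd {k : V × ℝ → ℝ} (hk : ContDiff ℝ 1 k)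
    (hc : HasCompactSupport k) {θ : V → ℝ} (hθ : Continuous θ) :
    ∫ p in {p : V × ℝ | p.2 < 0}, θ p.1 * fderiv ℝ k p (0, 1) = ∫ y, θ y * k (y, 0) := by
  have hi : Integrable fun p : V × ℝ => θ p.1 * fderiv ℝ k p (0, 1) := by
    refine Continuous.integrable_of_hasCompactSupport ?_ ((hc.fderiv_apply ℝ _).mul_left)
    exact (hθ.comp continuous_fst).mul
      ((hk.continuous_fderiv one_ne_zero).clm_apply continuous_const)
  rw [setIntegral_halfSpace _ hi]
  congr 1 with y
  change ∫ r in Iic (0 : ℝ), θ y * fderiv ℝ k (y, r) (0, 1) = _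
  rw [integral_const_mul]
  congr 1
  have h1 : ∀ r, deriv (fun r => k (y, r)) r = fderiv ℝ k (y, r) (0, 1) := fun r =>
    (((hk.differentiable one_ne_zero) (y, r)).hasFDerivAt.comp_hasDerivAt r
      ((hasDerivAt_const r y).prodMk (hasDerivAt_id r))).deriv
  simp_rw [← h1]
  exact HasCompactSupport.integral_Iic_deriv_eq (hk.comp (by fun_prop)) (hc.comp_prodMk_left y) 0

theorem setIntegral_halfSpace_fderiv_fst {k : V × ℝ → ℝ} (hk : ContDiff ℝ 1 k)
    (hc : HasCompactSupport k) (e : V) :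
    ∫ p in {p : V × ℝ | p.2 < 0}, fderiv ℝ k p (e, 0) = 0 := by
  have hi : Integrable fun p : V × ℝ => fderiv ℝ k p (e, 0) := by
    refine Continuous.integrable_of_hasCompactSupport ?_ (hc.fderiv_apply ℝ _)
    exact (hk.continuous_fderiv one_ne_zero).clm_apply continuous_const
  rw [setIntegral_halfSpace_symm _ hi]
  have h1 : ∀ r y, fderiv ℝ (fun y => k (y, r)) y e = fderiv ℝ k (y, r) (e, 0) := fun r y => by
    have h4 : HasFDerivAt (fun y : V => (y, r)) ((ContinuousLinearMap.id ℝ V).prod 0) y :=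
      (hasFDerivAt_id y).prodMk (hasFDerivAt_const r y)
    have := ((hk.differentiable one_ne_zero) (y, r)).hasFDerivAt.comp y h4
    have h2 := this.fderiv
    simp only [Function.comp_def] at h2
    rw [h2]; simp
  have h3 : ∀ r : ℝ, ∫ y, fderiv ℝ k (y, r) (e, 0) = 0 := fun r => by
    simp_rw [← h1]
    exact integral_fderiv_apply_eq_zero (hk.comp (by fun_prop)) (hc.comp_prodMk_right r) e
  simp [h3]

/-- The shear `(y, r) ↦ (y, r + g y)`. -/
def shear {g : V → ℝ} (hg : Continuous g) : V × ℝ ≃ₜ V × ℝ where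
  toFun p := (p.1, p.2 + g p.1)
  invFun p := (p.1, p.2 - g p.1)
  left_inv p := by simp
  right_inv p := by simp

theorem measurePreserving_shear {g : V → ℝ} (hg : Continuous g) :
    MeasurePreserving (shear hg) (volume : Measure (V × ℝ)) volume := by
  refine (MeasurePreserving.id (volume : Measure V)).skew_product (g := fun y r => r + g y) ?_ ?_
  · exact (continuous_snd.add (hg.comp continuous_fst)).measurable
  · exact Eventually.of_forall fun y => map_add_right_eq_self volume (g y)

theorem setIntegral_subgraph {g : V → ℝ} (hg : Continuous g) (φ : V × ℝ → ℝ) :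
    ∫ p in {p : V × ℝ | p.2 < g p.1}, φ p =
      ∫ p in {p : V × ℝ | p.2 < 0}, φ (p.1, p.2 + g p.1) := by
  rw [← (measurePreserving_shear hg).setIntegral_preimage_emb
    (shear hg).measurableEmbedding φ]
  congr 2
  ext p
  simp [shear]

omit [FiniteDimensional ℝ V] [MeasurableSpace V] [BorelSpace V] in
theorem fderiv_comp_shear {k : V × ℝ → ℝ} (hk : ContDiff ℝ 1 k) {g : V → ℝ} (hg : ContDiff ℝ 1 g)
    (p : V × ℝ) (e : V) (r : ℝ) :
    fderiv ℝ (fun p : V × ℝ => k (p.1, p.2 + g p.1)) p (e, r) =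
      fderiv ℝ k (p.1, p.2 + g p.1) (e, r + fderiv ℝ g p.1 e) := by
  have h1 : HasFDerivAt (fun p : V × ℝ => (p.1, p.2 + g p.1)) _ p :=
    hasFDerivAt_fst.prodMk (hasFDerivAt_snd.add
      (((hg.differentiable one_ne_zero) p.1).hasFDerivAt.comp p hasFDerivAt_fst))
  have h2 := (((hk.differentiable one_ne_zero) (p.1, p.2 + g p.1)).hasFDerivAt.comp p h1).fderiv
  simp only [Function.comp_def] at h2
  rw [h2]
  simp

theorem setIntegral_subgraph_fderiv_snd {k : V × ℝ → ℝ} (hk : ContDiff ℝ 1 k)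
    (hc : HasCompactSupport k) {g : V → ℝ} (hg : ContDiff ℝ 1 g) :
    ∫ p in {p : V × ℝ | p.2 < g p.1}, fderiv ℝ k p (0, 1) = ∫ y, k (y, g y) := by
  rw [setIntegral_subgraph hg.continuous]
  have h := setIntegral_halfSpace_fderiv_snd (k := fun p : V × ℝ => k (p.1, p.2 + g p.1))
    (hk.comp (by fun_prop)) (hc.comp_homeomorph (shear hg.continuous)) (θ := fun _ => 1)
    continuous_const
  simpa [fderiv_comp_shear hk hg] using h

/-- After flattening by the shear, the horizontal derivative of `k` becomes the horizontal
derivative of the sheared function `k'` minus `∂ₑg` times its vertical derivative. The former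
integrates to zero over the half space, the latter leaves a boundary term. Only first derivatives of
`g` occur. -/
theorem setIntegral_subgraph_fderiv_fst {k : V × ℝ → ℝ} (hk : ContDiff ℝ 1 k)
    (hc : HasCompactSupport k) {g : V → ℝ} (hg : ContDiff ℝ 1 g) (e : V) :
    ∫ p in {p : V × ℝ | p.2 < g p.1}, fderiv ℝ k p (e, 0) =
      - ∫ y, fderiv ℝ g y e * k (y, g y) := by
  rw [setIntegral_subgraph hg.continuous]
  set k' := fun p : V × ℝ => k (p.1, p.2 + g p.1) with hk'
  have hk1 : ContDiff ℝ 1 k' := hk.comp (by fun_prop)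
  have hkc : HasCompactSupport k' := hc.comp_homeomorph (shear hg.continuous)
  have hθ : Continuous fun y => fderiv ℝ g y e :=
    (hg.continuous_fderiv one_ne_zero).clm_apply continuous_const
  have h1 := setIntegral_halfSpace_fderiv_snd hk1 hkc hθ
  have h2 := setIntegral_halfSpace_fderiv_fst hk1 hkc e
  have hi : ∀ w : V × ℝ, Continuous fun p : V × ℝ => fderiv ℝ k' p w := fun w =>
    (hk1.continuous_fderiv one_ne_zero).clm_apply continuous_const
  have h3 : ∀ p : V × ℝ, fderiv ℝ k (p.1, p.2 + g p.1) (e, 0) =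
      fderiv ℝ k' p (e, 0) - fderiv ℝ g p.1 e * fderiv ℝ k' p (0, 1) := by
    intro p
    rw [hk', fderiv_comp_shear hk hg, fderiv_comp_shear hk hg, ← smul_eq_mul, ← map_smul,
      ← map_sub]
    simp
  simp_rw [h3]
  rw [integral_sub, h1, h2]
  · simp [hk']
  · exact ((hi _).integrable_of_hasCompactSupport (hkc.fderiv_apply ℝ _)).integrableOn
  · exact (((hθ.comp continuous_fst).mul (hi _)).integrable_of_hasCompactSupport
      (hkc.fderiv_apply ℝ _).mul_left).integrableOn

end Subgraph

/-! ### Comparison of the surface measure with the measure in a chart -/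

open scoped NNReal ENNReal

theorem LipschitzOnWith.euclideanHausdorffMeasure_image_le {X Y : Type*} [EMetricSpace X]
    [EMetricSpace Y] [MeasurableSpace X] [BorelSpace X] [MeasurableSpace Y] [BorelSpace Y]
    {K : ℝ≥0} {f : X → Y} {s : Set X} (h : LipschitzOnWith K f s) (k : ℕ) :
    μHE[k] (f '' s) ≤ (K : ℝ≥0∞) ^ k * μHE[k] s := by
  have := h.hausdorffMeasure_image_le (d := (k : ℝ)) (by positivity)
  rw [ENNReal.rpow_natCast] at this
  rw [Measure.euclideanHausdorffMeasure_def, Measure.euclideanHausdorffMeasure_def,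
    Measure.smul_apply, Measure.smul_apply, ENNReal.smul_def, ENNReal.smul_def, smul_eq_mul,
    smul_eq_mul, mul_left_comm]
  gcongr

/-- The difference `ν - μ` is a positive measure bounded by `(c - 1) μ`, and the difference of the
integrals is the integral against it. -/
theorem abs_integral_sub_integral_le {X : Type*} [MeasurableSpace X] {μ ν : Measure X}
    [IsFiniteMeasure μ] {c : ℝ≥0} (h1 : μ ≤ ν) (h2 : ν ≤ c • μ)
    {f : X → ℝ} (hf : Integrable f ν) :
    |∫ x, f x ∂ν - ∫ x, f x ∂μ| ≤ (c - 1) * ∫ x, |f x| ∂μ := by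
  have hfμ : Integrable f μ := hf.mono_measure h1
  have hδ : ν - μ ≤ ν := Measure.sub_le
  have hadd : ν - μ + μ = ν := Measure.sub_add_cancel_of_le h1
  have key : ∀ g : X → ℝ, Integrable g ν →
      ∫ x, g x ∂ν = ∫ x, g x ∂(ν - μ) + ∫ x, g x ∂μ := fun g hg => by
    conv_lhs => rw [← hadd]
    exact integral_add_measure (hg.mono_measure hδ) (hg.mono_measure h1)
  have e1 := key f hf
  have e2 := key _ hf.abs
  have e3 : ∫ x, |f x| ∂ν ≤ c * ∫ x, |f x| ∂μ := by
    have := integral_mono_measure h2 (Eventually.of_forall fun x => abs_nonneg (f x))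
      (hfμ.abs.smul_measure_nnreal (c := c))
    rwa [integral_smul_nnreal_measure] at this
  have e4 : |∫ x, f x ∂(ν - μ)| ≤ ∫ x, |f x| ∂(ν - μ) := abs_integral_le_integral_abs
  rw [e1, add_sub_cancel_right]
  nlinarith

section Chart

variable {d : ℕ} {Ω : Set (EuclideanSpace ℝ (Fin d))} {ν : EuclideanSpace ℝ (Fin d)}
  {ε : ℝ≥0} {g : (ℝ ∙ ν)ᗮ → ℝ} {B : Set (ℝ ∙ ν)ᗮ} {I : Set ℝ}

/-- The graph parametrisation of the boundary. -/
def graphMap (ν : EuclideanSpace ℝ (Fin d)) (g : (ℝ ∙ ν)ᗮ → ℝ) (y : (ℝ ∙ ν)ᗮ) :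
    EuclideanSpace ℝ (Fin d) :=
  normalCoord ν (y, g y)

theorem normalCoordInv_fst_lipschitz (ν : EuclideanSpace ℝ (Fin d)) :
    LipschitzWith 1 fun x => (normalCoordInv ν x).1 := by
  refine LipschitzWith.of_dist_le_mul fun x y => ?_
  have : (normalCoordInv ν x).1 - (normalCoordInv ν y).1 =
      (ℝ ∙ ν)ᗮ.orthogonalProjectionOnto (x - y) := by simp [normalCoordInv]
  rw [dist_eq_norm, dist_eq_norm, this]
  simpa using (ℝ ∙ ν)ᗮ.norm_orthogonalProjectionOnto_apply_le (x - y)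

namespace IsGraphChart

variable (h : IsGraphChart Ω ν ε g B I)
include h

theorem continuous_graphMap : Continuous (graphMap ν g) :=
  (normalCoord ν).continuous.comp (continuous_id.prodMk h.contDiff.continuous)

theorem lipschitzOnWith_graphMap : LipschitzOnWith (1 + ε) (graphMap ν g) B := by
  refine LipschitzOnWith.of_dist_le_mul fun y hy z hz => ?_
  have h1 := h.lipschitz.dist_le_mul y hy z hz
  have h2 : graphMap ν g y - graphMap ν g z = ((y - z : (ℝ ∙ ν)ᗮ) : EuclideanSpace ℝ (Fin d)) +
      (g y - g z) • ν := by
    simp only [graphMap, normalCoord_apply, sub_smul, Submodule.coe_sub]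
    abel
  rw [dist_eq_norm, h2]
  refine (norm_add_le _ _).trans ?_
  rw [norm_smul, h.norm_eq, mul_one, ← dist_eq_norm (g y)]
  rw [NNReal.coe_add, NNReal.coe_one, add_mul, one_mul]
  exact add_le_add (by rw [dist_eq_norm]; rfl) h1

theorem isOpen_box : IsOpen (normalCoord ν '' (B ×ˢ I)) :=
  (normalCoordEquiv h.norm_eq).toHomeomorph.isOpenMap _ (h.isOpen_base.prod h.isOpen_fibre)

theorem frontier_inter_box : frontier Ω ∩ normalCoord ν '' (B ×ˢ I) = graphMap ν g '' B := by
  ext x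
  constructor
  · rintro ⟨hx, ⟨⟨y, r⟩, ⟨hy, hr⟩, rfl⟩⟩
    exact ⟨y, hy, by rw [(h.frontier_iff y hy r hr).1 hx, graphMap]⟩
  · rintro ⟨y, hy, rfl⟩
    exact ⟨(h.frontier_iff y hy _ (h.mem_fibre y hy)).2 rfl, ⟨_, ⟨hy, h.mem_fibre y hy⟩, rfl⟩⟩

theorem finrank_base : Module.finrank ℝ (ℝ ∙ ν)ᗮ = d - 1 := by
  have h1 := Submodule.finrank_add_finrank_orthogonal (ℝ ∙ ν)
  have hν : ν ≠ 0 := by rintro rfl; simpa using h.norm_eq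
  rw [finrank_span_singleton hν, finrank_euclideanSpace_fin] at h1
  omega

/-- Projection along `ν` is 1-Lipschitz and inverts the graph parametrisation. Together with the
Lipschitz bound of the parametrisation this compares the surface measure with Lebesgue measure up to
a factor tending to 1 with `ε`, which replaces the area formula. -/
theorem volume_le_surface {A : Set (ℝ ∙ ν)ᗮ} :
    volume A ≤ μHE[d - 1] (graphMap ν g '' A) := by
  have h1 := ((normalCoordInv_fst_lipschitz ν).lipschitzOnWith
    (s := graphMap ν g '' A)).euclideanHausdorffMeasure_image_le (d - 1)
  have h2 : (fun x => (normalCoordInv ν x).1) '' (graphMap ν g '' A) = A := by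
    rw [image_image]
    simp [graphMap, normalCoordInv_normalCoord h.norm_eq]
  rw [h2] at h1
  rw [← InnerProductSpace.euclideanHausdorffMeasure_eq_volume, h.finrank_base]
  simpa using h1

theorem surface_le_volume {A : Set (ℝ ∙ ν)ᗮ} (hA : A ⊆ B) :
    μHE[d - 1] (graphMap ν g '' A) ≤ ((1 + ε : ℝ≥0) : ℝ≥0∞) ^ (d - 1) * volume A := by
  have h1 := (h.lipschitzOnWith_graphMap.mono hA).euclideanHausdorffMeasure_image_le (d - 1)
  rwa [← InnerProductSpace.euclideanHausdorffMeasure_eq_volume, h.finrank_base]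

theorem isFiniteMeasure_base : IsFiniteMeasure (volume.restrict B) :=
  ⟨by simpa using h.isBounded_base.measure_lt_top⟩

theorem preimage_inter (A : Set (EuclideanSpace ℝ (Fin d))) :
    A ∩ (frontier Ω ∩ normalCoord ν '' (B ×ˢ I)) =
      graphMap ν g '' (graphMap ν g ⁻¹' A ∩ B) := by
  rw [h.frontier_inter_box, inter_comm (graphMap ν g ⁻¹' A), image_inter_preimage, inter_comm]

theorem map_le_surface :
    Measure.map (graphMap ν g) (volume.restrict B) ≤
      (μHE[d - 1]).restrict (frontier Ω ∩ normalCoord ν '' (B ×ˢ I)) := by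
  refine Measure.le_iff.2 fun A hA => ?_
  have hm := h.continuous_graphMap.measurable
  rw [Measure.map_apply hm hA, Measure.restrict_apply (hm hA), Measure.restrict_apply hA,
    h.preimage_inter]
  exact h.volume_le_surface

theorem surface_le_map :
    (μHE[d - 1]).restrict (frontier Ω ∩ normalCoord ν '' (B ×ˢ I)) ≤
      ((1 + ε) ^ (d - 1) : ℝ≥0) • Measure.map (graphMap ν g) (volume.restrict B) := by
  refine Measure.le_iff.2 fun A hA => ?_
  have hm := h.continuous_graphMap.measurable
  rw [Measure.smul_apply, Measure.map_apply hm hA, Measure.restrict_apply (hm hA),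
    Measure.restrict_apply hA, h.preimage_inter, ENNReal.smul_def, smul_eq_mul, ENNReal.coe_pow]
  exact h.surface_le_volume inter_subset_right

theorem surface_lt_top :
    μHE[d - 1] (frontier Ω ∩ normalCoord ν '' (B ×ˢ I)) < ⊤ := by
  rw [h.frontier_inter_box]
  exact (h.surface_le_volume subset_rfl).trans_lt (ENNReal.mul_lt_top (by finiteness)
    h.isBounded_base.measure_lt_top)

end IsGraphChart

end Chart

/-! ### The divergence theorem -/

section Divergence

variable {d : ℕ} {Ω : Set (EuclideanSpace ℝ (Fin d))}

/-! ### The Gauss–Green formula with a small error in one chart -/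

namespace IsGraphChart

variable {ν : EuclideanSpace ℝ (Fin d)} {ε : ℝ≥0} {g : (ℝ ∙ ν)ᗮ → ℝ} {B : Set (ℝ ∙ ν)ᗮ} {I : Set ℝ}
  (h : IsGraphChart Ω ν ε g B I) {f : EuclideanSpace ℝ (Fin d) → ℝ}
include h

/-- `Ω` and the subgraph need to agree only inside the box, as the integrand vanishes elsewhere. -/
theorem setIntegral_eq_subgraph {φ : EuclideanSpace ℝ (Fin d) → ℝ}
    (hφ : ∀ x ∉ normalCoord ν '' (B ×ˢ I), φ x = 0) (hΩ : MeasurableSet Ω) :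
    ∫ x in Ω, φ x = ∫ p in {p : (ℝ ∙ ν)ᗮ × ℝ | p.2 < g p.1}, φ (normalCoord ν p) := by
  have hm : MeasurableSet {p : (ℝ ∙ ν)ᗮ × ℝ | p.2 < g p.1} :=
    measurableSet_lt measurable_snd (h.contDiff.continuous.measurable.comp measurable_fst)
  rw [← integral_indicator hΩ, ← integral_indicator hm,
    ← (measurePreserving_normalCoord h.norm_eq).integral_comp
      (normalCoordEquiv h.norm_eq).toHomeomorph.measurableEmbedding]
  congr 1 with p
  by_cases hp : p ∈ B ×ˢ I
  · have := h.mem_iff p.1 hp.1 p.2 hp.2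
    by_cases hlt : p.2 < g p.1
    · rw [indicator_of_mem (this.2 hlt), indicator_of_mem (show p ∈ {p | p.2 < g p.1} from hlt)]
    · rw [indicator_of_notMem (fun hc => hlt (this.1 hc)),
        indicator_of_notMem (show p ∉ {p | p.2 < g p.1} from hlt)]
  · have h0 : φ (normalCoord ν p) = 0 := by
      refine hφ _ ?_
      rintro ⟨q, hq, hqp⟩
      exact hp ((normalCoordEquiv h.norm_eq).injective hqp ▸ hq)
    by_cases h1 : normalCoord ν p ∈ Ω <;> by_cases h2 : p ∈ {p : (ℝ ∙ ν)ᗮ × ℝ | p.2 < g p.1} <;>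
      simp only [indicator_of_mem, indicator_of_notMem, h1, h2, h0, not_false_eq_true]

theorem integral_graph_eq (hs : tsupport f ⊆ normalCoord ν '' (B ×ˢ I))
    (θ : (ℝ ∙ ν)ᗮ → ℝ) :
    ∫ y, θ y * f (normalCoord ν (y, g y)) = ∫ y in B, θ y * f (graphMap ν g y) := by
  symm
  refine setIntegral_eq_integral_of_forall_compl_eq_zero fun y hy => ?_
  have : f (graphMap ν g y) = 0 := by
    refine image_eq_zero_of_notMem_tsupport fun hc => hy ?_
    obtain ⟨q, hq, hqp⟩ := hs hc
    have := (normalCoordEquiv h.norm_eq).injective hqp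
    rw [this] at hq
    exact hq.1
  rw [this, mul_zero]

/-- Three errors occur: the surface measure is replaced by Lebesgue measure on the base, costing `(1
+ ε)^(d-1) - 1`; the tangential part of `e` meets the slope of the graph, costing `ε`; the outer
normal is replaced by `ν`, costing `ε`. Each is multiplied by `‖e‖` and the L¹ norm of `f` on the
boundary, a bound that is stable under summation. -/
theorem abs_setIntegral_fderiv_sub_le (hΩ : IsSmoothBoundedDomain Ω) (hf : ContDiff ℝ 1 f)
    (hc : HasCompactSupport f) (hs : tsupport f ⊆ normalCoord ν '' (B ×ˢ I))
    (e : EuclideanSpace ℝ (Fin d)) :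
    |(∫ x in Ω, fderiv ℝ f x e) - ∫ x in frontier Ω, f x * inner ℝ e (outerNormal Ω x) ∂μHE[d - 1]| ≤
      (2 * ε + ((1 + ε : ℝ) ^ (d - 1) - 1)) * ‖e‖ * ∫ x in frontier Ω, |f x| ∂μHE[d - 1] := by
  set W := normalCoord ν '' (B ×ˢ I) with hW
  set σ := (μHE[d - 1] : Measure (EuclideanSpace ℝ (Fin d))).restrict (frontier Ω ∩ W) with hσ
  set l := Measure.map (graphMap ν g) (volume.restrict B) with hl
  have hf0 : ∀ x ∉ W, f x = 0 := fun x hx => image_eq_zero_of_notMem_tsupport fun hc => hx (hs hc)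
  have hrestr : ∀ φ : EuclideanSpace ℝ (Fin d) → ℝ, (∀ x ∉ W, φ x = 0) →
      ∫ x in frontier Ω, φ x ∂μHE[d - 1] = ∫ x, φ x ∂σ := fun φ hφ => by
    rw [hσ]
    refine setIntegral_eq_of_subset_of_forall_sdiff_eq_zero isClosed_frontier.measurableSet
      inter_subset_left fun x hx => hφ x fun hxW => hx.2 ⟨hx.1, hxW⟩
  rw [hrestr _ fun x hx => by rw [hf0 x hx, zero_mul], hrestr _ fun x hx => by rw [hf0 x hx, abs_zero]]
  have : IsFiniteMeasure σ := ⟨by simpa [hσ] using h.surface_lt_top⟩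
  have : IsFiniteMeasure (volume.restrict B) := h.isFiniteMeasure_base
  have hle1 : l ≤ σ := h.map_le_surface
  have hle2 : σ ≤ ((1 + ε) ^ (d - 1) : ℝ≥0) • l := h.surface_le_map
  have hfσ : Integrable f σ := hf.continuous.integrable_of_hasCompactSupport hc
  have hfl : Integrable f l := hfσ.mono_measure hle1
  have hGm : AEMeasurable (graphMap ν g) (volume.restrict B) :=
    h.continuous_graphMap.measurable.aemeasurable
  -- decomposition of the direction
  set a := inner ℝ ν e with ha
  set e' : (ℝ ∙ ν)ᗮ := (normalCoordInv ν e).1 with he'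
  have hdec : e = normalCoord ν (e', a) := by
    conv_lhs => rw [← normalCoord_normalCoordInv h.norm_eq e]
    rfl
  have ha1 : |a| ≤ ‖e‖ := by
    simpa [h.norm_eq] using abs_real_inner_le_norm ν e
  have he1 : ‖e'‖ ≤ ‖e‖ := (ℝ ∙ ν)ᗮ.norm_orthogonalProjectionOnto_apply_le e
  -- the volume integral
  set k : (ℝ ∙ ν)ᗮ × ℝ → ℝ := fun p => f (normalCoord ν p) with hk
  have hk1 : ContDiff ℝ 1 k := hf.comp (normalCoord ν).contDiff
  have hkc : HasCompactSupport k :=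
    hc.comp_homeomorph (normalCoordEquiv h.norm_eq).toHomeomorph
  have hkd : ∀ p q, fderiv ℝ k p q = fderiv ℝ f (normalCoord ν p) (normalCoord ν q) := fun p q => by
    have := (((hf.differentiable one_ne_zero) (normalCoord ν p)).hasFDerivAt.comp p
      (normalCoord ν).hasFDerivAt).fderiv
    simp only [Function.comp_def] at this
    rw [hk, this]; rfl
  have hkint : ∀ q, IntegrableOn (fun p => fderiv ℝ k p q) {p : (ℝ ∙ ν)ᗮ × ℝ | p.2 < g p.1} :=
    fun q => (((hk1.continuous_fderiv one_ne_zero).clm_apply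
      continuous_const).integrable_of_hasCompactSupport (hkc.fderiv_apply ℝ _)).integrableOn
  have hvol : ∫ x in Ω, fderiv ℝ f x e =
      a * ∫ x, f x ∂l - ∫ y in B, fderiv ℝ g y e' * f (graphMap ν g y) := by
    rw [h.setIntegral_eq_subgraph (fun x hx => ?_) hΩ.isOpen.measurableSet]
    · have : ∀ p, fderiv ℝ f (normalCoord ν p) e =
          a * fderiv ℝ k p (0, 1) + fderiv ℝ k p (e', 0) := fun p => by
        rw [← smul_eq_mul, ← map_smul, ← map_add, hkd]
        conv_lhs => rw [hdec]
        simp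
      simp_rw [this]
      rw [integral_add ((hkint _).const_mul _) (hkint _), integral_const_mul,
        setIntegral_subgraph_fderiv_snd hk1 hkc h.contDiff,
        setIntegral_subgraph_fderiv_fst hk1 hkc h.contDiff, sub_eq_add_neg,
        ← h.integral_graph_eq hs, hl,
        integral_map hGm hf.continuous.aestronglyMeasurable]
      have := h.integral_graph_eq hs (fun _ => 1)
      simp only [one_mul] at this
      rw [← this]
    · have : x ∉ tsupport (fderiv ℝ f) := fun hx' => hx (hs (tsupport_fderiv_subset ℝ hx'))
      rw [image_eq_zero_of_notMem_tsupport this]; rfl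
  have hgr : |∫ y in B, fderiv ℝ g y e' * f (graphMap ν g y)| ≤ ε * ‖e‖ * ∫ x, |f x| ∂σ := by
    have h1 : ∫ y in B, |f (graphMap ν g y)| ≤ ∫ x, |f x| ∂σ := by
      have := integral_mono_measure hle1 (Eventually.of_forall fun x => abs_nonneg (f x)) hfσ.abs
      rwa [hl, integral_map hGm hf.continuous.abs.aestronglyMeasurable] at this
    have h2 : Integrable (fun y => |f (graphMap ν g y)|) (volume.restrict B) :=
      (integrable_map_measure hf.continuous.aestronglyMeasurable hGm).1 hfl |>.abs
    have h3 : |∫ y in B, fderiv ℝ g y e' * f (graphMap ν g y)| ≤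
        ∫ y in B, ε * ‖e‖ * |f (graphMap ν g y)| := by
      rw [← Real.norm_eq_abs]
      refine norm_integral_le_of_norm_le (h2.const_mul _) ?_
      filter_upwards [ae_restrict_mem h.isOpen_base.measurableSet] with y hy
      rw [norm_mul, Real.norm_eq_abs (f _)]
      gcongr
      refine ((fderiv ℝ g y).le_opNorm e').trans ?_
      gcongr
      exact norm_fderiv_le_of_lipschitzOn ℝ (h.isOpen_base.mem_nhds hy) h.lipschitz
    rw [integral_const_mul] at h3
    exact h3.trans (by gcongr)
  -- the surface integral
  have hsurfmem : ∀ᵐ x ∂σ, ‖outerNormal Ω x - ν‖ ≤ ε ∧ x ∈ frontier Ω := by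
    filter_upwards [ae_restrict_mem
      (isClosed_frontier.measurableSet.inter h.isOpen_box.measurableSet)] with x hx
    have hx' := hx
    rw [h.frontier_inter_box] at hx'
    obtain ⟨y, hy, rfl⟩ := hx'
    exact ⟨h.normal_near y hy, hx.1⟩
  have hnm : AEStronglyMeasurable (outerNormal Ω) σ :=
    (hΩ.continuousOn_outerNormal.mono inter_subset_left).aestronglyMeasurable
      (isClosed_frontier.measurableSet.inter h.isOpen_box.measurableSet)
  have hi1 : Integrable (fun x => f x * inner ℝ e (outerNormal Ω x - ν)) σ := by
    refine (hfσ.abs.const_mul (‖e‖ * ε)).mono' (hfσ.aestronglyMeasurable.mul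
      (aestronglyMeasurable_const.inner (hnm.sub aestronglyMeasurable_const))) ?_
    filter_upwards [hsurfmem] with x hx
    rw [norm_mul, Real.norm_eq_abs (f x), mul_comm]
    gcongr
    exact (norm_inner_le_norm _ _).trans (by gcongr; exact hx.1)
  have hsurf : ∫ x, f x * inner ℝ e (outerNormal Ω x) ∂σ =
      a * ∫ x, f x ∂σ + ∫ x, f x * inner ℝ e (outerNormal Ω x - ν) ∂σ := by
    rw [← integral_const_mul, ← integral_add (hfσ.const_mul _) hi1]
    congr 1 with x
    rw [inner_sub_right, ha, real_inner_comm ν e]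
    ring
  have hR : |∫ x, f x * inner ℝ e (outerNormal Ω x - ν) ∂σ| ≤ ε * ‖e‖ * ∫ x, |f x| ∂σ := by
    rw [← integral_const_mul, ← Real.norm_eq_abs]
    refine norm_integral_le_of_norm_le (hfσ.abs.const_mul _) ?_
    filter_upwards [hsurfmem] with x hx
    rw [norm_mul, Real.norm_eq_abs (f x), mul_comm]
    gcongr
    refine (norm_inner_le_norm _ _).trans ?_
    rw [mul_comm]
    gcongr
    exact hx.1
  have hcmp := abs_integral_sub_integral_le hle1 hle2 hfσ
  have hmono : ∫ x, |f x| ∂l ≤ ∫ x, |f x| ∂σ :=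
    integral_mono_measure hle1 (Eventually.of_forall fun x => abs_nonneg (f x)) hfσ.abs
  have hc1 : (0 : ℝ) ≤ (1 + ε : ℝ) ^ (d - 1) - 1 :=
    sub_nonneg.2 (one_le_pow₀ (by simp))
  have hJ : 0 ≤ ∫ x, |f x| ∂σ := integral_nonneg fun x => abs_nonneg _
  have hcmp' : |∫ x, f x ∂σ - ∫ x, f x ∂l| ≤ ((1 + ε : ℝ) ^ (d - 1) - 1) * ∫ x, |f x| ∂σ := by
    refine hcmp.trans ?_
    push_cast
    gcongr
  rw [hvol, hsurf]
  have : a * ∫ x, f x ∂l - (∫ y in B, fderiv ℝ g y e' * f (graphMap ν g y)) -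
      (a * ∫ x, f x ∂σ + ∫ x, f x * inner ℝ e (outerNormal Ω x - ν) ∂σ) =
      -(a * (∫ x, f x ∂σ - ∫ x, f x ∂l)) + (-∫ y in B, fderiv ℝ g y e' * f (graphMap ν g y)) +
      (-∫ x, f x * inner ℝ e (outerNormal Ω x - ν) ∂σ) := by ring
  rw [this]
  refine (abs_add_three _ _ _).trans ?_
  rw [abs_neg, abs_neg, abs_neg, abs_mul]
  have : |a| * |∫ x, f x ∂σ - ∫ x, f x ∂l| ≤
      ‖e‖ * (((1 + ε : ℝ) ^ (d - 1) - 1) * ∫ x, |f x| ∂σ) := by gcongr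
  linarith

end IsGraphChart

/-! ### From charts to the whole domain -/

namespace IsSmoothBoundedDomain

variable (hΩ : IsSmoothBoundedDomain Ω)
include hΩ

theorem surface_frontier_lt_top : μHE[d - 1] (frontier Ω) < ⊤ := by
  have : ∀ s ⊆ frontier Ω, IsCompact s → ∃ N, IsOpen N ∧ s ⊆ N ∧
      μHE[d - 1] (frontier Ω ∩ N) < ⊤ := by
    intro s hs hsc
    refine hsc.induction_on (p := fun s => ∃ N, IsOpen N ∧ s ⊆ N ∧
      μHE[d - 1] (frontier Ω ∩ N) < ⊤) ⟨∅, by simp⟩ ?_ ?_ ?_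
    · rintro s t hst ⟨N, h1, h2, h3⟩
      exact ⟨N, h1, hst.trans h2, h3⟩
    · rintro s t ⟨N, h1, h2, h3⟩ ⟨N', h1', h2', h3'⟩
      refine ⟨N ∪ N', h1.union h1', union_subset_union h2 h2', ?_⟩
      rw [inter_union_distrib_left]
      exact measure_union_lt_top h3 h3'
    · intro x hx
      obtain ⟨ν, g, B, I, h, hmem⟩ := hΩ.exists_isGraphChart (hs hx) one_pos
      exact ⟨_, mem_nhdsWithin_of_mem_nhds (h.isOpen_box.mem_nhds hmem), _, h.isOpen_box, subset_rfl,
        h.surface_lt_top⟩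
  obtain ⟨N, -, h1, h2⟩ := this _ subset_rfl hΩ.isCompact_frontier
  rwa [inter_eq_left.2 h1] at h2

theorem isFiniteMeasure_surface :
    IsFiniteMeasure ((μHE[d - 1] : Measure (EuclideanSpace ℝ (Fin d))).restrict (frontier Ω)) :=
  ⟨by simpa using hΩ.surface_frontier_lt_top⟩

theorem integrableOn_frontier {f : EuclideanSpace ℝ (Fin d) → ℝ} (hf : ContinuousOn f (frontier Ω)) :
    IntegrableOn f (frontier Ω) μHE[d - 1] := by
  have := hΩ.isFiniteMeasure_surface
  obtain ⟨C, hC⟩ := hΩ.isCompact_frontier.exists_bound_of_continuousOn hf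
  refine Integrable.of_bound (hf.aestronglyMeasurable isClosed_frontier.measurableSet) C ?_
  filter_upwards [ae_restrict_mem isClosed_frontier.measurableSet] with x hx using hC x hx

theorem integrableOn_of_continuousOn_closure {F : Type*} [NormedAddCommGroup F]
    {f : EuclideanSpace ℝ (Fin d) → F}
    (hf : ContinuousOn f (closure Ω)) : IntegrableOn f Ω :=
  (hf.integrableOn_compact hΩ.isCompact_closure).mono_set subset_closure

theorem exists_chart_abs_sub_le {δ : ℝ} (hδ : 0 < δ) {x : EuclideanSpace ℝ (Fin d)}
    (hx : x ∈ frontier Ω) (e : EuclideanSpace ℝ (Fin d)) :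
    ∃ N, IsOpen N ∧ x ∈ N ∧ ∀ f : EuclideanSpace ℝ (Fin d) → ℝ, ContDiff ℝ 1 f →
      HasCompactSupport f → tsupport f ⊆ N →
      |(∫ x in Ω, fderiv ℝ f x e) - ∫ x in frontier Ω, f x * inner ℝ e (outerNormal Ω x) ∂μHE[d - 1]| ≤
      δ * ∫ x in frontier Ω, |f x| ∂μHE[d - 1] := by
  have hlim : Tendsto (fun ε : ℝ≥0 => (2 * ε + ((1 + ε : ℝ) ^ (d - 1) - 1)) * ‖e‖) (𝓝[>] 0)
      (𝓝 0) := by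
    have : Continuous fun ε : ℝ≥0 => (2 * ε + ((1 + ε : ℝ) ^ (d - 1) - 1)) * ‖e‖ := by fun_prop
    have := this.tendsto 0
    simp only [NNReal.coe_zero, mul_zero, add_zero, one_pow, sub_self, zero_mul] at this
    exact this.mono_left nhdsWithin_le_nhds
  obtain ⟨ε, hε1, hε2⟩ := ((hlim.eventually_le_const hδ).and self_mem_nhdsWithin).exists
  obtain ⟨ν, g, B, I, h, hmem⟩ := hΩ.exists_isGraphChart hx (show 0 < ε from hε2)
  refine ⟨_, h.isOpen_box, hmem, fun f hf hc hs => ?_⟩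
  exact (h.abs_setIntegral_fderiv_sub_le hΩ hf hc hs e).trans (by gcongr)

/-- The local estimate is propagated by compactness of the support. For a splitting `f = χ f + (1 -
χ) f` with `0 ≤ χ ≤ 1` the boundary norms add up exactly, so the constant `δ` does not grow with the
number of charts. -/
theorem abs_setIntegral_fderiv_sub_le {f : EuclideanSpace ℝ (Fin d) → ℝ} (hf : ContDiff ℝ 1 f)
    (hc : HasCompactSupport f) (e : EuclideanSpace ℝ (Fin d)) {δ : ℝ} (hδ : 0 < δ) :
    |(∫ x in Ω, fderiv ℝ f x e) - ∫ x in frontier Ω, f x * inner ℝ e (outerNormal Ω x) ∂μHE[d - 1]| ≤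
      δ * ∫ x in frontier Ω, |f x| ∂μHE[d - 1] := by
  let p : Set (EuclideanSpace ℝ (Fin d)) → Prop := fun s =>
    ∃ N, IsOpen N ∧ s ⊆ N ∧ ∀ f : EuclideanSpace ℝ (Fin d) → ℝ, ContDiff ℝ 1 f →
      HasCompactSupport f → tsupport f ⊆ N →
      |(∫ x in Ω, fderiv ℝ f x e) - ∫ x in frontier Ω, f x * inner ℝ e (outerNormal Ω x) ∂μHE[d - 1]| ≤
      δ * ∫ x in frontier Ω, |f x| ∂μHE[d - 1]
  have hcd : ∀ f : EuclideanSpace ℝ (Fin d) → ℝ, ContDiff ℝ 1 f → HasCompactSupport f →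
      Integrable (fun x => fderiv ℝ f x e) := fun f hf hc =>
    ((hf.continuous_fderiv one_ne_zero).clm_apply continuous_const).integrable_of_hasCompactSupport
      (hc.fderiv_apply ℝ e)
  have hsd : ∀ f : EuclideanSpace ℝ (Fin d) → ℝ, Continuous f →
      IntegrableOn (fun x => f x * inner ℝ e (outerNormal Ω x)) (frontier Ω) μHE[d - 1] :=
    fun f hf => hΩ.integrableOn_frontier
      (hf.continuousOn.mul (continuousOn_const.inner hΩ.continuousOn_outerNormal))
  suffices p (tsupport f) by
    obtain ⟨N, -, h1, h2⟩ := this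
    exact h2 f hf hc h1
  refine IsCompact.induction_on hc (p := p) ?_ ?_ ?_ ?_
  · refine ⟨∅, isOpen_empty, subset_rfl, fun f _ _ hs => ?_⟩
    have : f = 0 := tsupport_eq_empty_iff.1 (subset_empty_iff.1 hs)
    simp [this]
  · rintro s t hst ⟨N, h1, h2, h3⟩
    exact ⟨N, h1, hst.trans h2, h3⟩
  · rintro s t ⟨N, h1, h2, h3⟩ ⟨N', h1', h2', h3'⟩
    refine ⟨N ∪ N', h1.union h1', union_subset_union h2 h2', fun f hf hc hs => ?_⟩
    -- `χ` equals 1 near the part of the support outside `N'`, so `(1 - χ) f` is supported in `N'`,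
    -- while `χ f` is supported in `N`.
    have hK : IsCompact (tsupport f \ N') := hc.isCompact.diff h1'
    obtain ⟨χ, hχ1, hχ2, hχ3, hχ4, hχ5⟩ := exists_contDiff_cutoff hK h1 (fun x hx =>
      ((hs hx.1 : x ∈ N ∪ N')).resolve_right hx.2)
    have hχ1' : ContDiff ℝ 1 χ := hχ1.of_le (by exact_mod_cast le_top)
    have ha : ContDiff ℝ 1 fun x => χ x * f x := hχ1'.mul hf
    have hb : ContDiff ℝ 1 fun x => (1 - χ x) * f x := (contDiff_const.sub hχ1').mul hf
    have hac : HasCompactSupport fun x => χ x * f x := hc.mul_left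
    have hbc : HasCompactSupport fun x => (1 - χ x) * f x := hc.mul_left
    have has : tsupport (fun x => χ x * f x) ⊆ N := (tsupport_mul_subset_left).trans hχ3
    have hbs : tsupport (fun x => (1 - χ x) * f x) ⊆ N' := by
      intro x hx
      by_contra hxN
      have hxf : x ∈ tsupport f := (tsupport_mul_subset_right) hx
      have h0 : (fun x => (1 - χ x) * f x) =ᶠ[𝓝 x] 0 := by
        filter_upwards [hχ5.filter_mono (nhds_le_nhdsSet (show x ∈ tsupport f \ N' from ⟨hxf, hxN⟩))] with y hy
        simp [hy]
      exact (notMem_tsupport_iff_eventuallyEq.2 h0) hx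
    have e1 := h3 _ ha hac has
    have e2 := h3' _ hb hbc hbs
    have s1 : ∫ x in Ω, fderiv ℝ f x e = (∫ x in Ω, fderiv ℝ (fun x => χ x * f x) x e) +
        ∫ x in Ω, fderiv ℝ (fun x => (1 - χ x) * f x) x e := by
      rw [← integral_add (hcd _ ha hac).integrableOn (hcd _ hb hbc).integrableOn]
      congr 1 with x
      have : f = fun x => χ x * f x + (1 - χ x) * f x := by ext x; ring
      conv_lhs => rw [this]
      rw [fderiv_fun_add ((ha.differentiable one_ne_zero) x) ((hb.differentiable one_ne_zero) x)]
      rfl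
    have s2 : ∫ x in frontier Ω, f x * inner ℝ e (outerNormal Ω x) ∂μHE[d - 1] =
        ∫ x in frontier Ω, (χ x * f x) * inner ℝ e (outerNormal Ω x) ∂μHE[d - 1] +
        ∫ x in frontier Ω, ((1 - χ x) * f x) * inner ℝ e (outerNormal Ω x) ∂μHE[d - 1] := by
      rw [← integral_add (hsd _ ha.continuous) (hsd _ hb.continuous)]
      congr 1 with x
      ring
    have s3 : ∫ x in frontier Ω, |f x| ∂μHE[d - 1] =
        ∫ x in frontier Ω, |χ x * f x| ∂μHE[d - 1] +
        ∫ x in frontier Ω, |(1 - χ x) * f x| ∂μHE[d - 1] := by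
      rw [← integral_add (hΩ.integrableOn_frontier ha.continuous.abs.continuousOn)
        (hΩ.integrableOn_frontier hb.continuous.abs.continuousOn)]
      congr 1 with x
      rw [abs_mul, abs_mul, abs_of_nonneg (hχ4 x).1, abs_of_nonneg (sub_nonneg.2 (hχ4 x).2)]
      ring
    rw [s1, s2, s3, mul_add, add_sub_add_comm]
    exact (abs_add_le _ _).trans (add_le_add e1 e2)
  · intro x _
    suffices ∃ N, IsOpen N ∧ x ∈ N ∧ ∀ f : EuclideanSpace ℝ (Fin d) → ℝ, ContDiff ℝ 1 f →
        HasCompactSupport f → tsupport f ⊆ N →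
        |(∫ x in Ω, fderiv ℝ f x e) -
          ∫ x in frontier Ω, f x * inner ℝ e (outerNormal Ω x) ∂μHE[d - 1]| ≤
        δ * ∫ x in frontier Ω, |f x| ∂μHE[d - 1] by
      obtain ⟨N, h1, h2, h3⟩ := this
      exact ⟨N, mem_nhdsWithin_of_mem_nhds (h1.mem_nhds h2), N, h1, subset_rfl, h3⟩
    -- Away from the boundary there is nothing to compare: both integrals vanish for functions
    -- supported inside `Ω` or outside its closure.
    have hzero : ∀ f : EuclideanSpace ℝ (Fin d) → ℝ, (∀ y ∈ frontier Ω, f y = 0) →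
        ∫ x in Ω, fderiv ℝ f x e = 0 →
        |(∫ x in Ω, fderiv ℝ f x e) -
          ∫ x in frontier Ω, f x * inner ℝ e (outerNormal Ω x) ∂μHE[d - 1]| ≤
        δ * ∫ x in frontier Ω, |f x| ∂μHE[d - 1] := by
      intro f hf0 hi
      rw [hi, setIntegral_eq_zero_of_forall_eq_zero fun y hy => by rw [hf0 y hy, zero_mul]]
      rw [sub_zero, abs_zero]
      exact mul_nonneg hδ.le (integral_nonneg fun x => abs_nonneg _)
    by_cases hxf : x ∈ frontier Ω
    · exact hΩ.exists_chart_abs_sub_le hδ hxf e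
    by_cases hxΩ : x ∈ Ω
    · refine ⟨Ω, hΩ.isOpen, hxΩ, fun f hf hc hs => hzero f (fun y hy => ?_) ?_⟩
      · refine image_eq_zero_of_notMem_tsupport fun hy' => ?_
        rw [hΩ.isOpen.frontier_eq] at hy
        exact hy.2 (hs hy')
      · rw [setIntegral_eq_integral_of_forall_compl_eq_zero fun y hy => ?_]
        · exact integral_fderiv_apply_eq_zero hf hc e
        · have : y ∉ tsupport (fderiv ℝ f) := fun h' => hy (hs (tsupport_fderiv_subset ℝ h'))
          rw [image_eq_zero_of_notMem_tsupport this]; rfl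
    · have hxc : x ∉ closure Ω := fun h' => hxf (by rw [hΩ.isOpen.frontier_eq]; exact ⟨h', hxΩ⟩)
      refine ⟨(closure Ω)ᶜ, isClosed_closure.isOpen_compl, hxc, fun f hf hc hs => hzero f
        (fun y hy => ?_) ?_⟩
      · exact image_eq_zero_of_notMem_tsupport fun hy' => hs hy' (frontier_subset_closure hy)
      · refine setIntegral_eq_zero_of_forall_eq_zero fun y hy => ?_
        have : y ∉ tsupport (fderiv ℝ f) := fun h' =>
          hs (tsupport_fderiv_subset ℝ h') (subset_closure hy)
        rw [image_eq_zero_of_notMem_tsupport this]; rfl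

/-- The Gauss–Green formula for a scalar function and a constant direction. -/
theorem setIntegral_fderiv_apply {f : EuclideanSpace ℝ (Fin d) → ℝ}
    {V : Set (EuclideanSpace ℝ (Fin d))} (hV : IsOpen V) (hΩV : closure Ω ⊆ V)
    (hf : ContDiffOn ℝ 1 f V) (e : EuclideanSpace ℝ (Fin d)) :
    ∫ x in Ω, fderiv ℝ f x e =
      ∫ x in frontier Ω, f x * inner ℝ e (outerNormal Ω x) ∂μHE[d - 1] := by
  obtain ⟨f', h1, h2, -, h3⟩ := ContDiffOn.exists_contDiff_eventuallyEq_nhdsSet (n := 1) hf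
    hΩ.isCompact_closure hV hΩV
  have h4 : ∀ x ∈ closure Ω, f' =ᶠ[𝓝 x] f := fun x hx => h3.filter_mono (nhds_le_nhdsSet hx)
  have h5 : ∫ x in Ω, fderiv ℝ f x e = ∫ x in Ω, fderiv ℝ f' x e :=
    setIntegral_congr_fun hΩ.isOpen.measurableSet fun x hx => by
      simp only [(h4 x (subset_closure hx)).fderiv_eq]
  have h6 : ∫ x in frontier Ω, f x * inner ℝ e (outerNormal Ω x) ∂μHE[d - 1] =
      ∫ x in frontier Ω, f' x * inner ℝ e (outerNormal Ω x) ∂μHE[d - 1] :=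
    setIntegral_congr_fun isClosed_frontier.measurableSet fun x hx => by
      simp only [(h4 x (frontier_subset_closure hx)).eq_of_nhds]
  rw [h5, h6, ← sub_eq_zero, ← abs_eq_zero]
  refine le_antisymm (le_of_forall_pos_le_add fun η hη => ?_) (abs_nonneg _)
  set J := ∫ x in frontier Ω, |f' x| ∂μHE[d - 1] with hJ
  have hJ0 : 0 ≤ J := integral_nonneg fun x => abs_nonneg _
  -- The denominator `J + 1` rather than `J` covers the case `J = 0`.
  refine (hΩ.abs_setIntegral_fderiv_sub_le h1 h2 e (δ := η / (J + 1)) (by positivity)).trans ?_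
  rw [← hJ, zero_add, div_mul_eq_mul_div, div_le_iff₀ (by positivity)]
  nlinarith

/-- The divergence theorem on a smooth bounded domain. -/
theorem setIntegral_divergence {F : EuclideanSpace ℝ (Fin d) → EuclideanSpace ℝ (Fin d)}
    {V : Set (EuclideanSpace ℝ (Fin d))} (hV : IsOpen V) (hΩV : closure Ω ⊆ V)
    (hF : ContDiffOn ℝ 1 F V) :
    ∫ x in Ω, divergence F x = ∫ x in frontier Ω, inner ℝ (F x) (outerNormal Ω x) ∂μHE[d - 1] := by
  have hFi : ∀ i, ContDiffOn ℝ 1 (fun x => F x i) V := fun i =>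
    (EuclideanSpace.proj (𝕜 := ℝ) i).contDiff.comp_contDiffOn hF
  have hd : ∀ x ∈ Ω, ∀ i, (fderiv ℝ F x (EuclideanSpace.single i 1)) i =
      fderiv ℝ (fun x => F x i) x (EuclideanSpace.single i 1) := fun x hx i => by
    have h1 : DifferentiableAt ℝ F x :=
      (hF.contDiffAt (hV.mem_nhds (hΩV (subset_closure hx)))).differentiableAt one_ne_zero
    have h2 := ((EuclideanSpace.proj (𝕜 := ℝ) i).hasFDerivAt.comp x h1.hasFDerivAt).fderiv
    have h3 : (EuclideanSpace.proj (𝕜 := ℝ) i) ∘ F = fun x => F x i := rfl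
    rw [h3] at h2
    rw [h2]; rfl
  have e1 : ∫ x in Ω, divergence F x =
      ∫ x in Ω, ∑ i, fderiv ℝ (fun x => F x i) x (EuclideanSpace.single i 1) :=
    setIntegral_congr_fun hΩ.isOpen.measurableSet fun x hx =>
      Finset.sum_congr rfl fun i _ => hd x hx i
  have e2 : ∀ x, inner ℝ (F x) (outerNormal Ω x) =
      ∑ i, F x i * inner ℝ (EuclideanSpace.single i (1 : ℝ)) (outerNormal Ω x) := fun x => by
    simp [PiLp.inner_apply, mul_comm]
  rw [e1, integral_finsetSum]
  · simp_rw [e2]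
    rw [integral_finsetSum]
    · exact Finset.sum_congr rfl fun i _ => hΩ.setIntegral_fderiv_apply hV hΩV (hFi i) _
    · exact fun i _ => hΩ.integrableOn_frontier
        (((hFi i).continuousOn.mono (frontier_subset_closure.trans hΩV)).mul
        (continuousOn_const.inner hΩ.continuousOn_outerNormal))
  · intro i _
    refine hΩ.integrableOn_of_continuousOn_closure ?_
    exact (((hFi i).continuousOn_fderiv_of_isOpen hV le_rfl).mono hΩV).clm_apply continuousOn_const

end IsSmoothBoundedDomain

end Divergence

/-! ### Partial derivatives -/

section PartialDerivatives

variable {d : ℕ} {f g : EuclideanSpace ℝ (Fin d) → ℝ} {x : EuclideanSpace ℝ (Fin d)}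

/-- The partial derivative in the `i`-th coordinate direction. -/
def pd (i : Fin d) (f : EuclideanSpace ℝ (Fin d) → ℝ) (x : EuclideanSpace ℝ (Fin d)) : ℝ :=
  fderiv ℝ f x (EuclideanSpace.single i 1)

theorem gradient_coord (i : Fin d) : (∇ f x) i = pd i f x := by
  have := inner_gradient_left (𝕜 := ℝ) (f := f) (x := x) (y := EuclideanSpace.single i (1 : ℝ))
  rw [pd, ← this, EuclideanSpace.inner_single_right]
  simp

theorem ContDiff.pd {n m : ℕ∞ω} (hf : ContDiff ℝ n f) (h : m + 1 ≤ n) (i : Fin d) :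
    ContDiff ℝ m (pd i f) :=
  (hf.fderiv_right h).clm_apply contDiff_const

theorem pd_comm (hf : ContDiff ℝ 2 f) (i j : Fin d) : pd i (pd j f) = pd j (pd i f) := by
  ext x
  have h1 : DifferentiableAt ℝ (fderiv ℝ f) x :=
    ((hf.fderiv_right (m := 1) (by norm_num)).differentiable one_ne_zero) x
  have h2 : ∀ k l : Fin d, pd k (pd l f) x =
      fderiv ℝ (fderiv ℝ f) x (EuclideanSpace.single k 1) (EuclideanSpace.single l 1) := by
    intro k l
    have := h1.hasFDerivAt.clm_apply (hasFDerivAt_const (EuclideanSpace.single l (1 : ℝ)) x)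
    change fderiv ℝ (fun y => fderiv ℝ f y (EuclideanSpace.single l 1)) x _ = _
    rw [this.fderiv]
    simp
  rw [h2, h2]
  exact (hf.contDiffAt.isSymmSndFDerivAt (by simp)).eq _ _

theorem hessianNormSq_eq (hf : ContDiff ℝ 2 f) :
    hessianNormSq f x = ∑ i, ∑ j, (pd i (pd j f) x) ^ 2 := by
  have h1 : DifferentiableAt ℝ (fderiv ℝ f) x :=
    ((hf.fderiv_right (m := 1) (by norm_num)).differentiable one_ne_zero) x
  refine Finset.sum_congr rfl fun k _ => Finset.sum_congr rfl fun l _ => ?_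
  have := h1.hasFDerivAt.clm_apply (hasFDerivAt_const (EuclideanSpace.single l (1 : ℝ)) x)
  change _ = (fderiv ℝ (fun y => fderiv ℝ f y (EuclideanSpace.single l 1)) x _) ^ 2
  rw [this.fderiv]
  simp

theorem laplacian_eq_sum (hf : ContDiff ℝ 2 f) : Δ f x = ∑ i, pd i (pd i f) x := by
  have h1 : DifferentiableAt ℝ (fderiv ℝ f) x :=
    ((hf.fderiv_right (m := 1) (by norm_num)).differentiable one_ne_zero) x
  rw [InnerProductSpace.laplacian_eq_iteratedFDeriv_orthonormalBasis f
    (EuclideanSpace.basisFun (Fin d) ℝ)]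
  refine Finset.sum_congr rfl fun i _ => ?_
  have := h1.hasFDerivAt.clm_apply (hasFDerivAt_const (EuclideanSpace.single i (1 : ℝ)) x)
  change _ = fderiv ℝ (fun y => fderiv ℝ f y (EuclideanSpace.single i 1)) x _
  rw [this.fderiv, iteratedFDeriv_two_apply]
  simp

theorem pd_mul (hf : Differentiable ℝ f) (hg : Differentiable ℝ g) (i : Fin d) :
    pd i (fun x => f x * g x) = fun x => f x * pd i g x + pd i f x * g x := by
  ext x
  simp only [pd]
  rw [fderiv_fun_mul (hf x) (hg x)]
  simp [mul_comm]

theorem pd_sum {ι : Type*} (s : Finset ι) {F : ι → EuclideanSpace ℝ (Fin d) → ℝ}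
    (hF : ∀ k ∈ s, Differentiable ℝ (F k)) (i : Fin d) :
    pd i (fun x => ∑ k ∈ s, F k x) = fun x => ∑ k ∈ s, pd i (F k) x := by
  ext x
  simp only [pd]
  rw [fderiv_fun_sum fun k hk => hF k hk x]
  simp

theorem pd_comp {φ : ℝ → ℝ} (hφ : Differentiable ℝ φ) (hf : Differentiable ℝ f) (i : Fin d) :
    pd i (fun x => φ (f x)) = fun x => deriv φ (f x) * pd i f x := by
  ext x
  simp only [pd]
  have := ((hφ (f x)).hasDerivAt.comp_hasFDerivAt x (hf x).hasFDerivAt).fderiv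
  simp only [Function.comp_def] at this
  rw [this]
  simp

theorem inner_gradient_gradient :
    inner ℝ (∇ f x) (∇ g x) = ∑ i, pd i f x * pd i g x := by
  rw [PiLp.inner_apply]
  simp [gradient_coord, mul_comm]

theorem norm_gradient_sq : ‖∇ f x‖ ^ 2 = ∑ i, (pd i f x) ^ 2 := by
  rw [← real_inner_self_eq_norm_sq, inner_gradient_gradient]
  simp [sq]

theorem ContDiff.gradient_right {n m : ℕ∞ω} (hf : ContDiff ℝ n f) (h : m + 1 ≤ n) :
    ContDiff ℝ m (∇ f) :=
  (InnerProductSpace.toDual ℝ (EuclideanSpace ℝ (Fin d))).symm.contDiff.comp (hf.fderiv_right h)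

theorem divergence_eq_sum {F : EuclideanSpace ℝ (Fin d) → EuclideanSpace ℝ (Fin d)}
    (hF : DifferentiableAt ℝ F x) : divergence F x = ∑ i, pd i (fun y => F y i) x := by
  refine Finset.sum_congr rfl fun i _ => ?_
  have h2 := ((EuclideanSpace.proj (𝕜 := ℝ) i).hasFDerivAt.comp x hF.hasFDerivAt).fderiv
  have h3 : (EuclideanSpace.proj (𝕜 := ℝ) i) ∘ F = fun x => F x i := rfl
  rw [h3] at h2
  rw [pd, h2]; rfl

theorem divergence_smul_gradient (hf : ContDiff ℝ 1 f) (hg : ContDiff ℝ 2 g) :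
    divergence (fun y => f y • ∇ g y) x =
      ∑ i, pd i f x * pd i g x + f x * ∑ i, pd i (pd i g) x := by
  have h1 : ContDiff ℝ 1 (fun y => f y • ∇ g y) := hf.smul (hg.gradient_right (by norm_num))
  rw [divergence_eq_sum (h1.differentiable one_ne_zero x), Finset.mul_sum,
    ← Finset.sum_add_distrib]
  refine Finset.sum_congr rfl fun i _ => ?_
  have h2 : (fun y => (f y • ∇ g y) i) = fun y => f y * pd i g y := by
    ext y
    simp [gradient_coord]
  rw [h2, pd_mul (hf.differentiable one_ne_zero)
    ((hg.pd (m := 1) (by norm_num) i).differentiable one_ne_zero)]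
  ring

theorem contDiff_norm_gradient_sq {n m : ℕ∞ω} (hf : ContDiff ℝ n f) (h : m + 1 ≤ n) :
    ContDiff ℝ m fun x => ‖∇ f x‖ ^ 2 :=
  (hf.gradient_right h).norm_sq ℝ

theorem pd_norm_gradient_sq (hf : ContDiff ℝ 2 f) (i : Fin d) :
    pd i (fun x => ‖∇ f x‖ ^ 2) = fun x => ∑ j, 2 * (pd j f x * pd i (pd j f) x) := by
  have hd : ∀ j, Differentiable ℝ (pd j f) := fun j =>
    (hf.pd (m := 1) (by norm_num) j).differentiable one_ne_zero
  have h : (fun x => ‖∇ f x‖ ^ 2) = fun x => ∑ j, pd j f x * pd j f x := by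
    ext x; rw [norm_gradient_sq]; simp [sq]
  have hm : ∀ j, Differentiable ℝ fun x => pd j f x * pd j f x := fun j => (hd j).mul (hd j)
  rw [h, pd_sum _ fun j _ => hm j]
  ext x
  refine Finset.sum_congr rfl fun j _ => ?_
  rw [pd_mul (hd j) (hd j)]
  ring

/-- Bochner's formula. -/
theorem sum_pd_pd_norm_gradient_sq (hf : ContDiff ℝ 3 f) :
    ∑ i, pd i (pd i (fun x => ‖∇ f x‖ ^ 2)) x =
      2 * hessianNormSq f x + 2 * ∑ j, pd j f x * pd j (fun y => ∑ i, pd i (pd i f) y) x := by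
  have hf2 : ContDiff ℝ 2 f := hf.of_le (by norm_num)
  have h1 : ∀ j, ContDiff ℝ 2 (pd j f) := fun j => hf.pd (by norm_num) j
  have h2 : ∀ i j, ContDiff ℝ 1 (pd i (pd j f)) := fun i j => (h1 j).pd (by norm_num) i
  have e1 : ∀ i, pd i (pd i (fun x => ‖∇ f x‖ ^ 2)) x =
      ∑ j, (2 * (pd i (pd j f) x) ^ 2 + 2 * (pd j f x * pd i (pd i (pd j f)) x)) := by
    intro i
    have hm : ∀ j, Differentiable ℝ fun x => pd j f x * pd i (pd j f) x := fun j =>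
      ((h1 j).differentiable two_ne_zero).mul ((h2 i j).differentiable one_ne_zero)
    have hm' : ∀ j, Differentiable ℝ fun x => 2 * (pd j f x * pd i (pd j f) x) := fun j =>
      (differentiable_const _).mul (hm j)
    rw [pd_norm_gradient_sq hf2 i, pd_sum _ fun j _ => hm' j]
    refine Finset.sum_congr rfl fun j _ => ?_
    rw [pd_mul (differentiable_const _) (hm j), pd_mul ((h1 j).differentiable two_ne_zero)
      ((h2 i j).differentiable one_ne_zero)]
    have h0 : pd i (fun _ => (2 : ℝ)) x = 0 := by simp [pd]
    simp only [h0]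
    ring
  have e2 : ∀ j, pd j (fun y => ∑ i, pd i (pd i f) y) x = ∑ i, pd i (pd i (pd j f)) x := by
    intro j
    rw [pd_sum _ fun i _ => (h2 i i).differentiable one_ne_zero]
    refine Finset.sum_congr rfl fun i _ => ?_
    rw [pd_comm (h1 i) j i, pd_comm hf2 j i]
  simp_rw [e1, e2]
  rw [hessianNormSq_eq hf2]
  simp_rw [Finset.sum_add_distrib, ← Finset.mul_sum]
  congr 2
  rw [Finset.sum_comm]
  simp_rw [← Finset.mul_sum]

end PartialDerivatives

/-! ### The static identity -/

section Static

variable {d : ℕ} {Ω : Set (EuclideanSpace ℝ (Fin d))}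

theorem IsSmoothBoundedDomain.setIntegral_divergence_smul_gradient (hΩ : IsSmoothBoundedDomain Ω)
    {f g : EuclideanSpace ℝ (Fin d) → ℝ} (hf : ContDiff ℝ 1 f) (hg : ContDiff ℝ 2 g) :
    ∫ x in Ω, divergence (fun y => f y • ∇ g y) x =
      ∫ x in frontier Ω, f x * inner ℝ (∇ g x) (outerNormal Ω x)
        ∂(Measure.euclideanHausdorffMeasure (d - 1)) := by
  have h1 : ContDiff ℝ 1 (fun y => f y • ∇ g y) := hf.smul (hg.gradient_right (by norm_num))
  rw [hΩ.setIntegral_divergence isOpen_univ (subset_univ _) h1.contDiffOn]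
  simp only [inner_smul_left]
  rfl

theorem continuous_divergence_smul_gradient {f g : EuclideanSpace ℝ (Fin d) → ℝ}
    (hf : ContDiff ℝ 1 f) (hg : ContDiff ℝ 2 g) :
    Continuous (divergence (fun y => f y • ∇ g y)) := by
  have h1 : ContDiff ℝ 1 (∇ g) := hg.gradient_right (by norm_num)
  have h2 := (hf.smul h1).continuous_fderiv one_ne_zero
  refine continuous_finsetSum _ fun i _ => ?_
  exact (EuclideanSpace.proj (𝕜 := ℝ) i).continuous.comp (h2.clm_apply continuous_const)

/-- The two sides differ by the integrals of divergences. Those of `p'(r) w ∇z` and `h(r) Δz ∇z`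
vanish by the Neumann condition, while half that of `h(r) ∇|∇z|²` is the boundary term of the
statement. -/
theorem IsSmoothBoundedDomain.integral_identity (hΩ : IsSmoothBoundedDomain Ω)
    {p μ h : ℝ → ℝ} (hp : ContDiff ℝ 2 p) (hμ : ContDiff ℝ 2 μ) (hh : ContDiff ℝ 1 h)
    {r z w : EuclideanSpace ℝ (Fin d) → ℝ} (hr : ContDiff ℝ 2 r) (hz : ContDiff ℝ 3 z)
    (hw : ContDiff ℝ 1 w)
    (heq : ∀ x ∈ Ω, - divergence (fun y => μ (r y) • ∇ z y) x = w x)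
    (hN : ∀ x ∈ frontier Ω, inner ℝ (∇ z x) (outerNormal Ω x) = 0)
    (hh' : ∀ x ∈ Ω, deriv h (r x) = deriv p (r x) * deriv μ (r x)) :
    - (∫ x in Ω, inner ℝ (∇ (fun y => deriv p (r y) * w y) x) (∇ z x))
      + 1 / 2 * (∫ x in Ω, inner ℝ (∇ (fun y => p (r y)) x)
          (∇ (fun y => deriv μ (r y) * ‖∇ z y‖ ^ 2) x)) =
    - (∫ x in Ω, ((deriv p (r x) * μ (r x) - h (r x)) * (Δ z x) ^ 2
        + h (r x) * hessianNormSq z x))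
      + 1 / 2 * (∫ x in Ω, deriv p (r x) * deriv (deriv μ) (r x) * ‖∇ r x‖ ^ 2 * ‖∇ z x‖ ^ 2)
      + 1 / 2 * (∫ x in frontier Ω, h (r x) * inner ℝ (∇ (fun y => ‖∇ z y‖ ^ 2) x) (outerNormal Ω x)
          ∂(Measure.euclideanHausdorffMeasure (d - 1))) := by
  have hp1 : ContDiff ℝ 1 (deriv p) := by
    have := (contDiff_succ_iff_deriv (n := 1)).1 hp; exact this.2.2
  have hμ1 : ContDiff ℝ 1 (deriv μ) := by
    have := (contDiff_succ_iff_deriv (n := 1)).1 hμ; exact this.2.2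
  have hr1 : ContDiff ℝ 1 r := hr.of_le (by norm_num)
  have hz2 : ContDiff ℝ 2 z := hz.of_le (by norm_num)
  have hz1 : ContDiff ℝ 1 z := hz.of_le (by norm_num)
  have hrd := hr1.differentiable one_ne_zero
  have hpw : ContDiff ℝ 1 fun y => deriv p (r y) * w y := (hp1.comp hr1).mul hw
  have hpr : ContDiff ℝ 1 fun y => p (r y) := (hp.of_le (by norm_num)).comp hr1
  have hμr : ContDiff ℝ 1 fun y => μ (r y) := (hμ.of_le (by norm_num)).comp hr1
  have hhr : ContDiff ℝ 1 fun y => h (r y) := hh.comp hr1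
  have hG : ContDiff ℝ 2 fun y => ‖∇ z y‖ ^ 2 := contDiff_norm_gradient_sq hz (by norm_num)
  have hG1 : ContDiff ℝ 1 fun y => ‖∇ z y‖ ^ 2 := hG.of_le (by norm_num)
  have hμG : ContDiff ℝ 1 fun y => deriv μ (r y) * ‖∇ z y‖ ^ 2 := (hμ1.comp hr1).mul hG1
  have hL : ContDiff ℝ 1 fun y => ∑ i, pd i (pd i z) y :=
    ContDiff.sum fun i _ => (hz.pd (m := 2) (by norm_num) i).pd (by norm_num) i
  have hhL : ContDiff ℝ 1 fun y => h (r y) * ∑ i, pd i (pd i z) y := hhr.mul hL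
  -- the three applications of the divergence theorem
  have d1 := hΩ.setIntegral_divergence_smul_gradient hpw hz2
  have d2 := hΩ.setIntegral_divergence_smul_gradient hhL hz2
  have d3 := hΩ.setIntegral_divergence_smul_gradient hhr hG
  have d0 : ∀ f : EuclideanSpace ℝ (Fin d) → ℝ,
      ∫ x in frontier Ω, f x * inner ℝ (∇ z x) (outerNormal Ω x)
        ∂(Measure.euclideanHausdorffMeasure (d - 1)) = 0 := fun f =>
    setIntegral_eq_zero_of_forall_eq_zero fun x hx => by rw [hN x hx, mul_zero]
  rw [d0] at d1 d2
  -- integrability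
  have hgc : ∀ {f : EuclideanSpace ℝ (Fin d) → ℝ}, ContDiff ℝ 1 f → Continuous (∇ f) :=
    fun hf => hf.continuous_gradient one_ne_zero
  have int : ∀ {f : EuclideanSpace ℝ (Fin d) → ℝ}, Continuous f → IntegrableOn f Ω :=
    fun hf => hΩ.integrableOn_of_continuousOn_closure hf.continuousOn
  have i1 := int ((hgc hpw).inner (hgc hz1))
  have i2 := int ((hgc hpr).inner (hgc hμG))
  have i3 := int (continuous_divergence_smul_gradient hpw hz2)
  have i4 := int (continuous_divergence_smul_gradient hhL hz2)
  have i5 := int (continuous_divergence_smul_gradient hhr hG)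
  have i6 : IntegrableOn (fun x => deriv p (r x) * deriv (deriv μ) (r x) * ‖∇ r x‖ ^ 2 *
      ‖∇ z x‖ ^ 2) Ω := by
    refine int ((((hp1.continuous.comp hr.continuous).mul ?_).mul
      ((hgc hr1).norm.pow 2)).mul hG.continuous)
    exact (hμ1.continuous_deriv le_rfl).comp hr.continuous
  -- The identity is algebraic at each point. Substituting `w = -(μ' ∇r·∇z + μ Δz)` produces `p' μ
  -- (Δz)²` and `p' μ' Δz ∇r·∇z`; the latter cancels against `∇h·∇z Δz` because `h' = p' μ'`.
  -- Bochner's formula turns `½ h Δ|∇z|²` into `h |D²z|² + h ∇z·∇Δz`, whose last term cancels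
  -- against the divergence of `h Δz ∇z`.
  have point : ∀ x ∈ Ω, (deriv p (r x) * μ (r x) - h (r x)) * (Δ z x) ^ 2
        + h (r x) * hessianNormSq z x =
      inner ℝ (∇ (fun y => deriv p (r y) * w y) x) (∇ z x)
      - 1 / 2 * inner ℝ (∇ (fun y => p (r y)) x) (∇ (fun y => deriv μ (r y) * ‖∇ z y‖ ^ 2) x)
      + 1 / 2 * (deriv p (r x) * deriv (deriv μ) (r x) * ‖∇ r x‖ ^ 2 * ‖∇ z x‖ ^ 2)
      - divergence (fun y => (deriv p (r y) * w y) • ∇ z y) x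
      - divergence (fun y => (h (r y) * ∑ i, pd i (pd i z) y) • ∇ z y) x
      + 1 / 2 * divergence (fun y => h (r y) • ∇ (fun y => ‖∇ z y‖ ^ 2) y) x := by
    intro x hx
    have hwx := heq x hx
    rw [divergence_smul_gradient hμr hz2] at hwx
    rw [divergence_smul_gradient hpw hz2, divergence_smul_gradient hhL hz2,
      divergence_smul_gradient hhr hG, sum_pd_pd_norm_gradient_sq hz, laplacian_eq_sum hz2,
      inner_gradient_gradient, inner_gradient_gradient]
    have q1 : ∀ i, pd i (fun y => p (r y)) x = deriv p (r x) * pd i r x := fun i => by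
      rw [pd_comp (hp.differentiable two_ne_zero) hrd]
    have q2 : ∀ i, pd i (fun y => deriv μ (r y) * ‖∇ z y‖ ^ 2) x =
        deriv μ (r x) * pd i (fun y => ‖∇ z y‖ ^ 2) x +
        deriv (deriv μ) (r x) * pd i r x * ‖∇ z x‖ ^ 2 := fun i => by
      have hd : Differentiable ℝ fun y => deriv μ (r y) := (hμ1.comp hr1).differentiable one_ne_zero
      rw [pd_mul hd (hG1.differentiable one_ne_zero),
        pd_comp (hμ1.differentiable one_ne_zero) hrd]
    have q3 : ∀ i, pd i (fun y => h (r y) * ∑ i, pd i (pd i z) y) x =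
        h (r x) * pd i (fun y => ∑ i, pd i (pd i z) y) x +
        deriv h (r x) * pd i r x * ∑ i, pd i (pd i z) x := fun i => by
      rw [pd_mul (hhr.differentiable one_ne_zero) (hL.differentiable one_ne_zero),
        pd_comp (hh.differentiable one_ne_zero) hrd]
    have q4 : ∀ i, pd i (fun y => h (r y)) x = deriv h (r x) * pd i r x := fun i => by
      rw [pd_comp (hh.differentiable one_ne_zero) hrd]
    have q5 : ∀ i, pd i (fun y => μ (r y)) x = deriv μ (r x) * pd i r x := fun i => by
      rw [pd_comp (hμ.differentiable two_ne_zero) hrd]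
    simp only [q1, q2, q3, q4, q5, hh' x hx] at hwx ⊢
    set L := ∑ i, pd i (pd i z) x
    set N := ‖∇ z x‖ ^ 2
    have s1 : ∑ i, deriv p (r x) * pd i r x * (deriv μ (r x) * pd i (fun y => ‖∇ z y‖ ^ 2) x +
        deriv (deriv μ) (r x) * pd i r x * N) =
        deriv p (r x) * deriv μ (r x) * ∑ i, pd i r x * pd i (fun y => ‖∇ z y‖ ^ 2) x +
        deriv p (r x) * deriv (deriv μ) (r x) * ‖∇ r x‖ ^ 2 * N := by
      rw [norm_gradient_sq, Finset.mul_sum, Finset.mul_sum, Finset.sum_mul,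
        ← Finset.sum_add_distrib]
      exact Finset.sum_congr rfl fun i _ => by ring
    have s2 : ∑ i, (h (r x) * pd i (fun y => ∑ i, pd i (pd i z) y) x +
        deriv p (r x) * deriv μ (r x) * pd i r x * L) * pd i z x =
        h (r x) * ∑ i, pd i z x * pd i (fun y => ∑ i, pd i (pd i z) y) x +
        deriv p (r x) * deriv μ (r x) * L * ∑ i, pd i r x * pd i z x := by
      rw [Finset.mul_sum, Finset.mul_sum, ← Finset.sum_add_distrib]
      exact Finset.sum_congr rfl fun i _ => by ring
    have s3 : ∑ i, deriv p (r x) * deriv μ (r x) * pd i r x * pd i (fun y => ‖∇ z y‖ ^ 2) x =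
        deriv p (r x) * deriv μ (r x) * ∑ i, pd i r x * pd i (fun y => ‖∇ z y‖ ^ 2) x := by
      rw [Finset.mul_sum]
      exact Finset.sum_congr rfl fun i _ => by ring
    have s4 : ∑ i, deriv μ (r x) * pd i r x * pd i z x =
        deriv μ (r x) * ∑ i, pd i r x * pd i z x := by
      rw [Finset.mul_sum]
      exact Finset.sum_congr rfl fun i _ => by ring
    rw [s4] at hwx
    rw [s1, s2, s3, ← hwx]
    ring
  rw [setIntegral_congr_fun hΩ.isOpen.measurableSet point, integral_add, integral_sub,
    integral_sub, integral_add, integral_sub, integral_const_mul, integral_const_mul,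
    integral_const_mul, d1, d2, d3]
  · ring
  · exact i1
  · exact i2.const_mul _
  · exact i1.sub (i2.const_mul _)
  · exact i6.const_mul _
  · exact (i1.sub (i2.const_mul _)).add (i6.const_mul _)
  · exact i3
  · exact ((i1.sub (i2.const_mul _)).add (i6.const_mul _)).sub i3
  · exact i4
  · exact (((i1.sub (i2.const_mul _)).add (i6.const_mul _)).sub i3).sub i4
  · exact i5.const_mul _

end Static

/-! ### Differentiation under the integral sign -/

section Parametric

variable {d : ℕ} {Ω : Set (EuclideanSpace ℝ (Fin d))}

theorem IsSmoothBoundedDomain.volume_lt_top (hΩ : IsSmoothBoundedDomain Ω) : volume Ω < ⊤ :=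
  hΩ.isBounded.measure_lt_top

theorem IsSmoothBoundedDomain.hasDerivAt_setIntegral (hΩ : IsSmoothBoundedDomain Ω)
    {f : ℝ → EuclideanSpace ℝ (Fin d) → ℝ} {f' : ℝ → EuclideanSpace ℝ (Fin d) → ℝ}
    (hf : ∀ τ, Continuous (f τ))
    (hf' : Continuous fun q : ℝ × EuclideanSpace ℝ (Fin d) => f' q.1 q.2)
    (hd : ∀ τ x, HasDerivAt (fun τ => f τ x) (f' τ x) τ) (t : ℝ) :
    HasDerivAt (fun τ => ∫ x in Ω, f τ x) (∫ x in Ω, f' t x) t := by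
  obtain ⟨C, hC⟩ := ((isCompact_closedBall t 1).prod
    hΩ.isCompact_closure).exists_bound_of_continuousOn hf'.continuousOn
  have hft : Continuous (f' t) := hf'.comp (by fun_prop : Continuous fun x => (t, x))
  refine (hasDerivAt_integral_of_dominated_loc_of_deriv_le (bound := fun _ => C)
    (s := Metric.ball t 1) (Metric.ball_mem_nhds t one_pos)
    (Eventually.of_forall fun τ => (hf τ).aestronglyMeasurable)
    (hΩ.integrableOn_of_continuousOn_closure (hf t).continuousOn)
    hft.aestronglyMeasurable ?_ ?_ ?_).2
  · filter_upwards [ae_restrict_mem hΩ.isOpen.measurableSet] with x hx τ hτ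
    exact hC (τ, x) ⟨Metric.ball_subset_closedBall hτ, subset_closure hx⟩
  · have : IsFiniteMeasure (volume.restrict Ω) := ⟨by simpa using hΩ.volume_lt_top⟩
    exact integrable_const C
  · exact Eventually.of_forall fun x τ _ => hd τ x

end Parametric

/-! ### Slices of functions of `(s, t, x)` -/

section Slices

variable {d : ℕ} {F : ℝ × ℝ × EuclideanSpace ℝ (Fin d) → ℝ}

theorem hasDerivAt_slice_fst (hF : Differentiable ℝ F) (σ τ : ℝ) (x : EuclideanSpace ℝ (Fin d)) :
    HasDerivAt (fun σ => F (σ, τ, x)) (fderiv ℝ F (σ, τ, x) (1, 0, 0)) σ :=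
  (hF (σ, τ, x)).hasFDerivAt.comp_hasDerivAt σ
    ((hasDerivAt_id σ).prodMk ((hasDerivAt_const σ τ).prodMk (hasDerivAt_const σ x)))

theorem hasDerivAt_slice_snd (hF : Differentiable ℝ F) (σ τ : ℝ) (x : EuclideanSpace ℝ (Fin d)) :
    HasDerivAt (fun τ => F (σ, τ, x)) (fderiv ℝ F (σ, τ, x) (0, 1, 0)) τ :=
  (hF (σ, τ, x)).hasFDerivAt.comp_hasDerivAt τ
    ((hasDerivAt_const τ σ).prodMk ((hasDerivAt_id τ).prodMk (hasDerivAt_const τ x)))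

theorem fderiv_slice (hF : Differentiable ℝ F) (σ τ : ℝ) (x v : EuclideanSpace ℝ (Fin d)) :
    fderiv ℝ (fun x => F (σ, τ, x)) x v = fderiv ℝ F (σ, τ, x) (0, 0, v) := by
  have h1 : HasFDerivAt (fun x : EuclideanSpace ℝ (Fin d) => (σ, τ, x))
      ((0 : EuclideanSpace ℝ (Fin d) →L[ℝ] ℝ).prod
        ((0 : EuclideanSpace ℝ (Fin d) →L[ℝ] ℝ).prod (ContinuousLinearMap.id ℝ _))) x :=
    (hasFDerivAt_const σ x).prodMk ((hasFDerivAt_const τ x).prodMk (hasFDerivAt_id x))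
  have h2 := ((hF (σ, τ, x)).hasFDerivAt.comp x h1).fderiv
  simp only [Function.comp_def] at h2
  rw [h2]
  simp

theorem inner_gradient_slice (hF : Differentiable ℝ F) (σ τ : ℝ)
    (x v : EuclideanSpace ℝ (Fin d)) :
    inner ℝ (∇ (fun x => F (σ, τ, x)) x) v = fderiv ℝ F (σ, τ, x) (0, 0, v) := by
  rw [inner_gradient_left, fderiv_slice hF]

theorem ContDiff.fderiv_const_apply {X : Type*} [NormedAddCommGroup X] [NormedSpace ℝ X]
    {F : X → ℝ} {n m : ℕ∞ω} (hF : ContDiff ℝ n F) (h : m + 1 ≤ n) (a : X) :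
    ContDiff ℝ m fun q => fderiv ℝ F q a :=
  (hF.fderiv_right h).clm_apply contDiff_const

theorem fderiv_fderiv_swap {X : Type*} [NormedAddCommGroup X] [NormedSpace ℝ X] {F : X → ℝ}
    (hF : ContDiff ℝ 2 F) (q a b : X) :
    fderiv ℝ (fun q => fderiv ℝ F q a) q b = fderiv ℝ (fun q => fderiv ℝ F q b) q a := by
  have h1 : DifferentiableAt ℝ (fderiv ℝ F) q :=
    ((hF.fderiv_right (m := 1) (by norm_num)).differentiable one_ne_zero) q
  have h2 : ∀ a b, fderiv ℝ (fun q => fderiv ℝ F q a) q b = fderiv ℝ (fderiv ℝ F) q b a := by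
    intro a b
    rw [(h1.hasFDerivAt.clm_apply (hasFDerivAt_const a q)).fderiv]
    simp
  rw [h2, h2]
  exact (hF.contDiffAt.isSymmSndFDerivAt (by simp)).eq _ _

end Slices

/-! ### The derivative of the action -/

section Action

variable {d : ℕ} {Ω : Set (EuclideanSpace ℝ (Fin d))}

/-- If the spatial integral identity `∫ ∂ₜR ξ = -σ ∫ ∇F · ∇ξ` holds, then so does its derivative
in the first parameter. -/
theorem IsSmoothBoundedDomain.hasDerivAt_integral_parameter_derivative
    (hΩ : IsSmoothBoundedDomain Ω) {R F : ℝ × ℝ × EuclideanSpace ℝ (Fin d) → ℝ}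
    (hR : ContDiff ℝ 2 R) (hF : ContDiff ℝ 2 F) {s τ : ℝ} (hs : s ∈ Icc (0 : ℝ) 1)
    {ξ : EuclideanSpace ℝ (Fin d) → ℝ} (hξ : ContDiff ℝ ∞ ξ)
    (hI : ∀ᶠ σ in 𝓝[Icc 0 1] s, ∫ x in Ω, fderiv ℝ R (σ, τ, x) (0, 1, 0) * ξ x =
      -σ * ∫ x in Ω, fderiv ℝ F (σ, τ, x) (0, 0, ∇ ξ x)) :
    HasDerivAt (fun τ => ∫ x in Ω, fderiv ℝ R (s, τ, x) (1, 0, 0) * ξ x)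
      (-(∫ x in Ω, fderiv ℝ F (s, τ, x) (0, 0, ∇ ξ x)) -
        s * ∫ x in Ω, fderiv ℝ (fun q => fderiv ℝ F q (1, 0, 0)) (s, τ, x) (0, 0, ∇ ξ x)) τ := by
  have hξc : Continuous (∇ ξ) := hξ.continuous_gradient (by simp)
  have hR1 : ∀ a, ContDiff ℝ 1 fun q => fderiv ℝ R q a := fun a =>
    hR.fderiv_const_apply (by norm_num) a
  have hF1 : ∀ a, ContDiff ℝ 1 fun q => fderiv ℝ F q a := fun a =>
    hF.fderiv_const_apply (by norm_num) a
  have e1 := hΩ.hasDerivAt_setIntegral (f := fun τ x => fderiv ℝ R (s, τ, x) (1, 0, 0) * ξ x)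
    (f' := fun τ x => fderiv ℝ (fun q => fderiv ℝ R q (1, 0, 0)) (s, τ, x) (0, 1, 0) * ξ x)
    (fun τ => (((hR1 _).continuous).comp (by fun_prop : Continuous fun x => (s, τ, x))).mul
      hξ.continuous)
    (((((hR1 _).continuous_fderiv one_ne_zero).comp
      (by fun_prop : Continuous fun q : ℝ × EuclideanSpace ℝ (Fin d) => (s, q.1, q.2))).clm_apply
        continuous_const).mul (hξ.continuous.comp continuous_snd))
    (fun τ x => (hasDerivAt_slice_snd ((hR1 _).differentiable one_ne_zero) s τ x).mul_const _) τ
  have e2 := hΩ.hasDerivAt_setIntegral (f := fun σ x => fderiv ℝ R (σ, τ, x) (0, 1, 0) * ξ x)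
    (f' := fun σ x => fderiv ℝ (fun q => fderiv ℝ R q (0, 1, 0)) (σ, τ, x) (1, 0, 0) * ξ x)
    (fun σ => (((hR1 _).continuous).comp (by fun_prop : Continuous fun x => (σ, τ, x))).mul
      hξ.continuous)
    (((((hR1 _).continuous_fderiv one_ne_zero).comp
      (by fun_prop : Continuous fun q : ℝ × EuclideanSpace ℝ (Fin d) => (q.1, τ, q.2))).clm_apply
        continuous_const).mul (hξ.continuous.comp continuous_snd))
    (fun σ x => (hasDerivAt_slice_fst ((hR1 _).differentiable one_ne_zero) σ τ x).mul_const _) s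
  have e3 := hΩ.hasDerivAt_setIntegral (f := fun σ x => fderiv ℝ F (σ, τ, x) (0, 0, ∇ ξ x))
    (f' := fun σ x => fderiv ℝ (fun q => fderiv ℝ F q (1, 0, 0)) (σ, τ, x) (0, 0, ∇ ξ x))
    (fun σ => (((hF.continuous_fderiv two_ne_zero)).comp
      (by fun_prop : Continuous fun x => (σ, τ, x))).clm_apply
        (by fun_prop : Continuous fun x => ((0 : ℝ), (0 : ℝ), ∇ ξ x)))
    ((((hF1 _).continuous_fderiv one_ne_zero).comp
      (by fun_prop : Continuous fun q : ℝ × EuclideanSpace ℝ (Fin d) => (q.1, τ, q.2))).clm_apply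
        (by fun_prop : Continuous fun q : ℝ × EuclideanSpace ℝ (Fin d) =>
          ((0 : ℝ), (0 : ℝ), ∇ ξ q.2)))
    (fun σ x => by
      rw [fderiv_fderiv_swap hF]
      exact hasDerivAt_slice_fst ((hF1 _).differentiable one_ne_zero) σ τ x) s
  have e4 := (hasDerivAt_neg s).mul e3
  -- The hypothesis is known only for parameters in `[0, 1]`, and `s` may be an endpoint, so both
  -- sides are differentiated within the interval and compared by uniqueness of that derivative.
  -- Symmetry of the mixed second derivative then turns the parameter derivative into the time
  -- derivative.
  have huniq : UniqueDiffWithinAt ℝ (Icc (0 : ℝ) 1) s := uniqueDiffOn_Icc zero_lt_one s hs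
  have e5 : HasDerivWithinAt (fun σ => ∫ x in Ω, fderiv ℝ R (σ, τ, x) (0, 1, 0) * ξ x)
      _ (Icc 0 1) s :=
    e4.hasDerivWithinAt.congr_of_eventuallyEq hI (hI.self_of_nhdsWithin hs)
  have e6 := huniq.eq_deriv _ e2.hasDerivWithinAt e5
  simp only [fderiv_fderiv_swap hR _ (1, 0, 0) (0, 1, 0)] at e1
  rw [e6] at e1
  convert e1 using 1
  ring

/-- Derivative of an energy `a = 2ℓ - b + E` with a quadratically small error. -/
theorem HasDerivAt.of_quadratic_error {a l b : ℝ → ℝ} {l' b' C t : ℝ}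
    (hl : HasDerivAt l l' t) (hb : HasDerivAt b b' t)
    (hE : ∀ᶠ τ in 𝓝 t, |a τ - (2 * l τ - b τ)| ≤ C * (τ - t) ^ 2) :
    HasDerivAt a (2 * l' - b') t := by
  have h1 : HasDerivAt (fun τ => a τ - (2 * l τ - b τ)) 0 t := by
    rw [hasDerivAt_iff_isLittleO]
    have h0 : a t - (2 * l t - b t) = 0 := by
      have := hE.self_of_nhds
      simpa using this
    simp only [h0, smul_zero, sub_zero]
    have h2 : (fun τ => a τ - (2 * l τ - b τ)) =O[𝓝 t] fun τ => (τ - t) ^ 2 := by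
      refine Asymptotics.IsBigO.of_bound C ?_
      filter_upwards [hE] with τ hτ
      rwa [Real.norm_eq_abs, Real.norm_eq_abs, abs_of_nonneg (sq_nonneg (τ - t))]
    refine h2.trans_isLittleO ?_
    have h3 : (fun τ => τ - t) =o[𝓝 t] fun _ => (1 : ℝ) := by
      rw [Asymptotics.isLittleO_one_iff]
      have : Continuous fun τ => τ - t := by fun_prop
      simpa using this.tendsto t
    have h4 := (Asymptotics.isBigO_refl (fun τ => τ - t) (𝓝 t)).mul_isLittleO h3
    simpa [sq] using h4
  have h2 := h1.add ((hl.const_mul 2).sub hb)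
  rw [zero_add] at h2
  refine h2.congr_of_eventuallyEq (Eventually.of_forall fun τ => ?_)
  simp

/-- No regularity of `Z` in time is assumed. The action at `τ` equals twice a linear functional of
`Z t`, minus a quadratic one, plus the energy of `Z τ - Z t`. The functional is Lipschitz in time
with a constant controlled by the L¹ norm of the gradient of its argument, so the energy is bounded
by `|τ - t|` times the L¹ norm of its own gradient, and hence is quadratically small. -/
theorem IsSmoothBoundedDomain.hasDerivAt_action (hΩ : IsSmoothBoundedDomain Ω)
    {R F : ℝ × ℝ × EuclideanSpace ℝ (Fin d) → ℝ} (hR : ContDiff ℝ 2 R) (hF : ContDiff ℝ 2 F)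
    {m : ℝ × ℝ × EuclideanSpace ℝ (Fin d) → ℝ} (hm : ContDiff ℝ 1 m)
    {s t δ c : ℝ} (hs : s ∈ Icc (0 : ℝ) 1) (hδ : 0 < δ) (hc : 0 < c)
    (hmc : ∀ τ ∈ Metric.ball t δ, ∀ x ∈ Ω, c ≤ m (s, τ, x))
    {Z : ℝ → EuclideanSpace ℝ (Fin d) → ℝ}
    (hZ : ∀ τ ∈ Metric.ball t δ, ContDiff ℝ ∞ (Z τ) ∧ HasCompactSupport (Z τ))
    (hB : ∀ τ ∈ Metric.ball t δ, ∀ ξ : EuclideanSpace ℝ (Fin d) → ℝ, ContDiff ℝ ∞ ξ →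
      ∫ x in Ω, m (s, τ, x) * inner ℝ (∇ (Z τ) x) (∇ ξ x) =
        ∫ x in Ω, fderiv ℝ R (s, τ, x) (1, 0, 0) * ξ x)
    (hI : ∀ τ ∈ Metric.ball t δ, ∀ ξ : EuclideanSpace ℝ (Fin d) → ℝ, ContDiff ℝ ∞ ξ →
      HasCompactSupport ξ → ∀ᶠ σ in 𝓝[Icc 0 1] s,
      ∫ x in Ω, fderiv ℝ R (σ, τ, x) (0, 1, 0) * ξ x =
        -σ * ∫ x in Ω, fderiv ℝ F (σ, τ, x) (0, 0, ∇ ξ x)) :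
    HasDerivAt (fun τ => ∫ x in Ω, m (s, τ, x) * ‖∇ (Z τ) x‖ ^ 2)
      (2 * (-(∫ x in Ω, fderiv ℝ F (s, t, x) (0, 0, ∇ (Z t) x)) -
        s * ∫ x in Ω, fderiv ℝ (fun q => fderiv ℝ F q (1, 0, 0)) (s, t, x) (0, 0, ∇ (Z t) x)) -
        ∫ x in Ω, fderiv ℝ m (s, t, x) (0, 1, 0) * ‖∇ (Z t) x‖ ^ 2) t := by
  have htb : t ∈ Metric.ball t δ := Metric.mem_ball_self hδ
  have hgc : ∀ {f : EuclideanSpace ℝ (Fin d) → ℝ}, ContDiff ℝ ∞ f → Continuous (∇ f) :=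
    fun hf => hf.continuous_gradient (by simp)
  have int : ∀ {f : EuclideanSpace ℝ (Fin d) → ℝ}, Continuous f → IntegrableOn f Ω :=
    fun hf => hΩ.integrableOn_of_continuousOn_closure hf.continuousOn
  have hmτ : ∀ τ, Continuous fun x => m (s, τ, x) := fun τ => hm.continuous.comp (by fun_prop)
  have hZt := (hZ t htb).1
  have : IsFiniteMeasure (volume.restrict Ω) := ⟨by simpa using hΩ.volume_lt_top⟩
  -- bounds
  set F1 : ℝ × ℝ × EuclideanSpace ℝ (Fin d) → ℝ := fun q => fderiv ℝ F q (1, 0, 0) with hF1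
  have hF1c : ContDiff ℝ 1 F1 := hF.fderiv_const_apply (by norm_num) _
  set K : Set (ℝ × ℝ × EuclideanSpace ℝ (Fin d)) :=
    {s} ×ˢ Metric.closedBall t δ ×ˢ closure Ω with hK
  have hKc : IsCompact K :=
    isCompact_singleton.prod ((isCompact_closedBall t δ).prod hΩ.isCompact_closure)
  have hKm : ∀ τ ∈ Metric.ball t δ, ∀ x ∈ Ω, (s, τ, x) ∈ K := fun τ hτ x hx =>
    ⟨rfl, Metric.ball_subset_closedBall hτ, subset_closure hx⟩
  obtain ⟨C₁, hC₁⟩ := hKc.exists_bound_of_continuousOn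
    (hF.continuous_fderiv two_ne_zero).continuousOn
  obtain ⟨C₂, hC₂⟩ := hKc.exists_bound_of_continuousOn
    (hF1c.continuous_fderiv one_ne_zero).continuousOn
  obtain ⟨C₃, hC₃⟩ := hKc.exists_bound_of_continuousOn
    (hm.continuous_fderiv one_ne_zero).continuousOn
  obtain ⟨C₄, hC₄⟩ := hΩ.isCompact_closure.exists_bound_of_continuousOn (hgc hZt).continuousOn
  -- the linear functional
  set l : (EuclideanSpace ℝ (Fin d) → ℝ) → ℝ → ℝ := fun ξ τ =>
    ∫ x in Ω, fderiv ℝ R (s, τ, x) (1, 0, 0) * ξ x with hl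
  have hl' : ∀ ξ : EuclideanSpace ℝ (Fin d) → ℝ, ContDiff ℝ ∞ ξ → HasCompactSupport ξ →
      ∀ τ ∈ Metric.ball t δ, HasDerivAt (l ξ) (-(∫ x in Ω, fderiv ℝ F (s, τ, x) (0, 0, ∇ ξ x)) -
        s * ∫ x in Ω, fderiv ℝ F1 (s, τ, x) (0, 0, ∇ ξ x)) τ := fun ξ hξ hξc τ hτ =>
    hΩ.hasDerivAt_integral_parameter_derivative hR hF hs hξ (hI τ hτ ξ hξ hξc)
  have hnorm : ∀ v : EuclideanSpace ℝ (Fin d), ‖((0 : ℝ), (0 : ℝ), v)‖ = ‖v‖ := fun v => by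
    simp [Prod.norm_def]
  have hbound : ∀ {G : ℝ × ℝ × EuclideanSpace ℝ (Fin d) → ℝ} {C : ℝ},
      (∀ q ∈ K, ‖fderiv ℝ G q‖ ≤ C) → ∀ ξ : EuclideanSpace ℝ (Fin d) → ℝ, ContDiff ℝ ∞ ξ →
      ∀ τ ∈ Metric.ball t δ,
      |∫ x in Ω, fderiv ℝ G (s, τ, x) (0, 0, ∇ ξ x)| ≤ C * ∫ x in Ω, ‖∇ ξ x‖ := by
    intro G C hC ξ hξ τ hτ
    rw [← Real.norm_eq_abs, ← integral_const_mul]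
    refine norm_integral_le_of_norm_le ((int (hgc hξ).norm).const_mul _) ?_
    filter_upwards [ae_restrict_mem hΩ.isOpen.measurableSet] with x hx
    refine ((fderiv ℝ G (s, τ, x)).le_opNorm _).trans ?_
    rw [hnorm]
    exact mul_le_mul_of_nonneg_right (hC _ (hKm τ hτ x hx)) (norm_nonneg _)
  -- Although `l ξ` is defined through `ξ`, its time derivative involves only `∇ξ`. This is what
  -- later permits `ξ = Z τ - Z t`, on which only the gradient is controlled.
  have hlLip : ∀ ξ : EuclideanSpace ℝ (Fin d) → ℝ, ContDiff ℝ ∞ ξ → HasCompactSupport ξ →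
      ∀ τ ∈ Metric.ball t δ, |l ξ τ - l ξ t| ≤ (C₁ + C₂) * (∫ x in Ω, ‖∇ ξ x‖) * |τ - t| := by
    intro ξ hξ hξc τ hτ
    refine (convex_ball t δ).norm_image_sub_le_of_norm_hasDerivWithin_le
      (fun y hy => (hl' ξ hξ hξc y hy).hasDerivWithinAt) (fun y hy => ?_) htb hτ
    have k1 := hbound hC₁ ξ hξ y hy
    have k2 := hbound hC₂ ξ hξ y hy
    have k3 : |s * ∫ x in Ω, fderiv ℝ F1 (s, y, x) (0, 0, ∇ ξ x)| ≤ C₂ * ∫ x in Ω, ‖∇ ξ x‖ := by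
      rw [abs_mul, abs_of_nonneg hs.1]
      exact (mul_le_of_le_one_left (abs_nonneg _) hs.2).trans k2
    rw [Real.norm_eq_abs]
    refine (abs_sub _ _).trans ?_
    rw [abs_neg]
    linarith
  have hmLip : ∀ τ ∈ Metric.ball t δ, ∀ x ∈ Ω, |m (s, τ, x) - m (s, t, x)| ≤ C₃ * |τ - t| := by
    intro τ hτ x hx
    refine (convex_ball t δ).norm_image_sub_le_of_norm_hasDerivWithin_le
      (f := fun τ => m (s, τ, x))
      (fun y hy => (hasDerivAt_slice_snd (hm.differentiable one_ne_zero) s y x).hasDerivWithinAt)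
      (fun y hy => ?_) htb hτ
    refine ((fderiv ℝ m (s, y, x)).le_opNorm _).trans ?_
    have : ‖((0 : ℝ), (1 : ℝ), (0 : EuclideanSpace ℝ (Fin d)))‖ = 1 := by simp [Prod.norm_def]
    rw [this, mul_one]
    exact hC₃ _ (hKm y hy x hx)
  have hb := hΩ.hasDerivAt_setIntegral (f := fun τ x => m (s, τ, x) * ‖∇ (Z t) x‖ ^ 2)
    (f' := fun τ x => fderiv ℝ m (s, τ, x) (0, 1, 0) * ‖∇ (Z t) x‖ ^ 2)
    (fun τ => (hmτ τ).mul ((hgc hZt).norm.pow 2))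
    ((((hm.continuous_fderiv one_ne_zero).comp
      (by fun_prop : Continuous fun q : ℝ × EuclideanSpace ℝ (Fin d) => (s, q.1, q.2))).clm_apply
        continuous_const).mul (((hgc hZt).comp continuous_snd).norm.pow 2))
    (fun τ x => (hasDerivAt_slice_snd (hm.differentiable one_ne_zero) s τ x).mul_const _) t
  refine HasDerivAt.of_quadratic_error (l := l (Z t))
    (C := (C₁ + C₂ + C₃ * C₄) ^ 2 / c * (volume.restrict Ω).real univ) (hl' _ hZt (hZ t htb).2 t htb)
    hb ?_
  filter_upwards [Metric.ball_mem_nhds t hδ] with τ hτ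
  have hZτ := (hZ τ hτ).1
  set ξ : EuclideanSpace ℝ (Fin d) → ℝ := fun x => Z τ x - Z t x with hξdef
  have hξ : ContDiff ℝ ∞ ξ := hZτ.sub hZt
  have hξc : HasCompactSupport ξ := (hZ τ hτ).2.sub (hZ t htb).2
  have hξg : ∀ x, ∇ ξ x = ∇ (Z τ) x - ∇ (Z t) x := fun x => by
    simp only [gradient, hξdef]
    rw [fderiv_fun_sub ((hZτ.differentiable (by simp)) x) ((hZt.differentiable (by simp)) x),
      map_sub]
  set J := ∫ x in Ω, ‖∇ ξ x‖ with hJ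
  set E := ∫ x in Ω, m (s, τ, x) * ‖∇ ξ x‖ ^ 2 with hE
  have ic1 : IntegrableOn (fun x => m (s, τ, x) * inner ℝ (∇ (Z τ) x) (∇ (Z τ) x)) Ω :=
    int ((hmτ τ).mul ((hgc hZτ).inner (hgc hZτ)))
  have ic2 : IntegrableOn (fun x => m (s, τ, x) * inner ℝ (∇ (Z τ) x) (∇ (Z t) x)) Ω :=
    int ((hmτ τ).mul ((hgc hZτ).inner (hgc hZt)))
  have ic3 : IntegrableOn (fun x => m (s, τ, x) * ‖∇ (Z t) x‖ ^ 2) Ω :=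
    int ((hmτ τ).mul ((hgc hZt).norm.pow 2))
  have icE : IntegrableOn (fun x => m (s, τ, x) * ‖∇ ξ x‖ ^ 2) Ω :=
    int ((hmτ τ).mul ((hgc hξ).norm.pow 2))
  -- Completing the square: the mixed term is rewritten by testing the equation of `Z τ` with `Z t`.
  have hEeq : (∫ x in Ω, m (s, τ, x) * ‖∇ (Z τ) x‖ ^ 2) -
      (2 * l (Z t) τ - ∫ x in Ω, m (s, τ, x) * ‖∇ (Z t) x‖ ^ 2) = E := by
    simp only [hl]
    rw [← hB τ hτ _ hZt]
    simp_rw [← real_inner_self_eq_norm_sq (∇ (Z τ) _)]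
    have ic4 : IntegrableOn (fun x => 2 * (m (s, τ, x) * inner ℝ (∇ (Z τ) x) (∇ (Z t) x)) -
      m (s, τ, x) * ‖∇ (Z t) x‖ ^ 2) Ω := (ic2.const_mul 2).sub ic3
    rw [← integral_const_mul, ← integral_sub (ic2.const_mul 2) ic3, ← integral_sub ic1 ic4, hE]
    refine integral_congr_ae (ae_of_all _ fun x => ?_)
    dsimp only
    rw [hξg, norm_sub_sq_real, ← real_inner_self_eq_norm_sq (∇ (Z τ) _)]
    ring
  -- The difference of the equations at times `τ` and `t`, both tested with `ξ = Z τ - Z t`.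
  have hE1 : E = (l ξ τ - l ξ t) -
      ∫ x in Ω, (m (s, τ, x) - m (s, t, x)) * inner ℝ (∇ (Z t) x) (∇ ξ x) := by
    simp only [hl]
    rw [← hB τ hτ _ hξ, ← hB t htb _ hξ, ← integral_sub, ← integral_sub, hE]
    · refine integral_congr_ae (ae_of_all _ fun x => ?_)
      dsimp only
      rw [← real_inner_self_eq_norm_sq]
      conv_lhs => rw [hξg, inner_sub_left, ← hξg]
      ring
    · exact (int ((hmτ τ).mul ((hgc hZτ).inner (hgc hξ)))).sub
        (int ((hmτ t).mul ((hgc hZt).inner (hgc hξ))))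
    · exact int (((hmτ τ).sub (hmτ t)).mul ((hgc hZt).inner (hgc hξ)))
    · exact int ((hmτ τ).mul ((hgc hZτ).inner (hgc hξ)))
    · exact int ((hmτ t).mul ((hgc hZt).inner (hgc hξ)))
  have hE2 : |∫ x in Ω, (m (s, τ, x) - m (s, t, x)) * inner ℝ (∇ (Z t) x) (∇ ξ x)| ≤
      C₃ * |τ - t| * C₄ * J := by
    rw [← Real.norm_eq_abs, hJ, ← integral_const_mul]
    refine norm_integral_le_of_norm_le ((int (hgc hξ).norm).const_mul _) ?_
    filter_upwards [ae_restrict_mem hΩ.isOpen.measurableSet] with x hx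
    rw [norm_mul, mul_assoc (C₃ * |τ - t|)]
    have h1 := hmLip τ hτ x hx
    refine mul_le_mul h1 ((norm_inner_le_norm _ _).trans ?_) (norm_nonneg _)
      ((abs_nonneg _).trans h1)
    exact mul_le_mul_of_nonneg_right (hC₄ x (subset_closure hx)) (norm_nonneg _)
  set Λ := C₁ + C₂ + C₃ * C₄ with hΛ
  have hE3 : E ≤ Λ * |τ - t| * J := by
    have h1 := hlLip ξ hξ hξc τ hτ
    have h2 := le_abs_self (l ξ τ - l ξ t)
    have h3 := neg_abs_le (∫ x in Ω, (m (s, τ, x) - m (s, t, x)) * inner ℝ (∇ (Z t) x) (∇ ξ x))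
    rw [hE1, hΛ]
    nlinarith
  -- Young's inequality with weight `c`, the lower bound of the mobility: half of the energy is
  -- absorbed, leaving `E ≤ (Λ² / c) |Ω| (τ - t)²`.
  have hE4 : Λ * |τ - t| * J ≤ E / 2 + Λ ^ 2 * (τ - t) ^ 2 / (2 * c) *
      (volume.restrict Ω).real univ := by
    rw [hJ, hE, ← integral_const_mul, ← integral_div]
    have : Λ ^ 2 * (τ - t) ^ 2 / (2 * c) * (volume.restrict Ω).real univ =
        ∫ _ in Ω, Λ ^ 2 * (τ - t) ^ 2 / (2 * c) := by
      rw [integral_const, smul_eq_mul, mul_comm]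
    rw [this, ← integral_add (icE.div_const 2) (integrable_const _)]
    refine setIntegral_mono_on ((int (hgc hξ).norm).const_mul _)
      ((icE.div_const 2).add (integrable_const _)) hΩ.isOpen.measurableSet fun x hx => ?_
    have h1 := hmc τ hτ x hx
    have h2 : c * ‖∇ ξ x‖ ^ 2 ≤ m (s, τ, x) * ‖∇ ξ x‖ ^ 2 := by gcongr
    have h3 : Λ * |τ - t| * ‖∇ ξ x‖ ≤
        c * ‖∇ ξ x‖ ^ 2 / 2 + Λ ^ 2 * (τ - t) ^ 2 / (2 * c) := by
      have h4 : 0 ≤ (c * ‖∇ ξ x‖ - Λ * |τ - t|) ^ 2 / (2 * c) := by positivity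
      have h5 : (c * ‖∇ ξ x‖ - Λ * |τ - t|) ^ 2 / (2 * c) = c * ‖∇ ξ x‖ ^ 2 / 2 +
          Λ ^ 2 * (τ - t) ^ 2 / (2 * c) - Λ * |τ - t| * ‖∇ ξ x‖ := by
        rw [← sq_abs (τ - t)]
        field_simp
        ring
      linarith
    linarith
  have hE0 : 0 ≤ E := setIntegral_nonneg hΩ.isOpen.measurableSet fun x hx =>
    mul_nonneg (hc.le.trans (hmc τ hτ x hx)) (sq_nonneg _)
  rw [hEeq, abs_of_nonneg hE0]
  have : Λ ^ 2 / c * (volume.restrict Ω).real univ * (τ - t) ^ 2 =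
      2 * (Λ ^ 2 * (τ - t) ^ 2 / (2 * c) * (volume.restrict Ω).real univ) := by
    field_simp
  rw [this]
  linarith

end Action

/-! ### Monotonicity: weak gradients of nondecreasing functions of a smooth function -/

section WeakGradient

variable {d : ℕ} {Ω : Set (EuclideanSpace ℝ (Fin d))}

theorem MeasureTheory.LocallyIntegrableOn.integrableOn_smul_of_hasCompactSupport {F : Type*}
    [NormedAddCommGroup F] [NormedSpace ℝ F] {q : EuclideanSpace ℝ (Fin d) → F}
    (hq : LocallyIntegrableOn q Ω) {φ : EuclideanSpace ℝ (Fin d) → ℝ} (hφ : Continuous φ)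
    (hc : HasCompactSupport φ) (hs : tsupport φ ⊆ Ω) : IntegrableOn (fun x => φ x • q x) Ω := by
  have h1 : IntegrableOn (fun x => φ x • q x) (tsupport φ) :=
    (hq.integrableOn_compact_subset hs hc).continuousOn_smul hφ.continuousOn hc
  have h2 : Integrable (fun x => φ x • q x) :=
    (integrableOn_iff_integrable_of_support_subset fun x hx => subset_tsupport _ fun h0 => hx
      (by simp [h0])).1 h1
  exact h2.integrableOn

/-- The definition of the weak gradient tested, coordinate by coordinate, with `ψ ∂ᵢf`. -/
theorem HasWeakGradient.integral_mul_divergence {q : EuclideanSpace ℝ (Fin d) → ℝ}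
    {g : EuclideanSpace ℝ (Fin d) → EuclideanSpace ℝ (Fin d)} (hg : HasWeakGradient Ω q g)
    {ψ f : EuclideanSpace ℝ (Fin d) → ℝ} (hψ : ContDiff ℝ ∞ ψ) (hψc : HasCompactSupport ψ)
    (hψs : tsupport ψ ⊆ Ω) (hf : ContDiff ℝ ∞ f) :
    ∫ x in Ω, q x * divergence (fun y => ψ y • ∇ f y) x =
      -∫ x in Ω, ψ x * inner ℝ (g x) (∇ f x) := by
  have hφ : ∀ i, ContDiff ℝ ∞ fun x => ψ x * pd i f x := fun i =>
    hψ.mul (hf.pd (by simp) i)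
  have hφc : ∀ i, HasCompactSupport fun x => ψ x * pd i f x := fun i => hψc.mul_right
  have hφs : ∀ i, tsupport (fun x => ψ x * pd i f x) ⊆ Ω := fun i =>
    (tsupport_mul_subset_left).trans hψs
  have key : ∀ i, ∫ x in Ω, q x * pd i (fun x => ψ x * pd i f x) x =
      -∫ x in Ω, ψ x * pd i f x * g x i := by
    intro i
    have h1 := congrArg (EuclideanSpace.proj (𝕜 := ℝ) i) (hg.2.2 _ (hφ i) (hφc i) (hφs i))
    rw [map_neg, ← ContinuousLinearMap.integral_comp_comm,
      ← ContinuousLinearMap.integral_comp_comm] at h1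
    · simpa [gradient_coord] using h1
    · exact hg.2.1.integrableOn_smul_of_hasCompactSupport (hφ i).continuous (hφc i) (hφs i)
    · have h2 : Continuous (∇ fun x => ψ x * pd i f x) := (hφ i).continuous_gradient (by simp)
      have h3 : IntegrableOn (fun x => q x • ∇ (fun x => ψ x * pd i f x) x)
          (tsupport fun x => ψ x * pd i f x) :=
        (hg.1.integrableOn_compact_subset (hφs i) (hφc i)).smul_continuousOn h2.continuousOn (hφc i)
      refine ((integrableOn_iff_integrable_of_support_subset fun x hx => ?_).1 h3).integrableOn
      refine tsupport_fderiv_subset ℝ (subset_tsupport _ fun h0 => hx ?_)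
      simp [gradient, h0]
  have hint1 : ∀ i, IntegrableOn (fun x => ψ x * pd i f x * g x i) Ω := fun i => by
    have := (hg.2.1.integrableOn_smul_of_hasCompactSupport (hφ i).continuous (hφc i) (hφs i))
    simpa [IntegrableOn] using (EuclideanSpace.proj (𝕜 := ℝ) i).integrable_comp this
  have hint2 : ∀ i, IntegrableOn (fun x => q x * pd i (fun x => ψ x * pd i f x) x) Ω := fun i => by
    have h3 : ContDiff ℝ ∞ (pd i fun x => ψ x * pd i f x) := (hφ i).pd (by simp) i
    have := hg.1.integrableOn_smul_of_hasCompactSupport h3.continuous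
      ((hφc i).fderiv_apply (𝕜 := ℝ) _) ((tsupport_fderiv_apply_subset ℝ _).trans (hφs i))
    simpa [mul_comm] using this
  calc _ = ∫ x in Ω, ∑ i, q x * pd i (fun x => ψ x * pd i f x) x := by
        refine integral_congr_ae (ae_of_all _ fun x => ?_)
        dsimp only
        rw [divergence_smul_gradient (hψ.of_le (WithTop.coe_le_coe.2 le_top)) (hf.of_le (WithTop.coe_le_coe.2 le_top)),
          ← Finset.mul_sum]
        congr 1
        rw [Finset.mul_sum, ← Finset.sum_add_distrib]
        refine Finset.sum_congr rfl fun i _ => ?_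
        rw [pd_mul (hψ.differentiable (by simp)) ((hf.pd (m := ∞) (by simp) i).differentiable (by simp))]
        ring
    _ = ∑ i, -∫ x in Ω, ψ x * pd i f x * g x i := by
        rw [integral_finsetSum _ fun i _ => hint2 i]
        exact Finset.sum_congr rfl fun i _ => key i
    _ = _ := by
        rw [Finset.sum_neg_distrib, ← integral_finsetSum _ fun i _ => hint1 i]
        congr 1
        refine integral_congr_ae (ae_of_all _ fun x => ?_)
        simp only [PiLp.inner_apply, gradient_coord, Finset.mul_sum]
        refine Finset.sum_congr rfl fun i _ => ?_
        simp
        ring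

/-- `∫ Q(f) ∇ · (ψ ∇f) ≤ 0` for nondecreasing `Q` and `ψ ≥ 0`. -/
theorem IsSmoothBoundedDomain.integral_comp_mul_divergence_nonpos (hΩ : IsSmoothBoundedDomain Ω)
    {Q : ℝ → ℝ} (hQ : Monotone Q) (hQc : Continuous Q) {ψ f : EuclideanSpace ℝ (Fin d) → ℝ}
    (hψ : ContDiff ℝ ∞ ψ) (hψs : tsupport ψ ⊆ Ω) (hψ0 : ∀ x, 0 ≤ ψ x) (hf : ContDiff ℝ ∞ f) :
    ∫ x in Ω, Q (f x) * divergence (fun y => ψ y • ∇ f y) x ≤ 0 := by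
  have hdivc : Continuous (divergence fun y => ψ y • ∇ f y) :=
    continuous_divergence_smul_gradient (hψ.of_le (WithTop.coe_le_coe.2 le_top)) (hf.of_le (WithTop.coe_le_coe.2 le_top))
  -- smoothing by averages
  set I : ℝ → ℝ := fun r => ∫ y in (0 : ℝ)..r, Q y with hI
  have hI' : ∀ r, HasDerivAt I (Q r) r := fun r => hQc.integral_hasStrictDerivAt 0 r |>.hasDerivAt
  have smooth : ∀ ε : ℝ, 0 < ε →
      ∫ x in Ω, (I (f x + ε) - I (f x)) / ε * divergence (fun y => ψ y • ∇ f y) x ≤ 0 := by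
    intro ε hε
    set q : ℝ → ℝ := fun r => (I (r + ε) - I r) / ε with hq
    -- Averaging gains one derivative: `q` is C¹, and its derivative, a difference quotient of `Q`,
    -- is nonnegative.
    have hq' : ∀ r, HasDerivAt q ((Q (r + ε) - Q r) / ε) r := fun r =>
      (((hI' (r + ε)).comp_add_const r ε).sub (hI' r)).div_const ε
    have hqc : ContDiff ℝ 1 q := by
      rw [contDiff_one_iff_deriv]
      refine ⟨fun r => (hq' r).differentiableAt, ?_⟩
      have : deriv q = fun r => (Q (r + ε) - Q r) / ε := funext fun r => (hq' r).deriv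
      rw [this]
      fun_prop
    have hqf : ContDiff ℝ 1 fun x => q (f x) := hqc.comp (hf.of_le (WithTop.coe_le_coe.2 le_top))
    have hψ1 : ContDiff ℝ 1 ψ := hψ.of_le (WithTop.coe_le_coe.2 le_top)
    have hf2 : ContDiff ℝ 2 f := hf.of_le (WithTop.coe_le_coe.2 le_top)
    have h1 := hΩ.setIntegral_divergence_smul_gradient (hqf.mul hψ1) hf2
    rw [setIntegral_eq_zero_of_forall_eq_zero (t := frontier Ω)] at h1
    swap
    · intro x hx
      have : ψ x = 0 := image_eq_zero_of_notMem_tsupport fun h =>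
        (hΩ.isOpen.inter_frontier_eq ▸ ⟨hψs h, hx⟩ : x ∈ (∅ : Set _))
      simp [this]
    -- The divergence of `q(f) ψ ∇f` integrates to zero since `ψ` vanishes on the boundary. The
    -- product rule splits it into the wanted integrand and the nonnegative term `ψ q'(f) |∇f|²`.
    have h2 : ∀ x, divergence (fun y => (q (f y) * ψ y) • ∇ f y) x =
        q (f x) * divergence (fun y => ψ y • ∇ f y) x +
          ψ x * ((Q (f x + ε) - Q (f x)) / ε * ‖∇ f x‖ ^ 2) := by
      intro x
      rw [divergence_smul_gradient (hqf.mul hψ1) hf2, divergence_smul_gradient hψ1 hf2,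
        norm_gradient_sq]
      simp only [Finset.mul_sum, ← Finset.sum_add_distrib]
      refine Finset.sum_congr rfl fun i _ => ?_
      rw [pd_mul (hqf.differentiable one_ne_zero) (hψ1.differentiable one_ne_zero),
        pd_comp (hqc.differentiable one_ne_zero) (hf2.differentiable two_ne_zero)]
      simp only [(hq' _).deriv]
      ring
    have hc3 : Continuous fun x => ψ x * ((Q (f x + ε) - Q (f x)) / ε * ‖∇ f x‖ ^ 2) := by
      have := hf.continuous_gradient (by simp)
      have := hf.continuous
      have := hψ.continuous
      fun_prop
    have i1 : IntegrableOn (fun x => q (f x) * divergence (fun y => ψ y • ∇ f y) x) Ω :=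
      hΩ.integrableOn_of_continuousOn_closure (hqf.continuous.mul hdivc).continuousOn
    have i2 := hΩ.integrableOn_of_continuousOn_closure hc3.continuousOn
    simp only [h2] at h1
    rw [integral_add i1 i2] at h1
    have h3 : 0 ≤ ∫ x in Ω, ψ x * ((Q (f x + ε) - Q (f x)) / ε * ‖∇ f x‖ ^ 2) := by
      refine integral_nonneg fun x => ?_
      have : 0 ≤ Q (f x + ε) - Q (f x) := sub_nonneg.2 (hQ (by linarith))
      have := hψ0 x
      dsimp only
      positivity
    linarith
  -- passage to the limit
  have hQf : Continuous fun x => Q (f x + 1) := hQc.comp (hf.continuous.add_const 1)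
  obtain ⟨C, hC⟩ := hΩ.isCompact_closure.exists_bound_of_continuousOn hQf.continuousOn
  obtain ⟨C', hC'⟩ := hΩ.isCompact_closure.exists_bound_of_continuousOn
    ((hQc.comp hf.continuous).continuousOn)
  set e : ℕ → ℝ := fun n => 1 / ((n : ℝ) + 1) with he
  have he0 : ∀ n, 0 < e n := fun n => Nat.one_div_pos_of_nat
  have he1 : ∀ n, e n ≤ 1 := fun n => by
    rw [he]
    exact (div_le_one (by positivity)).2 (by linarith [n.cast_nonneg (α := ℝ)])
  -- The averages over steps of length at most 1 lie between `Q r` and `Q (r + 1)`, which supplies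
  -- the dominating function.
  have hmv : ∀ n, ∀ r, Q r ≤ (I (r + e n) - I r) / e n ∧ (I (r + e n) - I r) / e n ≤ Q (r + 1) := by
    intro n r
    have h1 : I (r + e n) - I r = ∫ y in r..(r + e n), Q y :=
      intervalIntegral.integral_interval_sub_left (hQc.intervalIntegrable (μ := volume) _ _)
        (hQc.intervalIntegrable (μ := volume) _ _)
    rw [h1, le_div_iff₀ (he0 n), div_le_iff₀ (he0 n)]
    have hle : r ≤ r + e n := by linarith [he0 n]
    constructor
    · have := intervalIntegral.integral_mono_on hle (intervalIntegrable_const (c := Q r))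
        (hQc.intervalIntegrable (μ := volume) _ _) fun y hy => hQ hy.1
      simpa [mul_comm] using this
    · have := intervalIntegral.integral_mono_on hle (hQc.intervalIntegrable (μ := volume) _ _)
        (intervalIntegrable_const (c := Q (r + 1)))
        fun y hy => hQ (hy.2.trans (by linarith [he1 n]))
      simpa [mul_comm] using this
  have hIc : Continuous I := continuous_iff_continuousAt.2 fun r => (hI' r).continuousAt
  have lim : Tendsto (fun n => ∫ x in Ω, (I (f x + e n) - I (f x)) / e n *
      divergence (fun y => ψ y • ∇ f y) x) atTop
      (𝓝 (∫ x in Ω, Q (f x) * divergence (fun y => ψ y • ∇ f y) x)) := by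
    refine tendsto_integral_of_dominated_convergence
      (fun x => (C + C') * ‖divergence (fun y => ψ y • ∇ f y) x‖) (fun n => ?_) ?_ (fun n => ?_) ?_
    · have := hf.continuous
      exact (Continuous.mul (by fun_prop) hdivc).aestronglyMeasurable
    · exact (hΩ.integrableOn_of_continuousOn_closure hdivc.norm.continuousOn).const_mul _
    · filter_upwards [ae_restrict_mem hΩ.isOpen.measurableSet] with x hx
      rw [norm_mul]
      refine mul_le_mul_of_nonneg_right ?_ (norm_nonneg _)
      have h1 := hC x (subset_closure hx)
      have h2 := hC' x (subset_closure hx)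
      obtain ⟨h3, h3'⟩ := hmv n (f x)
      simp only [Real.norm_eq_abs, Function.comp] at h1 h2 ⊢
      have h4 := (abs_nonneg _).trans h1
      have h5 := (abs_nonneg _).trans h2
      rw [abs_le] at h1 h2 ⊢
      constructor <;> linarith
    · refine ae_of_all _ fun x => Tendsto.mul_const _ ?_
      have h1 := (hI' (f x)).tendsto_slope_zero_right
      have h2 : Tendsto e atTop (𝓝[>] 0) :=
        tendsto_nhdsWithin_iff.2 ⟨tendsto_one_div_add_atTop_nhds_zero_nat, Eventually.of_forall he0⟩
      refine (h1.comp h2).congr fun n => ?_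
      simp [div_eq_inv_mul]
  exact le_of_tendsto' lim fun n => smooth _ (he0 n)


theorem tsupport_divergence_subset
    (F : EuclideanSpace ℝ (Fin d) → EuclideanSpace ℝ (Fin d)) :
    tsupport (divergence F) ⊆ tsupport F := by
  refine closure_minimal (fun x hx => ?_) (isClosed_tsupport F)
  by_contra h
  refine hx ?_
  have h1 : fderiv ℝ F x = 0 := by
    by_contra h0
    exact h (tsupport_fderiv_subset ℝ (subset_tsupport _ h0))
  simp [divergence, h1]

/-- Truncation levels exhausting `[0, M)`, uniformly for finite and infinite `M`. -/
theorem exists_seq_densityRange {M : EReal} (hM : 0 < M) :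
    ∃ K : ℕ → ℝ, (∀ n, K n ∈ densityRange M) ∧ ∀ r ∈ densityRange M, ∀ᶠ n in atTop, r ≤ K n := by
  obtain ⟨u, -, hu, hlim⟩ := exists_seq_strictMono_tendsto' hM
  have hne : ∀ n, u n ≠ ⊤ ∧ u n ≠ ⊥ := fun n =>
    ⟨((hu n).2.trans_le le_top).ne, (EReal.bot_lt_zero.trans (hu n).1).ne'⟩
  have hcoe : ∀ n, ((u n).toReal : EReal) = u n := fun n => EReal.coe_toReal (hne n).1 (hne n).2
  refine ⟨fun n => (u n).toReal, fun n => ⟨?_, ?_⟩, fun r hr => ?_⟩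
  · exact EReal.toReal_nonneg (hu n).1.le
  · rw [hcoe]
    exact (hu n).2
  · filter_upwards [hlim.eventually (lt_mem_nhds hr.2)] with n hn
    rw [← hcoe n, EReal.coe_lt_coe_iff] at hn
    exact hn.le

/-- A weak gradient `g` of a nondecreasing function of a smooth `f` satisfies `g · ∇f ≥ 0`,
in integrated form. -/
theorem HasWeakGradient.integral_mul_inner_nonneg_of_tsupport_subset
    (hΩ : IsSmoothBoundedDomain Ω) {M : EReal} (hM : 0 < M) {P : ℝ → ℝ}
    (hP : MonotoneOn P (densityRange M)) (hPc : ContinuousOn P (densityRange M)) (hP0 : 0 ≤ P 0)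
    {q : EuclideanSpace ℝ (Fin d) → ℝ} {g : EuclideanSpace ℝ (Fin d) → EuclideanSpace ℝ (Fin d)}
    (hg : HasWeakGradient Ω q g) {f : EuclideanSpace ℝ (Fin d) → ℝ} (hf : ContDiff ℝ ∞ f)
    (hfD : ∀ᵐ x ∂volume.restrict Ω, f x ∈ densityRange M)
    (hq : ∀ᵐ x ∂volume.restrict Ω, q x = P (f x))
    {ψ : EuclideanSpace ℝ (Fin d) → ℝ} (hψ : ContDiff ℝ ∞ ψ) (hψc : HasCompactSupport ψ)
    (hψs : tsupport ψ ⊆ Ω) (hψ0 : ∀ x, 0 ≤ ψ x) :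
    0 ≤ ∫ x in Ω, ψ x * inner ℝ (g x) (∇ f x) := by
  have h0 := hg.integral_mul_divergence hψ hψc hψs hf
  have hdivc : Continuous (divergence fun y => ψ y • ∇ f y) :=
    continuous_divergence_smul_gradient (hψ.of_le (WithTop.coe_le_coe.2 le_top))
      (hf.of_le (WithTop.coe_le_coe.2 le_top))
  have hsub : tsupport (divergence fun y => ψ y • ∇ f y) ⊆ tsupport ψ :=
    (tsupport_divergence_subset _).trans (tsupport_smul_subset_left _ _)
  have hint : IntegrableOn (fun x => q x * divergence (fun y => ψ y • ∇ f y) x) Ω := by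
    simpa [mul_comm] using hg.1.integrableOn_smul_of_hasCompactSupport hdivc
      (hψc.of_isClosed_subset (isClosed_tsupport _) hsub) (hsub.trans hψs)
  obtain ⟨K, hK, hKe⟩ := exists_seq_densityRange hM
  -- `P` is monotone and continuous on `[0, M)` only. Truncating its argument to `[0, K n]` gives a
  -- monotone continuous function on ℝ, to which the smooth inequality applies.
  have hmem : ∀ n r, max 0 (min r (K n)) ∈ densityRange M := fun n r =>
    ⟨le_max_left _ _, lt_of_le_of_lt (EReal.coe_le_coe_iff.2
      (max_le (hK n).1 (min_le_right _ _))) (hK n).2⟩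
  have hmono : ∀ n, Monotone fun r => P (max 0 (min r (K n))) := fun n r r' hr =>
    hP (hmem n r) (hmem n r') (max_le_max le_rfl (min_le_min hr le_rfl))
  have hcont : ∀ n, Continuous fun r => P (max 0 (min r (K n))) := fun n =>
    hPc.comp_continuous (by fun_prop) (hmem n)
  have hzero : (0 : ℝ) ∈ densityRange M := ⟨le_rfl, by simpa using hM⟩
  have lim : Tendsto (fun n => ∫ x in Ω, P (max 0 (min (f x) (K n))) *
      divergence (fun y => ψ y • ∇ f y) x) atTop
      (𝓝 (∫ x in Ω, q x * divergence (fun y => ψ y • ∇ f y) x)) := by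
    refine tendsto_integral_of_dominated_convergence
      (fun x => ‖q x * divergence (fun y => ψ y • ∇ f y) x‖) (fun n => ?_) hint.norm (fun n => ?_) ?_
    · exact (((hcont n).comp hf.continuous).mul hdivc).aestronglyMeasurable
    · filter_upwards [hfD, hq] with x hx hqx
      rw [norm_mul, norm_mul, hqx]
      refine mul_le_mul_of_nonneg_right ?_ (norm_nonneg _)
      -- Monotonicity and `0 ≤ P 0` place the truncated values between 0 and `P (f x)`, so `q`
      -- itself dominates.
      have h1 : P 0 ≤ P (max 0 (min (f x) (K n))) := hP hzero (hmem n _) (le_max_left _ _)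
      have h2 : P (max 0 (min (f x) (K n))) ≤ P (f x) :=
        hP (hmem n _) hx (max_le hx.1 (min_le_left _ _))
      rw [Real.norm_eq_abs, Real.norm_eq_abs, abs_of_nonneg (hP0.trans h1),
        abs_of_nonneg (hP0.trans (h1.trans h2))]
      exact h2
    · filter_upwards [hfD, hq] with x hx hqx
      refine tendsto_const_nhds.congr' ?_
      filter_upwards [hKe _ hx] with n hn
      rw [min_eq_left hn, max_eq_right hx.1, hqx]
  have h1 := le_of_tendsto' lim fun n =>
    hΩ.integral_comp_mul_divergence_nonpos (hmono n) (hcont n) hψ hψs hψ0 hf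
  linarith

/-- The weight `k` need not vanish at the boundary. Cutoffs equal to 1 on an exhaustion of `Ω`
reduce to compact support, and integrability of `g` allows passage to the limit. -/
theorem HasWeakGradient.integral_mul_inner_nonneg
    (hΩ : IsSmoothBoundedDomain Ω) {M : EReal} (hM : 0 < M) {P : ℝ → ℝ}
    (hP : MonotoneOn P (densityRange M)) (hPc : ContinuousOn P (densityRange M)) (hP0 : 0 ≤ P 0)
    {q : EuclideanSpace ℝ (Fin d) → ℝ} {g : EuclideanSpace ℝ (Fin d) → EuclideanSpace ℝ (Fin d)}
    (hg : HasWeakGradient Ω q g) (hgi : IntegrableOn g Ω)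
    {f : EuclideanSpace ℝ (Fin d) → ℝ} (hf : ContDiff ℝ ∞ f)
    (hfD : ∀ᵐ x ∂volume.restrict Ω, f x ∈ densityRange M)
    (hq : ∀ᵐ x ∂volume.restrict Ω, q x = P (f x))
    {k : EuclideanSpace ℝ (Fin d) → ℝ} (hk : ContDiff ℝ ∞ k) (hk0 : ∀ x, 0 ≤ k x) :
    0 ≤ ∫ x in Ω, k x * inner ℝ (g x) (∇ f x) := by
  obtain ⟨A, hAc, hAs, hAU, hAm⟩ := hΩ.isOpen.exists_iUnion_isClosed
  have hAk : ∀ n, IsCompact (A n) := fun n =>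
    hΩ.isCompact_closure.of_isClosed_subset (hAc n) ((hAs n).trans subset_closure)
  choose κ hκ hκc hκs hκ01 hκ1 using fun n => exists_contDiff_cutoff (hAk n) hΩ.isOpen (hAs n)
  have hcont : Continuous fun x => k x • ∇ f x := hk.continuous.smul (hf.continuous_gradient (by simp))
  have hint : IntegrableOn (fun x => k x * inner ℝ (g x) (∇ f x)) Ω := by
    obtain ⟨C, hC⟩ := hΩ.isCompact_closure.exists_bound_of_continuousOn hcont.continuousOn
    have hm : AEStronglyMeasurable (fun x => inner ℝ (g x) (k x • ∇ f x)) (volume.restrict Ω) :=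
      hgi.aestronglyMeasurable.inner hcont.aestronglyMeasurable
    have : IntegrableOn (fun x => inner ℝ (g x) (k x • ∇ f x)) Ω := by
      refine (hgi.norm.mul_const C).mono' hm ?_
      filter_upwards [ae_restrict_mem hΩ.isOpen.measurableSet] with x hx
      exact (norm_inner_le_norm _ _).trans
        (mul_le_mul_of_nonneg_left (hC x (subset_closure hx)) (norm_nonneg _))
    simpa only [inner_smul_right] using this
  have lim : Tendsto (fun n => ∫ x in Ω, (κ n x * k x) * inner ℝ (g x) (∇ f x)) atTop
      (𝓝 (∫ x in Ω, k x * inner ℝ (g x) (∇ f x))) := by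
    refine tendsto_integral_of_dominated_convergence
      (fun x => ‖k x * inner ℝ (g x) (∇ f x)‖) (fun n => ?_) hint.norm (fun n => ?_) ?_
    · simp only [mul_assoc]
      exact (hκ n).continuous.aestronglyMeasurable.mul hint.aestronglyMeasurable
    · refine ae_of_all _ fun x => ?_
      rw [mul_assoc, norm_mul, Real.norm_eq_abs, abs_of_nonneg (hκ01 n x).1]
      exact mul_le_of_le_one_left (norm_nonneg _) (hκ01 n x).2
    · filter_upwards [ae_restrict_mem hΩ.isOpen.measurableSet] with x hx
      refine tendsto_const_nhds.congr' ?_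
      obtain ⟨n₀, hn₀⟩ := mem_iUnion.1 (hAU.symm ▸ hx : x ∈ ⋃ n, A n)
      filter_upwards [eventually_ge_atTop n₀] with n hn
      rw [(hκ1 n).self_of_nhdsSet x (hAm hn hn₀), one_mul]
  refine ge_of_tendsto' lim fun n => ?_
  exact hg.integral_mul_inner_nonneg_of_tsupport_subset hΩ hM hP hPc hP0 hf hfD hq
    ((hκ n).mul hk) (hκc n).mul_right (tsupport_mul_subset_left.trans (hκs n))
    fun x => mul_nonneg (hκ01 n x).1 (hk0 x)

end WeakGradient

/-! ### The weak equation for smooth solutions -/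

section WeakEquation

variable {d : ℕ} {Ω : Set (EuclideanSpace ℝ (Fin d))}
  {φ : ℝ × EuclideanSpace ℝ (Fin d) → ℝ}

theorem hasDerivAt_curry_fst (hφ : Differentiable ℝ φ) (t : ℝ) (x : EuclideanSpace ℝ (Fin d)) :
    HasDerivAt (fun τ => φ (τ, x)) (fderiv ℝ φ (t, x) (1, 0)) t :=
  (hφ (t, x)).hasFDerivAt.comp_hasDerivAt t ((hasDerivAt_id t).prodMk (hasDerivAt_const t x))

theorem hasFDerivAt_curry_snd (hφ : Differentiable ℝ φ) (t : ℝ) (x : EuclideanSpace ℝ (Fin d)) :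
    HasFDerivAt (fun y => φ (t, y))
      ((fderiv ℝ φ (t, x)).comp (ContinuousLinearMap.inr ℝ ℝ (EuclideanSpace ℝ (Fin d)))) x :=
  (hφ (t, x)).hasFDerivAt.comp x ((hasFDerivAt_const t x).prodMk (hasFDerivAt_id x))

theorem ContDiff.continuous_gradient_curry (hφ : ContDiff ℝ 1 φ) :
    Continuous fun p : ℝ × EuclideanSpace ℝ (Fin d) => ∇ (fun y => φ (p.1, y)) p.2 := by
  have : (fun p : ℝ × EuclideanSpace ℝ (Fin d) => ∇ (fun y => φ (p.1, y)) p.2) = fun p =>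
      (InnerProductSpace.toDual ℝ (EuclideanSpace ℝ (Fin d))).symm
        ((fderiv ℝ φ p).comp (ContinuousLinearMap.inr ℝ ℝ (EuclideanSpace ℝ (Fin d)))) := by
    funext p
    rw [gradient, (hasFDerivAt_curry_snd (hφ.differentiable one_ne_zero) p.1 p.2).fderiv]
  rw [this]
  exact (LinearIsometryEquiv.continuous _).comp
    ((hφ.continuous_fderiv one_ne_zero).clm_comp continuous_const)

theorem IsSmoothBoundedDomain.integrable_prod_of_continuous (hΩ : IsSmoothBoundedDomain Ω)
    {f : ℝ × EuclideanSpace ℝ (Fin d) → ℝ} (hf : Continuous f) (b : ℝ) :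
    Integrable f ((volume.restrict (Ioc 0 b)).prod (volume.restrict Ω)) := by
  rw [Measure.prod_restrict]
  exact (hf.continuousOn.integrableOn_compact
    (isCompact_Icc.prod hΩ.isCompact_closure)).mono_set
      (prod_mono Ioc_subset_Icc_self subset_closure)

/-- For a smooth solution the time derivative in the weak equation can be moved to the solution. -/
theorem IsSmoothBoundedDomain.integral_inner_gradient_eq (hΩ : IsSmoothBoundedDomain Ω)
    {g : ℝ → EuclideanSpace ℝ (Fin d) → EuclideanSpace ℝ (Fin d)}
    {u : ℝ → EuclideanSpace ℝ (Fin d) → ℝ} {w : ℝ × EuclideanSpace ℝ (Fin d) → ℝ} {a b : ℝ}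
    (ha : 0 < a) (hab : a < b)
    (hg : MemLp (fun p : ℝ × EuclideanSpace ℝ (Fin d) => g p.1 p.2) 2
      ((volume.restrict (Ioc 0 b)).prod (volume.restrict Ω)))
    (hw : ContDiff ℝ 1 w)
    (huw : ∀ τ ∈ Icc a b, ∀ᵐ x ∂volume.restrict Ω, u τ x = w (τ, x))
    (hφ : ContDiff ℝ 1 φ) (hφs : tsupport φ ⊆ Ioo a b ×ˢ univ)
    (heq : ∫ t in Ioi (0 : ℝ), ∫ x in Ω,
      (u t x * deriv (fun τ => φ (τ, x)) t - inner ℝ (g t x) (∇ (fun y => φ (t, y)) x)) = 0) :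
    ∫ t in Ioc 0 b, ∫ x in Ω, inner ℝ (g t x) (∇ (fun y => φ (t, y)) x) =
      -∫ t in Ioc 0 b, ∫ x in Ω, fderiv ℝ w (t, x) (1, 0) * φ (t, x) := by
  have hb : 0 < b := ha.trans hab
  have hfin : IsFiniteMeasure (volume.restrict Ω) := ⟨by simpa using hΩ.volume_lt_top⟩
  have hφd := hφ.differentiable one_ne_zero
  have hwd := hw.differentiable one_ne_zero
  have hφt : ∀ t x, deriv (fun τ => φ (τ, x)) t = fderiv ℝ φ (t, x) (1, 0) := fun t x =>
    (hasDerivAt_curry_fst hφd t x).deriv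
  have hφtc : Continuous fun p => fderiv ℝ φ p (1, 0) :=
    (hφ.continuous_fderiv one_ne_zero).clm_apply continuous_const
  have hwtc : Continuous fun p => fderiv ℝ w p (1, 0) :=
    (hw.continuous_fderiv one_ne_zero).clm_apply continuous_const
  have hgradc := hφ.continuous_gradient_curry
  -- vanishing outside `(a, b)`
  have hout : ∀ t, t ∉ Ioo a b → ∀ x, φ (t, x) = 0 ∧ fderiv ℝ φ (t, x) = 0 := fun t ht x => by
    have h0 : (t, x) ∉ tsupport φ := fun h => ht (hφs h).1
    exact ⟨image_eq_zero_of_notMem_tsupport h0, by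
      by_contra h1
      exact h0 (tsupport_fderiv_subset ℝ (subset_tsupport _ h1))⟩
  set μ := (volume.restrict (Ioc 0 b)).prod (volume.restrict Ω) with hμ
  have iG : Integrable (fun p : ℝ × EuclideanSpace ℝ (Fin d) =>
      inner ℝ (g p.1 p.2) (∇ (fun y => φ (p.1, y)) p.2)) μ := by
    obtain ⟨C, hC⟩ := (isCompact_Icc.prod hΩ.isCompact_closure).exists_bound_of_continuousOn
      (s := Icc (0 : ℝ) b ×ˢ closure Ω) hgradc.continuousOn
    have hgi : Integrable (fun p : ℝ × EuclideanSpace ℝ (Fin d) => g p.1 p.2) μ :=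
      hg.integrable (by norm_num)
    refine (hgi.norm.mul_const C).mono'
      (hgi.aestronglyMeasurable.inner hgradc.aestronglyMeasurable) ?_
    rw [hμ, Measure.prod_restrict]
    filter_upwards [ae_restrict_mem (measurableSet_Ioc.prod hΩ.isOpen.measurableSet)] with p hp
    exact (norm_inner_le_norm _ _).trans (mul_le_mul_of_nonneg_left
      (hC p ⟨Ioc_subset_Icc_self hp.1, subset_closure hp.2⟩) (norm_nonneg _))
  have iW : Integrable (fun p => w p * fderiv ℝ φ p (1, 0)) μ :=
    hΩ.integrable_prod_of_continuous (hw.continuous.mul hφtc) b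
  have iV : Integrable (fun p => fderiv ℝ w p (1, 0) * φ p) μ :=
    hΩ.integrable_prod_of_continuous (hwtc.mul hφ.continuous) b
  have iWG : Integrable (fun p : ℝ × EuclideanSpace ℝ (Fin d) => w p * fderiv ℝ φ p (1, 0) -
      inner ℝ (g p.1 p.2) (∇ (fun y => φ (p.1, y)) p.2)) μ := iW.sub iG
  have iVW : Integrable (fun p => fderiv ℝ w p (1, 0) * φ p + w p * fderiv ℝ φ p (1, 0)) μ :=
    iV.add iW
  -- the weak equation in terms of `w`
  have h1 : ∫ t in Ioc 0 b, ∫ x in Ω, (w (t, x) * fderiv ℝ φ (t, x) (1, 0) -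
      inner ℝ (g t x) (∇ (fun y => φ (t, y)) x)) = 0 := by
    refine Eq.trans ?_ heq
    have h2 : ∫ t in Ioi (0 : ℝ), ∫ x in Ω,
        (u t x * deriv (fun τ => φ (τ, x)) t - inner ℝ (g t x) (∇ (fun y => φ (t, y)) x)) =
        ∫ t in Ioc 0 b, ∫ x in Ω,
        (u t x * deriv (fun τ => φ (τ, x)) t - inner ℝ (g t x) (∇ (fun y => φ (t, y)) x)) := by
      refine setIntegral_eq_of_subset_of_forall_sdiff_eq_zero measurableSet_Ioi
        (fun t ht => ht.1) fun t ht => ?_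
      have hn : t ∉ Ioo a b := fun h => ht.2 ⟨ht.1, h.2.le⟩
      simp [hφt, hout t hn]
    rw [h2]
    refine integral_congr_ae (ae_of_all _ fun t => ?_)
    dsimp only
    by_cases htn : t ∈ Ioo a b
    · refine integral_congr_ae ?_
      filter_upwards [huw t (Ioo_subset_Icc_self htn)] with x hx
      rw [hx, hφt]
    · simp [hφt, hout t htn]
  have h2 : (∫ p, w p * fderiv ℝ φ p (1, 0) ∂μ) -
      ∫ p, inner ℝ (g p.1 p.2) (∇ (fun y => φ (p.1, y)) p.2) ∂μ = 0 := by
    rw [← integral_sub iW iG, ← h1, hμ, integral_prod _ iWG]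
  -- integration by parts in time
  have h3 : ∀ t, HasDerivAt (fun τ => ∫ x in Ω, w (τ, x) * φ (τ, x))
      (∫ x in Ω, (fderiv ℝ w (t, x) (1, 0) * φ (t, x) + w (t, x) * fderiv ℝ φ (t, x) (1, 0))) t :=
    fun t => hΩ.hasDerivAt_setIntegral (f := fun τ x => w (τ, x) * φ (τ, x))
      (f' := fun t x => fderiv ℝ w (t, x) (1, 0) * φ (t, x) + w (t, x) * fderiv ℝ φ (t, x) (1, 0))
      (fun τ => (hw.continuous.mul hφ.continuous).comp (by fun_prop : Continuous fun x => (τ, x)))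
      ((hwtc.mul hφ.continuous).add (hw.continuous.mul hφtc))
      (fun τ x => (hasDerivAt_curry_fst hwd τ x).mul (hasDerivAt_curry_fst hφd τ x)) t
  -- The time derivative of `∫ w φ` integrates to zero, since `φ` vanishes at both ends of `[0, b]`.
  have h4 : (∫ p, fderiv ℝ w p (1, 0) * φ p ∂μ) + ∫ p, w p * fderiv ℝ φ p (1, 0) ∂μ = 0 := by
    rw [← integral_add iV iW, hμ, integral_prod _ iVW,
      ← intervalIntegral.integral_of_le hb.le]
    rw [intervalIntegral.integral_eq_sub_of_hasDerivAt (fun t _ => h3 t)]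
    · have e1 : ∀ x, φ (b, x) = 0 := fun x => (hout b (fun h => lt_irrefl _ h.2) x).1
      have e2 : ∀ x, φ (0, x) = 0 := fun x => (hout 0 (fun h => (ha.trans h.1).false) x).1
      simp [e1, e2]
    · rw [intervalIntegrable_iff_integrableOn_Ioc_of_le hb.le]
      exact iVW.integral_prod_left
  rw [hμ, integral_prod _ iG] at h2
  rw [hμ, integral_prod _ iV] at h4
  linarith

end WeakEquation

/-! ### Smooth weak solutions: bounds and the pointwise-in-time equation -/

section SmoothSolutions

variable {d : ℕ} {Ω : Set (EuclideanSpace ℝ (Fin d))}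

theorem IsSmoothBoundedDomain.continuous_setIntegral (hΩ : IsSmoothBoundedDomain Ω)
    {f : ℝ × EuclideanSpace ℝ (Fin d) → ℝ} (hf : Continuous f) :
    Continuous fun τ => ∫ x in Ω, f (τ, x) := by
  refine continuous_iff_continuousAt.2 fun t => ?_
  obtain ⟨C, hC⟩ := ((isCompact_closedBall t 1).prod
    hΩ.isCompact_closure).exists_bound_of_continuousOn hf.continuousOn
  have hfin : IsFiniteMeasure (volume.restrict Ω) := ⟨by simpa using hΩ.volume_lt_top⟩
  refine continuousAt_of_dominated (bound := fun _ => C)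
    (Eventually.of_forall fun τ => (hf.comp (by fun_prop : Continuous fun x => (τ, x))).aestronglyMeasurable)
    ?_ (integrable_const C) (ae_of_all _ fun x => (hf.comp (by fun_prop)).continuousAt)
  filter_upwards [Metric.closedBall_mem_nhds t one_pos] with τ hτ
  filter_upwards [ae_restrict_mem hΩ.isOpen.measurableSet] with x hx
  exact hC (τ, x) ⟨hτ, subset_closure hx⟩

/-- Test functions of the form `χ(t) κ(x) Θ(t, x)` isolate the times seen by `χ`. The cutoff `κ`
provides compact support and equals 1 near the closure of `Ω`, so it leaves no trace, and `Θ` is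
free at the boundary. One `g` serves all time intervals and all `w`. -/
theorem IsWeakDiffusionSolution.exists_weakGradient (hΩ : IsSmoothBoundedDomain Ω) {M : EReal}
    {P : ℝ → ℝ} {u₀ : EuclideanSpace ℝ (Fin d) → ℝ} {u : ℝ → EuclideanSpace ℝ (Fin d) → ℝ}
    (hu : IsWeakDiffusionSolution M P Ω u₀ u) :
    ∃ g : ℝ → EuclideanSpace ℝ (Fin d) → EuclideanSpace ℝ (Fin d), ∀ a b : ℝ, 0 < a → a < b →
      (∀ᵐ t ∂volume.restrict (Ioc 0 b), HasWeakGradient Ω (fun x => P (u t x)) (g t) ∧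
        IntegrableOn (g t) Ω ∧ ∀ᵐ x ∂volume.restrict Ω, u t x ∈ densityRange M) ∧
      ∀ w : ℝ × EuclideanSpace ℝ (Fin d) → ℝ, ContDiff ℝ ∞ w →
        (∀ τ ∈ Icc a b, ∀ᵐ x ∂volume.restrict Ω, u τ x = w (τ, x)) →
        ∀ χ : ℝ → ℝ, ContDiff ℝ ∞ χ → HasCompactSupport χ → tsupport χ ⊆ Ioo a b →
        ∀ Θ : ℝ × EuclideanSpace ℝ (Fin d) → ℝ, ContDiff ℝ ∞ Θ →
        ∫ t in Ioc 0 b, χ t * ∫ x in Ω, inner ℝ (g t x) (∇ (fun y => Θ (t, y)) x) =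
          -∫ t in Ioc 0 b, χ t * ∫ x in Ω, fderiv ℝ w (t, x) (1, 0) * Θ (t, x) := by
  obtain ⟨g, hg2, hgw, heq⟩ := hu.weak_equation
  refine ⟨g, fun a b ha hab => ⟨?_, fun w hw huw χ hχ hχc hχs Θ hΘ => ?_⟩⟩
  · have hfin : IsFiniteMeasure (volume.restrict Ω) := ⟨by simpa using hΩ.volume_lt_top⟩
    have h1 := ((hg2 b (ha.trans hab)).integrable (by norm_num)).prod_right_ae
    have hsub : (volume.restrict (Ioc 0 b)) ≤ volume.restrict (Ioi (0 : ℝ)) :=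
      Measure.restrict_mono_set _ Ioc_subset_Ioi_self
    have h2 := ae_mono hsub hgw
    have h3 := ae_mono hsub (Measure.ae_ae_of_ae_prod hu.mem_range)
    filter_upwards [h1, h2, h3] with t k1 k2 k3
    exact ⟨k2, k1, k3⟩
  · obtain ⟨κ, hκ, hκc, -, -, hκ1⟩ := exists_contDiff_cutoff hΩ.isCompact_closure isOpen_univ
      (subset_univ _)
    set φ : ℝ × EuclideanSpace ℝ (Fin d) → ℝ := fun p => χ p.1 * (κ p.2 * Θ p) with hφdef
    have hφ : ContDiff ℝ ∞ φ := (hχ.comp contDiff_fst).mul ((hκ.comp contDiff_snd).mul hΘ)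
    have hsupp : tsupport φ ⊆ tsupport χ ×ˢ tsupport κ := by
      refine closure_minimal (fun p hp => ⟨subset_tsupport _ fun h => hp ?_,
        subset_tsupport _ fun h => hp ?_⟩) ((isClosed_tsupport _).prod (isClosed_tsupport _))
      · simp [hφdef, h]
      · simp [hφdef, h]
    have hφc : HasCompactSupport φ :=
      (IsCompact.prod hχc hκc).of_isClosed_subset (isClosed_tsupport _) hsupp
    have hφs : tsupport φ ⊆ Ioo a b ×ˢ univ := hsupp.trans (prod_mono hχs (subset_univ _))
    have hφs' : tsupport φ ⊆ Ioi 0 ×ˢ univ :=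
      hφs.trans (prod_mono (fun t ht => ha.trans ht.1) Subset.rfl)
    have key := hΩ.integral_inner_gradient_eq ha hab (hg2 b (ha.trans hab))
      (hw.of_le (WithTop.coe_le_coe.2 le_top)) huw (hφ.of_le (WithTop.coe_le_coe.2 le_top)) hφs
      (heq φ hφ hφc hφs')
    have hκx : ∀ x ∈ Ω, κ =ᶠ[𝓝 x] fun _ => 1 := fun x hx =>
      (eventually_nhdsSet_iff_forall.1 hκ1 x (subset_closure hx))
    have hgrad : ∀ t, ∀ x ∈ Ω, ∇ (fun y => φ (t, y)) x = χ t • ∇ (fun y => Θ (t, y)) x := by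
      intro t x hx
      have h1 : (fun y => φ (t, y)) =ᶠ[𝓝 x] fun y => χ t * Θ (t, y) := by
        filter_upwards [hκx x hx] with y hy
        simp [hφdef, hy]
      have h2 : DifferentiableAt ℝ (fun y => Θ (t, y)) x :=
        (hasFDerivAt_curry_snd (hΘ.differentiable (by simp)) t x).differentiableAt
      rw [gradient, h1.fderiv_eq, fderiv_const_mul h2, gradient, map_smul]
    convert key using 1
    · refine integral_congr_ae (ae_of_all _ fun t => ?_)
      dsimp only
      rw [← integral_const_mul]
      refine setIntegral_congr_fun hΩ.isOpen.measurableSet fun x hx => ?_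
      rw [hgrad t x hx, inner_smul_right]
    · congr 1
      refine integral_congr_ae (ae_of_all _ fun t => ?_)
      dsimp only
      rw [← integral_const_mul]
      refine setIntegral_congr_fun hΩ.isOpen.measurableSet fun x hx => ?_
      dsimp only [φ]
      rw [(hκx x hx).self_of_nhds]
      ring

/-- Dissipation of convex entropies: the spatial integral of `∂ₜw η(w)` is nonpositive. -/
theorem IsWeakDiffusionSolution.integral_deriv_mul_comp_nonpos (hΩ : IsSmoothBoundedDomain Ω)
    {M : EReal} (hM : 0 < M) {P : ℝ → ℝ} (hP : MonotoneOn P (densityRange M))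
    (hPc : ContinuousOn P (densityRange M)) (hP0 : 0 ≤ P 0)
    {u₀ : EuclideanSpace ℝ (Fin d) → ℝ} {u : ℝ → EuclideanSpace ℝ (Fin d) → ℝ}
    (hu : IsWeakDiffusionSolution M P Ω u₀ u) {a b : ℝ} (ha : 0 < a)
    {w : ℝ × EuclideanSpace ℝ (Fin d) → ℝ} (hw : ContDiff ℝ ∞ w)
    (huw : ∀ τ ∈ Icc a b, ∀ᵐ x ∂volume.restrict Ω, u τ x = w (τ, x))
    {η : ℝ → ℝ} (hη : ContDiff ℝ ∞ η) (hηm : Monotone η) {t : ℝ} (ht : t ∈ Ioo a b) :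
    ∫ x in Ω, fderiv ℝ w (t, x) (1, 0) * η (w (t, x)) ≤ 0 := by
  by_contra! hpos
  set D : ℝ → ℝ := fun t => ∫ x in Ω, fderiv ℝ w (t, x) (1, 0) * η (w (t, x)) with hD
  have hDc : Continuous D := hΩ.continuous_setIntegral
    (f := fun p => fderiv ℝ w p (1, 0) * η (w p))
    (((hw.continuous_fderiv (by simp)).clm_apply continuous_const).mul
      (hη.continuous.comp hw.continuous))
  -- If `D t` were positive it would be positive nearby. A cutoff `χ` supported there makes the time
  -- integral of `χ D` positive, whereas the weak equation tested with `η(w)` makes it nonpositive.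
  have hU : IsOpen (Ioo a b ∩ D ⁻¹' Ioi 0) := isOpen_Ioo.inter (isOpen_Ioi.preimage hDc)
  obtain ⟨χ, hχ, hχc, hχs, hχ01, hχ1⟩ := exists_contDiff_cutoff (isCompact_singleton (x := t)) hU
    (singleton_subset_iff.2 ⟨ht, hpos⟩)
  obtain ⟨g, hg⟩ := hu.exists_weakGradient hΩ
  obtain ⟨hae, heq⟩ := hg a b ha (ht.1.trans ht.2)
  have h1 := heq w hw huw χ hχ hχc (hχs.trans inter_subset_left) (fun p => η (w p)) (hη.comp hw)
  have hχ0 : ∀ τ, τ ∉ Ioo a b ∩ D ⁻¹' Ioi 0 → χ τ = 0 := fun τ hτ =>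
    image_eq_zero_of_notMem_tsupport fun h => hτ (hχs h)
  have h2 : 0 < ∫ τ in Ioc 0 b, χ τ * D τ := by
    rw [setIntegral_eq_integral_of_forall_compl_eq_zero fun τ hτ => ?_]
    · refine Continuous.integral_pos_of_hasCompactSupport_nonneg_nonzero (x := t)
        (hχ.continuous.mul hDc) hχc.mul_right (fun τ => ?_) ?_
      · by_cases hτ : τ ∈ Ioo a b ∩ D ⁻¹' Ioi 0
        · exact mul_nonneg (hχ01 τ).1 hτ.2.le
        · simp [hχ0 τ hτ]
      · rw [hχ1.self_of_nhdsSet t rfl, one_mul]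
        exact hpos.ne'
    · rw [hχ0 τ fun h => hτ ⟨ha.trans h.1.1, h.1.2.le⟩, zero_mul]
  -- By the chain rule `∇η(w) = η'(w) ∇w` with `η' ≥ 0`, so monotonicity of `P` gives the sign for
  -- almost every time.
  have h3 : 0 ≤ ∫ τ in Ioc 0 b, χ τ * ∫ x in Ω, inner ℝ (g τ x) (∇ (fun y => η (w (τ, y))) x) := by
    refine integral_nonneg_of_ae ?_
    filter_upwards [hae] with τ ⟨k1, k2, k3⟩
    by_cases hτ : τ ∈ Ioo a b ∩ D ⁻¹' Ioi 0
    swap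
    · simp [hχ0 τ hτ]
    refine mul_nonneg (hχ01 τ).1 ?_
    have hwτ : ContDiff ℝ ∞ fun y => w (τ, y) := hw.comp (by fun_prop)
    have huτ := huw τ (Ioo_subset_Icc_self hτ.1)
    have hgrad : ∀ x, ∇ (fun y => η (w (τ, y))) x = deriv η (w (τ, x)) • ∇ (fun y => w (τ, y)) x :=
      fun x => by
        have k4 := ((hη.differentiable (by simp)) (w (τ, x))).hasDerivAt.comp_hasFDerivAt x
          ((hwτ.differentiable (by simp)) x).hasFDerivAt
        have k5 : fderiv ℝ (fun y => η (w (τ, y))) x = _ := k4.fderiv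
        rw [gradient, k5, gradient, map_smul]
    simp only [hgrad, inner_smul_right]
    refine k1.integral_mul_inner_nonneg hΩ hM hP hPc hP0 k2 hwτ ?_ ?_
      (((contDiff_infty_iff_deriv.1 hη).2).comp hwτ) fun x => hηm.deriv_nonneg
    · filter_upwards [k3, huτ] with x e1 e2
      rwa [← e2]
    · filter_upwards [huτ] with x e2
      rw [e2]
  linarith

end SmoothSolutions

/-! ### The maximum principle by entropy dissipation -/

section MaximumPrinciple

variable {d : ℕ} {Ω : Set (EuclideanSpace ℝ (Fin d))}

/-- A smooth convex function vanishing exactly on `[m₀, m₁]`. -/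
theorem exists_convex_entropy {m₀ m₁ : ℝ} (h : m₀ ≤ m₁) :
    ∃ η Φ : ℝ → ℝ, ContDiff ℝ ∞ η ∧ Monotone η ∧ (∀ r, HasDerivAt Φ (η r) r) ∧ (∀ r, 0 ≤ Φ r) ∧
      (∀ r, Φ r = 0 ↔ r ∈ Icc m₀ m₁) ∧ ∀ r r', |Φ r - Φ r'| ≤ |r - r'| := by
  -- `η` is nondecreasing, negative below `m₀`, zero on `[m₀, m₁]`, positive above `m₁`, and bounded
  -- by 1; its primitive from `m₀` is therefore convex, nonnegative and 1-Lipschitz.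
  set η : ℝ → ℝ := fun r => Real.smoothTransition (r - m₁) - Real.smoothTransition (m₀ - r) with hη
  have hηs : ContDiff ℝ ∞ η :=
    (Real.smoothTransition.contDiff.comp (by fun_prop : ContDiff ℝ ∞ fun r => r - m₁)).sub
      (Real.smoothTransition.contDiff.comp (by fun_prop : ContDiff ℝ ∞ fun r => m₀ - r))
  have hηm : Monotone η := fun r r' hr => sub_le_sub
    (Real.smoothTransition.monotone (by linarith)) (Real.smoothTransition.monotone (by linarith))
  have hη0 : ∀ r ∈ Icc m₀ m₁, η r = 0 := fun r hr => by
    simp only [hη]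
    rw [Real.smoothTransition.zero_of_nonpos (by linarith [hr.2]),
      Real.smoothTransition.zero_of_nonpos (by linarith [hr.1]), sub_zero]
  have hη1 : ∀ r, |η r| ≤ 1 := fun r => by
    have h1 := Real.smoothTransition.nonneg (r - m₁)
    have h2 := Real.smoothTransition.le_one (r - m₁)
    have h3 := Real.smoothTransition.nonneg (m₀ - r)
    have h4 := Real.smoothTransition.le_one (m₀ - r)
    rw [abs_le]
    constructor <;> simp only [hη] <;> linarith
  set Φ : ℝ → ℝ := fun r => ∫ y in m₀..r, η y with hΦ
  have hΦ' : ∀ r, HasDerivAt Φ (η r) r := fun r =>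
    (hηs.continuous.integral_hasStrictDerivAt m₀ r).hasDerivAt
  have hm₀ : η m₀ = 0 := hη0 m₀ ⟨le_rfl, h⟩
  have hΦ0 : ∀ r, 0 ≤ Φ r := fun r => by
    rcases le_total m₀ r with hr | hr
    · exact intervalIntegral.integral_nonneg hr fun y hy => hm₀ ▸ hηm hy.1
    · simp only [hΦ]
      rw [intervalIntegral.integral_symm, ← intervalIntegral.integral_neg]
      exact intervalIntegral.integral_nonneg hr fun y hy => neg_nonneg.2 (hm₀ ▸ hηm hy.2)
  refine ⟨η, Φ, hηs, hηm, hΦ', hΦ0, fun r => ⟨fun hr => ?_, fun hr => ?_⟩, fun r r' => ?_⟩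
  -- A zero of the nonnegative `Φ` is a minimum, hence a zero of `η`, and `η` does not vanish
  -- outside `[m₀, m₁]`.
  · have hmin : IsLocalMin Φ r := Eventually.of_forall fun y => hr ▸ hΦ0 y
    have h0 : η r = 0 := hmin.hasDerivAt_eq_zero (hΦ' r)
    constructor
    · by_contra! hlt
      have h1 := Real.smoothTransition.pos_of_pos (show 0 < m₀ - r by linarith)
      have h2 := Real.smoothTransition.zero_of_nonpos (show r - m₁ ≤ 0 by linarith)
      simp only [hη] at h0
      linarith
    · by_contra! hlt
      have h1 := Real.smoothTransition.pos_of_pos (show 0 < r - m₁ by linarith)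
      have h2 := Real.smoothTransition.zero_of_nonpos (show m₀ - r ≤ 0 by linarith)
      simp only [hη] at h0
      linarith
  · refine intervalIntegral.integral_zero_ae (ae_of_all _ fun y hy => ?_)
    rw [uIoc_of_le hr.1] at hy
    exact hη0 y ⟨hy.1.le, hy.2.trans hr.2⟩
  · have := convex_univ.norm_image_sub_le_of_norm_hasDerivWithin_le (f := Φ) (C := 1)
      (fun y _ => (hΦ' y).hasDerivWithinAt) (fun y _ => hη1 y) (mem_univ r') (mem_univ r)
    simpa using this

theorem IsSmoothBoundedDomain.exists_contDiff_eqOn_strip (hΩ : IsSmoothBoundedDomain Ω)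
    {v : ℝ × EuclideanSpace ℝ (Fin d) → ℝ} (hv : SmoothOnNhd v (Ioi 0 ×ˢ closure Ω)) {a b : ℝ}
    (ha : 0 < a) :
    ∃ w : ℝ × EuclideanSpace ℝ (Fin d) → ℝ, ContDiff ℝ ∞ w ∧
      ∀ τ ∈ Icc a b, ∀ x ∈ closure Ω, w =ᶠ[𝓝 (τ, x)] v := by
  obtain ⟨V, hVo, hsub, hvV⟩ := hv
  obtain ⟨w, hw, -, -, hwv⟩ := hvV.exists_contDiff_eventuallyEq_nhdsSet
    (isCompact_Icc.prod hΩ.isCompact_closure) hVo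
    ((prod_mono (fun τ hτ => ha.trans_le hτ.1 : Icc a b ⊆ Ioi 0) Subset.rfl).trans hsub)
  exact ⟨w, hw, fun τ hτ x hx => eventually_nhdsSet_iff_forall.1 hwv (τ, x) ⟨hτ, hx⟩⟩

theorem SmoothOnNhd.continuousOn {F : Type*} [NormedAddCommGroup F] [NormedSpace ℝ F] {f : F → ℝ}
    {S : Set F} (hf : SmoothOnNhd f S) : ContinuousOn f S :=
  let ⟨_, _, hS, h⟩ := hf
  h.continuousOn.mono hS

theorem SmoothOnNhd.contDiffAt {F : Type*} [NormedAddCommGroup F] [NormedSpace ℝ F] {f : F → ℝ}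
    {S : Set F} (hf : SmoothOnNhd f S) {x : F} (hx : x ∈ S) : ContDiffAt ℝ ∞ f x :=
  let ⟨_, hV, hS, h⟩ := hf
  h.contDiffAt (hV.mem_nhds (hS hx))

/-- Smooth solutions stay within the bounds of the initial datum. -/
theorem IsWeakDiffusionSolution.mem_Icc_of_initial (hΩ : IsSmoothBoundedDomain Ω)
    {M : EReal} (hM : 0 < M) {P : ℝ → ℝ} (hP : MonotoneOn P (densityRange M))
    (hPc : ContinuousOn P (densityRange M)) (hP0 : 0 ≤ P 0)
    {u₀ : EuclideanSpace ℝ (Fin d) → ℝ} {u : ℝ → EuclideanSpace ℝ (Fin d) → ℝ}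
    (hu : IsWeakDiffusionSolution M P Ω u₀ u) {v : ℝ × EuclideanSpace ℝ (Fin d) → ℝ}
    (hv : SmoothOnNhd v (Ioi 0 ×ˢ closure Ω))
    (huv : ∀ τ, 0 < τ → ∀ᵐ x ∂volume.restrict Ω, u τ x = v (τ, x)) {m₀ m₁ : ℝ} (hm : m₀ ≤ m₁)
    (hu₀ : ∀ x ∈ Ω, u₀ x ∈ Icc m₀ m₁) {t : ℝ} (ht : 0 < t) :
    ∀ x ∈ closure Ω, v (t, x) ∈ Icc m₀ m₁ := by
  obtain ⟨η, Φ, hη, hηm, hΦ', hΦ0, hΦi, hΦl⟩ := exists_convex_entropy hm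
  have hΦc : Continuous Φ := continuous_iff_continuousAt.2 fun r => (hΦ' r).continuousAt
  have hvt : ∀ τ, 0 < τ → ContinuousOn (fun x => v (τ, x)) (closure Ω) := fun τ hτ =>
    hv.continuousOn.comp (by fun_prop) fun x hx => ⟨hτ, hx⟩
  have hint : ∀ τ, 0 < τ → IntegrableOn (fun x => Φ (v (τ, x))) Ω := fun τ hτ =>
    hΩ.integrableOn_of_continuousOn_closure (hΦc.comp_continuousOn (hvt τ hτ))
  -- the entropy is nonincreasing
  have hanti : ∀ τ₁ τ₂, 0 < τ₁ → τ₁ ≤ τ₂ →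
      ∫ x in Ω, Φ (v (τ₂, x)) ≤ ∫ x in Ω, Φ (v (τ₁, x)) := by
    intro τ₁ τ₂ h1 h2
    -- The strip is larger than `[τ₁, τ₂]` because the dissipation inequality is used at interior
    -- times of the strip; it still stays away from time 0, where `v` need not be smooth.
    obtain ⟨w, hw, hwv⟩ := hΩ.exists_contDiff_eqOn_strip hv (a := τ₁ / 2) (b := τ₂ + 1)
      (by linarith)
    have hwv' : ∀ τ ∈ Icc (τ₁ / 2) (τ₂ + 1), ∀ x ∈ closure Ω, w (τ, x) = v (τ, x) :=
      fun τ hτ x hx => (hwv τ hτ x hx).self_of_nhds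
    have hF : ∀ τ ∈ Icc (τ₁ / 2) (τ₂ + 1),
        ∫ x in Ω, Φ (v (τ, x)) = ∫ x in Ω, Φ (w (τ, x)) := fun τ hτ =>
      setIntegral_congr_fun hΩ.isOpen.measurableSet fun x hx => by
        rw [hwv' τ hτ x (subset_closure hx)]
    rw [hF τ₁ ⟨by linarith, by linarith⟩, hF τ₂ ⟨by linarith, by linarith⟩]
    have hd : ∀ τ, HasDerivAt (fun τ => ∫ x in Ω, Φ (w (τ, x)))
        (∫ x in Ω, fderiv ℝ w (τ, x) (1, 0) * η (w (τ, x))) τ := fun τ =>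
      hΩ.hasDerivAt_setIntegral (f := fun τ x => Φ (w (τ, x)))
        (f' := fun τ x => fderiv ℝ w (τ, x) (1, 0) * η (w (τ, x)))
        (fun τ => hΦc.comp (hw.continuous.comp (by fun_prop)))
        (((hw.continuous_fderiv (by simp)).clm_apply continuous_const).mul
          (hη.continuous.comp hw.continuous))
        (fun τ x => by
          rw [mul_comm]
          exact (hΦ' _).comp τ (hasDerivAt_curry_fst (hw.differentiable (by simp)) τ x)) τ
    refine antitoneOn_of_deriv_nonpos (convex_Icc τ₁ τ₂)
      (fun τ _ => (hd τ).continuousAt.continuousWithinAt)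
      (fun τ _ => (hd τ).differentiableAt.differentiableWithinAt) (fun τ hτ => ?_)
      (left_mem_Icc.2 h2) (right_mem_Icc.2 h2) h2
    rw [interior_Icc] at hτ
    rw [(hd τ).deriv]
    refine hu.integral_deriv_mul_comp_nonpos hΩ hM hP hPc hP0 (a := τ₁ / 2) (b := τ₂ + 1)
      (by linarith) hw (fun σ hσ => ?_) hη hηm ⟨by linarith [hτ.1], by linarith [hτ.2]⟩
    have hσ0 : 0 < σ := by linarith [hσ.1]
    filter_upwards [huv σ hσ0, ae_restrict_mem hΩ.isOpen.measurableSet] with x e1 e2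
    rw [e1, hwv' σ hσ x (subset_closure e2)]
  -- it vanishes initially
  have hsmall : ∀ τ, 0 < τ → ∫ x in Ω, Φ (v (τ, x)) ≤ ∫ x in Ω, |u τ x - u 0 x| := by
    intro τ hτ
    refine integral_mono_ae (hint τ hτ) ((hu.integrable τ hτ.le).sub (hu.integrable 0 le_rfl)).abs ?_
    filter_upwards [huv τ hτ, hu.initial, ae_restrict_mem hΩ.isOpen.measurableSet] with x e1 e2 e3
    have h1 : Φ (u 0 x) = 0 := (hΦi _).2 (e2 ▸ hu₀ x e3)
    have h2 := hΦl (u τ x) (u 0 x)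
    rw [h1, sub_zero, abs_of_nonneg (hΦ0 _)] at h2
    rwa [← e1]
  have hle : ∫ x in Ω, Φ (v (t, x)) ≤ 0 := by
    have h1 := (hu.continuous_L1 0 le_rfl).mono_left
      (nhdsWithin_mono 0 Ioi_subset_Ici_self)
    refine ge_of_tendsto h1 ?_
    filter_upwards [Ioc_mem_nhdsGT ht] with τ hτ
    exact (hanti τ t hτ.1 hτ.2).trans (hsmall τ hτ.1)
  have hzero : ∀ᵐ x ∂volume.restrict Ω, Φ (v (t, x)) = 0 :=
    (integral_eq_zero_iff_of_nonneg (fun x => hΦ0 _) (hint t ht)).1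
      (hle.antisymm (integral_nonneg fun x => hΦ0 _))
  -- Continuity upgrades almost everywhere to everywhere in `Ω`, and closedness of `[m₀, m₁]`
  -- extends the bounds to the closure.
  have hon : EqOn (fun x => Φ (v (t, x))) (fun _ => 0) Ω :=
    Measure.eqOn_open_of_ae_eq hzero hΩ.isOpen
      ((hΦc.comp_continuousOn (hvt t ht)).mono subset_closure) continuousOn_const
  have himg := (hvt t ht).image_closure
  intro x hx
  have h1 : v (t, x) ∈ closure ((fun x => v (t, x)) '' Ω) := himg ⟨x, hx, rfl⟩
  refine closure_minimal ?_ isClosed_Icc h1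
  rintro _ ⟨y, hy, rfl⟩
  exact (hΦi _).1 (hon hy)

end MaximumPrinciple

/-! ### The weak equation at each positive time -/

section PointwiseEquation

variable {d : ℕ} {Ω : Set (EuclideanSpace ℝ (Fin d))}

/-- Weak gradients of `C¹` functions are classical gradients. -/
theorem HasWeakGradient.ae_eq_gradient (hΩ : IsSmoothBoundedDomain Ω)
    {q : EuclideanSpace ℝ (Fin d) → ℝ} {g : EuclideanSpace ℝ (Fin d) → EuclideanSpace ℝ (Fin d)}
    (hg : HasWeakGradient Ω q g) {f : EuclideanSpace ℝ (Fin d) → ℝ} (hf : ContDiff ℝ 1 f)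
    (hq : ∀ᵐ x ∂volume.restrict Ω, q x = f x) : ∀ᵐ x ∂volume.restrict Ω, g x = ∇ f x := by
  have hfc : Continuous (∇ f) := hf.continuous_gradient one_ne_zero
  have key : ∀ᵐ x, x ∈ Ω → g x - ∇ f x = 0 := by
    refine hΩ.isOpen.ae_eq_zero_of_integral_contDiff_smul_eq_zero
      (hg.2.1.sub (hfc.locallyIntegrable.locallyIntegrableOn Ω)) fun φ hφ hφc hφs => ?_
    have hφ0 : ∀ x, x ∉ Ω → φ x = 0 := fun x hx =>
      image_eq_zero_of_notMem_tsupport fun h => hx (hφs h)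
    rw [← setIntegral_eq_integral_of_forall_compl_eq_zero fun x hx => by rw [hφ0 x hx, zero_smul]]
    have i1 : IntegrableOn (fun x => φ x • g x) Ω :=
      hg.2.1.integrableOn_smul_of_hasCompactSupport hφ.continuous hφc hφs
    have i2 : IntegrableOn (fun x => φ x • ∇ f x) Ω :=
      (hfc.locallyIntegrable.locallyIntegrableOn Ω).integrableOn_smul_of_hasCompactSupport
        hφ.continuous hφc hφs
    have hφg : Continuous (∇ φ) := hφ.continuous_gradient (by simp)
    have i3 : IntegrableOn (fun x => f x • ∇ φ x) Ω :=
      ((hf.continuous.smul hφg).continuousOn.integrableOn_compact hΩ.isCompact_closure).mono_set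
        subset_closure
    simp only [smul_sub]
    rw [integral_sub i1 i2, sub_eq_zero, ← neg_inj, ← hg.2.2 φ hφ hφc hφs]
    have h1 : ∫ x in Ω, q x • ∇ φ x = ∫ x in Ω, f x • ∇ φ x := by
      refine integral_congr_ae ?_
      filter_upwards [hq] with x hx
      rw [hx]
    rw [h1, eq_neg_iff_add_eq_zero, ← integral_add i3 i2]
    ext i
    change EuclideanSpace.proj (𝕜 := ℝ) i (∫ x in Ω, (f x • ∇ φ x + φ x • ∇ f x)) = 0
    have i4 : IntegrableOn (fun x => f x • ∇ φ x + φ x • ∇ f x) Ω := i3.add i2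
    rw [← ContinuousLinearMap.integral_comp_comm _ i4]
    have hφf : ContDiff ℝ 1 fun x => φ x * f x := (hφ.of_le (WithTop.coe_le_coe.2 le_top)).mul hf
    have h2 := hΩ.setIntegral_fderiv_apply isOpen_univ (subset_univ _) hφf.contDiffOn
      (EuclideanSpace.single i 1)
    rw [setIntegral_eq_zero_of_forall_eq_zero (t := frontier Ω)] at h2
    · refine Eq.trans ?_ h2
      refine integral_congr_ae (ae_of_all _ fun x => ?_)
      have h3 := congrFun (pd_mul (hφ.differentiable (by simp)) (hf.differentiable one_ne_zero) i) x
      dsimp only [pd] at h3 ⊢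
      rw [h3]
      simp [gradient_coord, pd]
      ring
    · intro x hx
      have : φ x = 0 := hφ0 x fun h => (hΩ.isOpen.inter_frontier_eq ▸ ⟨h, hx⟩ : x ∈ (∅ : Set _))
      simp [this]
  filter_upwards [ae_restrict_of_ae key, ae_restrict_mem hΩ.isOpen.measurableSet] with x h1 h2
  exact sub_eq_zero.1 (h1 h2)

/-- For smooth solutions the weak equation holds at every time. -/
theorem IsWeakDiffusionSolution.integral_deriv_mul_eq (hΩ : IsSmoothBoundedDomain Ω)
    {M : EReal} {P : ℝ → ℝ}
    {u₀ : EuclideanSpace ℝ (Fin d) → ℝ} {u : ℝ → EuclideanSpace ℝ (Fin d) → ℝ}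
    (hu : IsWeakDiffusionSolution M P Ω u₀ u) {v : ℝ × EuclideanSpace ℝ (Fin d) → ℝ}
    (hv : SmoothOnNhd v (Ioi 0 ×ˢ closure Ω))
    (huv : ∀ τ, 0 < τ → ∀ᵐ x ∂volume.restrict Ω, u τ x = v (τ, x)) {p : ℝ → ℝ}
    (hp : ContDiff ℝ 1 p) (hpv : ∀ τ, 0 < τ → ∀ x ∈ Ω, p (v (τ, x)) = P (v (τ, x)))
    {t : ℝ} (ht : 0 < t) {ξ : EuclideanSpace ℝ (Fin d) → ℝ} (hξ : ContDiff ℝ ∞ ξ) :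
    ∫ x in Ω, fderiv ℝ v (t, x) (1, 0) * ξ x =
      -∫ x in Ω, inner ℝ (∇ (fun y => p (v (t, y))) x) (∇ ξ x) := by
  obtain ⟨w, hw, hwv⟩ := hΩ.exists_contDiff_eqOn_strip hv (a := t / 2) (b := t + 1) (by linarith)
  have ha : 0 < t / 2 := by linarith
  have hab : t / 2 < t + 1 := by linarith
  have htI : t ∈ Ioo (t / 2) (t + 1) := ⟨by linarith, by linarith⟩
  have hw1 : ContDiff ℝ 1 w := hw.of_le (WithTop.coe_le_coe.2 le_top)
  have hpw : ContDiff ℝ 1 fun q => p (w q) := hp.comp hw1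
  have huw : ∀ τ ∈ Icc (t / 2) (t + 1), ∀ᵐ x ∂volume.restrict Ω, u τ x = w (τ, x) := by
    intro τ hτ
    filter_upwards [huv τ (ha.trans_le hτ.1), ae_restrict_mem hΩ.isOpen.measurableSet] with x h1 h2
    rw [h1, (hwv τ hτ x (subset_closure h2)).self_of_nhds]
  obtain ⟨g, hg⟩ := hu.exists_weakGradient hΩ
  obtain ⟨hae, heq⟩ := hg _ _ ha hab
  set A : ℝ → ℝ := fun τ => ∫ x in Ω, fderiv ℝ w (τ, x) (1, 0) * ξ x with hA
  set B : ℝ → ℝ := fun τ => ∫ x in Ω, inner ℝ (∇ (fun y => p (w (τ, y))) x) (∇ ξ x) with hB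
  have hξg : Continuous (∇ ξ) := hξ.continuous_gradient (by simp)
  have hAc : Continuous A := hΩ.continuous_setIntegral (f := fun q => fderiv ℝ w q (1, 0) * ξ q.2)
    (((hw1.continuous_fderiv one_ne_zero).clm_apply continuous_const).mul
      (hξ.continuous.comp continuous_snd))
  have hBc : Continuous B := hΩ.continuous_setIntegral
    (f := fun q => inner ℝ (∇ (fun y => p (w (q.1, y))) q.2) (∇ ξ q.2))
    (hpw.continuous_gradient_curry.inner (hξg.comp continuous_snd))
  -- Testing with `χ(τ) ξ(x)` for every `χ` gives the spatial identity for almost every time. Both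
  -- sides are continuous in time, so it holds at `t` itself.
  have key : ∀ᵐ τ, τ ∈ Ioo (t / 2) (t + 1) → A τ + B τ = 0 := by
    refine isOpen_Ioo.ae_eq_zero_of_integral_contDiff_smul_eq_zero
      ((hAc.add hBc).locallyIntegrable.locallyIntegrableOn _) fun χ hχ hχc hχs => ?_
    have h1 := heq w hw huw χ hχ hχc hχs (fun q => ξ q.2) (hξ.comp contDiff_snd)
    have hχ0 : ∀ τ, τ ∉ Ioo (t / 2) (t + 1) → χ τ = 0 := fun τ hτ =>
      image_eq_zero_of_notMem_tsupport fun h => hτ (hχs h)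
    have h2 : ∫ τ in Ioc 0 (t + 1), χ τ * ∫ x in Ω, inner ℝ (g τ x) (∇ ξ x) =
        ∫ τ in Ioc 0 (t + 1), χ τ * B τ := by
      refine integral_congr_ae ?_
      filter_upwards [hae] with τ ⟨k1, k2, k3⟩
      by_cases hτ : τ ∈ Ioo (t / 2) (t + 1)
      swap
      · simp [hχ0 τ hτ]
      congr 1
      have hpτ : ContDiff ℝ 1 fun y => p (w (τ, y)) := hpw.comp (by fun_prop)
      have k4 := k1.ae_eq_gradient hΩ hpτ (by
        filter_upwards [huw τ (Ioo_subset_Icc_self hτ), ae_restrict_mem hΩ.isOpen.measurableSet]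
          with x e1 e2
        rw [e1, (hwv τ (Ioo_subset_Icc_self hτ) x (subset_closure e2)).self_of_nhds,
          hpv τ (ha.trans hτ.1) x e2])
      refine integral_congr_ae ?_
      filter_upwards [k4] with x hx
      rw [hx]
    have i1 : ∀ {f : ℝ → ℝ}, Continuous f → IntegrableOn (fun τ => χ τ * f τ) (Ioc 0 (t + 1)) :=
      fun hf => ((hχ.continuous.mul hf).integrableOn_Icc).mono_set Ioc_subset_Icc_self
    rw [← setIntegral_eq_integral_of_forall_compl_eq_zero (s := Ioc 0 (t + 1)) fun τ hτ => by
      rw [hχ0 τ fun h => hτ ⟨ha.trans h.1, h.2.le⟩, zero_smul]]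
    simp only [smul_eq_mul, mul_add]
    rw [integral_add (i1 hAc) (i1 hBc), ← h2, h1]
    simp [hA]
  have hon : EqOn (fun τ => A τ + B τ) (fun _ => 0) (Ioo (t / 2) (t + 1)) :=
    Measure.eqOn_open_of_ae_eq ((ae_restrict_iff' measurableSet_Ioo).2 key) isOpen_Ioo
      (hAc.add hBc).continuousOn continuousOn_const
  have hAt : ∫ x in Ω, fderiv ℝ v (t, x) (1, 0) * ξ x = A t :=
    setIntegral_congr_fun hΩ.isOpen.measurableSet fun x hx => by
      rw [(hwv t (Ioo_subset_Icc_self htI) x (subset_closure hx)).fderiv_eq]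
  have hBt : ∫ x in Ω, inner ℝ (∇ (fun y => p (v (t, y))) x) (∇ ξ x) = B t :=
    setIntegral_congr_fun hΩ.isOpen.measurableSet fun x hx => by
      have h1 : (fun y => p (v (t, y))) =ᶠ[𝓝 x] fun y => p (w (t, y)) := by
        have h2 := (hwv t (Ioo_subset_Icc_self htI) x (subset_closure hx))
        have h3 : Tendsto (fun y : EuclideanSpace ℝ (Fin d) => (t, y)) (𝓝 x) (𝓝 (t, x)) :=
          (by fun_prop : Continuous fun y : EuclideanSpace ℝ (Fin d) => (t, y)).tendsto x
        filter_upwards [h3.eventually h2] with y hy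
        rw [hy]
      rw [gradient, h1.fderiv_eq]
      rfl
  rw [hAt, hBt]
  linarith [hon htI]

end PointwiseEquation

/-! ### The pressure and extensions of functions from a compact interval -/

section Pressure

variable {M : EReal} {m U : ℝ → ℝ}

theorem mem_densityRange_of_le {r r' : ℝ} (hr : r ∈ densityRange M) (h0 : 0 ≤ r') (h : r' ≤ r) :
    r' ∈ densityRange M :=
  ⟨h0, (EReal.coe_le_coe_iff.2 h).trans_lt hr.2⟩

theorem isOpen_densityRangeInterior : IsOpen (densityRangeInterior M) :=
  isOpen_Ioi.inter (isOpen_Iio.preimage continuous_coe_real_ereal)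

/-- `U'` is nondecreasing. Where it is not differentiable the derivative has the default value 0, so
the sign holds at every point. -/
theorem IsEnergyDensity.deriv_deriv_nonneg (hU : IsEnergyDensity M m U) {r : ℝ}
    (hr : r ∈ densityRangeInterior M) : 0 ≤ deriv (deriv U) r := by
  have h1 : MonotoneOn (deriv U) (densityRangeInterior M) := hU.convexOn.monotoneOn_deriv fun x hx =>
    (hU.differentiableOn x hx).differentiableAt (isOpen_densityRangeInterior.mem_nhds hx)
  rw [← derivWithin_of_isOpen isOpen_densityRangeInterior hr]
  exact h1.derivWithin_nonneg

theorem IsEnergyDensity.monotoneOn_pressure (hm : IsMobility M m) (hU : IsEnergyDensity M m U) :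
    MonotoneOn (pressure m U) (densityRange M) := by
  intro r hr r' hr' h
  have h1 := hU.integrable_pressure r hr
  have h2 := hU.integrable_pressure r' hr'
  have h3 : pressure m U r' - pressure m U r = ∫ z in r..r', m z * deriv (deriv U) z :=
    intervalIntegral.integral_interval_sub_left h2 h1
  have h4 : 0 ≤ ∫ z in r..r', m z * deriv (deriv U) z := by
    rw [intervalIntegral.integral_of_le h]
    refine setIntegral_nonneg measurableSet_Ioc fun z hz => ?_
    have hz' : z ∈ densityRangeInterior M :=
      ⟨hr.1.trans_lt hz.1, (EReal.coe_le_coe_iff.2 hz.2).trans_lt hr'.2⟩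
    exact mul_nonneg (hm.pos z hz').le (hU.deriv_deriv_nonneg hz')
  linarith

theorem IsEnergyDensity.continuousOn_pressure (hU : IsEnergyDensity M m U) :
    ContinuousOn (pressure m U) (densityRange M) := by
  intro r hr
  obtain ⟨r', h1, h2⟩ := EReal.lt_iff_exists_real_btwn.1 hr.2
  rw [EReal.coe_lt_coe_iff] at h1
  have h0 : 0 ≤ r' := hr.1.trans h1.le
  have h3 : ContinuousOn (pressure m U) (uIcc 0 r') :=
    intervalIntegral.continuousOn_primitive_interval' (hU.integrable_pressure r' ⟨h0, h2⟩)
      left_mem_uIcc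
  rw [uIcc_of_le h0] at h3
  refine (h3 r ⟨hr.1, h1.le⟩).mono_of_mem_nhdsWithin ?_
  filter_upwards [self_mem_nhdsWithin, mem_nhdsWithin_of_mem_nhds (Iio_mem_nhds h1)] with y hy hy'
  exact ⟨hy.1, hy'.le⟩

theorem pressure_zero : pressure m U 0 = 0 := by simp [pressure]

end Pressure

/-! ### Extending functions from a compact interval -/

section Extension

/-- A function of class `Cⁿ` on a nontrivial compact interval has a `Cⁿ` extension to `ℝ`. -/
theorem ContDiffOn.exists_contDiff_eqOn_Icc {a b : ℝ} (hab : a < b) (n : ℕ) {f : ℝ → ℝ}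
    (hf : ContDiffOn ℝ n f (Icc a b)) : ∃ F : ℝ → ℝ, ContDiff ℝ n F ∧ EqOn F f (Icc a b) := by
  induction n generalizing f with
  | zero =>
    refine ⟨IccExtend hab.le (domRestrict (Icc a b) f), ?_, fun x hx => IccExtend_of_mem _ _ hx⟩
    exact contDiff_zero.2 (hf.continuousOn.domRestrict.Icc_extend')
  | succ n ih =>
    have hu := uniqueDiffOn_Icc hab
    have hf' : ContDiffOn ℝ n (derivWithin f (Icc a b)) (Icc a b) :=
      ((contDiffOn_succ_iff_derivWithin hu).1 (by exact_mod_cast hf)).2.2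
    obtain ⟨G, hG, hGf⟩ := ih hf'
    -- The extension is the primitive of an extension of the derivative, normalised at `a`; it is
    -- one degree smoother than `G`.
    have hF' : ∀ r, HasDerivAt (fun r => f a + ∫ y in a..r, G y) (G r) r := fun r =>
      ((hG.continuous.integral_hasStrictDerivAt a r).hasDerivAt).const_add _
    refine ⟨fun r => f a + ∫ y in a..r, G y, ?_, fun r hr => ?_⟩
    · have : ContDiff ℝ ((n : ℕ∞ω) + 1) fun r => f a + ∫ y in a..r, G y := by
        refine contDiff_succ_iff_deriv.2 ⟨fun r => (hF' r).differentiableAt, by simp, ?_⟩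
        rwa [funext fun r => (hF' r).deriv]
      exact_mod_cast this
    · have h1 : ∫ y in a..r, G y = f r - f a := by
        have hsub : Icc a r ⊆ Icc a b := Icc_subset_Icc_right hr.2
        refine intervalIntegral.integral_eq_sub_of_hasDeriv_right_of_le hr.1
          (hf.continuousOn.mono hsub) (fun x hx => ?_) (hG.continuous.intervalIntegrable _ _)
        have hx' : x ∈ Icc a b := hsub (Ioo_subset_Icc_self hx)
        have h2 := ((hf.differentiableOn (by simp)) x hx').hasDerivWithinAt
        rw [← hGf hx'] at h2
        exact h2.mono_of_mem_nhdsWithin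
          (mem_nhdsWithin_of_mem_nhds (Icc_mem_nhds hx.1 (hx.2.trans_le hr.2)))
      dsimp only
      rw [h1]
      ring

/-- A smooth function on a compact interval agrees, together with its first two derivatives within
the interval, with a `C³` function on `ℝ`. -/
theorem ContDiffOn.exists_contDiff_extension_Icc {a b : ℝ} (hab : a ≤ b) {f : ℝ → ℝ}
    (hf : ContDiffOn ℝ ∞ f (Icc a b)) : ∃ F : ℝ → ℝ, ContDiff ℝ 3 F ∧ ∀ r ∈ Icc a b,
      F r = f r ∧ derivWithin f (Icc a b) r = deriv F r ∧
        iteratedDerivWithin 2 f (Icc a b) r = deriv (deriv F) r := by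
  rcases hab.eq_or_lt with rfl | hab
  -- In a one-point interval every derivative within the interval takes the default value 0, which a
  -- constant extension reproduces.
  · have h0 : ∀ g : ℝ → ℝ, derivWithin g (Icc a a) a = 0 := fun g =>
      derivWithin_zero_of_not_accPt fun h => by
        obtain ⟨y, hy, hya⟩ := accPt_iff_nhds.1 h univ univ_mem
        exact hya (le_antisymm hy.2.2 hy.2.1)
    refine ⟨fun _ => f a, contDiff_const, fun r hr => ?_⟩
    have hr' : r = a := le_antisymm hr.2 hr.1
    subst hr'
    refine ⟨rfl, by rw [h0, deriv_const], ?_⟩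
    rw [iteratedDerivWithin_succ, h0]
    simp
  · obtain ⟨F, hF, hFf⟩ := (hf.of_le (WithTop.coe_le_coe.2 le_top) :
      ContDiffOn ℝ (3 : ℕ) f (Icc a b)).exists_contDiff_eqOn_Icc hab 3
    have hF3 : ContDiff ℝ 3 F := by exact_mod_cast hF
    have hu := uniqueDiffOn_Icc hab
    refine ⟨F, hF3, fun r hr => ⟨hFf hr, ?_, ?_⟩⟩
    · rw [← derivWithin_congr hFf (hFf hr)]
      exact ((hF3.differentiable (by simp)) r).derivWithin (hu r hr)
    · rw [← iteratedDerivWithin_congr hFf hr, iteratedDerivWithin_eq_iteratedDeriv hu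
        (hF3.contDiffAt.of_le (by norm_num)) hr, iteratedDeriv_eq_iterate]
      rfl

/-- `H` is defined with two-sided derivatives on ℝ, which agree with those of the extensions only in
the open interval. The endpoints are null for the integral, so on `[a, b]` the function `H` is still
a primitive of `p' μ'`. -/
theorem auxiliaryH_eq_of_eqOn {M : EReal} {m U : ℝ → ℝ} (hU : IsEnergyDensity M m U) {a b : ℝ}
    (ha : 0 < a) (hb : (b : EReal) < M) {p μ : ℝ → ℝ} (hp : EqOn p (pressure m U) (Icc a b))
    (hμ : EqOn μ m (Icc a b)) (H₀ : ℝ) {r : ℝ} (hr : r ∈ Icc a b) :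
    auxiliaryH m U H₀ r = auxiliaryH m U H₀ a + ∫ z in a..r, deriv p z * deriv μ z := by
  have hrM : r ∈ densityRange M :=
    ⟨ha.le.trans hr.1, (EReal.coe_le_coe_iff.2 hr.2).trans_lt hb⟩
  have haM : a ∈ densityRange M := mem_densityRange_of_le hrM ha.le hr.1
  have h1 := intervalIntegral.integral_interval_sub_left (hU.integrable_auxiliary r hrM)
    (hU.integrable_auxiliary a haM)
  have h2 : ∫ z in a..r, deriv (pressure m U) z * deriv m z = ∫ z in a..r, deriv p z * deriv μ z := by
    rw [intervalIntegral.integral_of_le hr.1, intervalIntegral.integral_of_le hr.1,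
      integral_Ioc_eq_integral_Ioo, integral_Ioc_eq_integral_Ioo]
    refine setIntegral_congr_fun measurableSet_Ioo fun z hz => ?_
    have h3 : Icc a b ∈ 𝓝 z := Icc_mem_nhds hz.1 (hz.2.trans_le hr.2)
    have h4 : p =ᶠ[𝓝 z] pressure m U := by filter_upwards [h3] with y hy using hp hy
    have h5 : μ =ᶠ[𝓝 z] m := by filter_upwards [h3] with y hy using hμ hy
    rw [h4.deriv_eq, h5.deriv_eq]
  simp only [auxiliaryH]
  linarith

end Extension

/-! ### Weak and strong form of the Neumann problem -/

section Neumann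

variable {d : ℕ} {Ω : Set (EuclideanSpace ℝ (Fin d))}

theorem divergence_smul_smul_gradient {a ξ z : EuclideanSpace ℝ (Fin d) → ℝ} (ha : ContDiff ℝ 1 a)
    (hξ : ContDiff ℝ 1 ξ) (hz : ContDiff ℝ 2 z) (x : EuclideanSpace ℝ (Fin d)) :
    divergence (fun y => (ξ y * a y) • ∇ z y) x =
      a x * inner ℝ (∇ z x) (∇ ξ x) + ξ x * divergence (fun y => a y • ∇ z y) x := by
  rw [divergence_smul_gradient (hξ.mul ha) hz, divergence_smul_gradient ha hz,
    real_inner_comm, inner_gradient_gradient]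
  simp only [Finset.mul_sum, mul_add, ← Finset.sum_add_distrib]
  refine Finset.sum_congr rfl fun i _ => ?_
  rw [pd_mul (hξ.differentiable one_ne_zero) (ha.differentiable one_ne_zero)]
  ring

theorem IsSmoothBoundedDomain.integral_mul_inner_gradient (hΩ : IsSmoothBoundedDomain Ω)
    {a ξ z : EuclideanSpace ℝ (Fin d) → ℝ} (ha : ContDiff ℝ 1 a)
    (hξ : ContDiff ℝ 1 ξ) (hz : ContDiff ℝ 2 z) :
    ∫ x in Ω, a x * inner ℝ (∇ z x) (∇ ξ x) =
      (∫ x in frontier Ω, (ξ x * a x) * inner ℝ (∇ z x) (outerNormal Ω x)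
        ∂(Measure.euclideanHausdorffMeasure (d - 1))) -
      ∫ x in Ω, ξ x * divergence (fun y => a y • ∇ z y) x := by
  have h1 := hΩ.setIntegral_divergence_smul_gradient (hξ.mul ha) hz
  simp only [divergence_smul_smul_gradient ha hξ hz] at h1
  have hzc := hz.continuous_gradient two_ne_zero
  have hξc := hξ.continuous_gradient one_ne_zero
  have i1 : IntegrableOn (fun x => a x * inner ℝ (∇ z x) (∇ ξ x)) Ω :=
    hΩ.integrableOn_of_continuousOn_closure (ha.continuous.mul (hzc.inner hξc)).continuousOn
  have i2 : IntegrableOn (fun x => ξ x * divergence (fun y => a y • ∇ z y) x) Ω :=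
    hΩ.integrableOn_of_continuousOn_closure
      (hξ.continuous.mul (continuous_divergence_smul_gradient ha hz)).continuousOn
  rw [integral_add i1 i2] at h1
  linarith

/-- A weak formulation tested with smooth functions may be tested with `C¹` functions. -/
theorem IsSmoothBoundedDomain.integral_mul_eq_of_contDiff_one (hΩ : IsSmoothBoundedDomain Ω)
    {f q : EuclideanSpace ℝ (Fin d) → ℝ} (hf : Continuous f) (hq : ContDiff ℝ 2 q)
    (h : ∀ ξ : EuclideanSpace ℝ (Fin d) → ℝ, ContDiff ℝ ∞ ξ → HasCompactSupport ξ →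
      ∫ x in Ω, f x * ξ x = -∫ x in Ω, inner ℝ (∇ q x) (∇ ξ x))
    {ξ : EuclideanSpace ℝ (Fin d) → ℝ} (hξ : ContDiff ℝ 1 ξ) :
    ∫ x in Ω, f x * ξ x = -∫ x in Ω, inner ℝ (∇ q x) (∇ ξ x) := by
  set D : EuclideanSpace ℝ (Fin d) → ℝ := divergence (fun y => (1 : ℝ) • ∇ q y) with hD
  have hDc : Continuous D := continuous_divergence_smul_gradient contDiff_const hq
  have key : ∀ ξ : EuclideanSpace ℝ (Fin d) → ℝ, ContDiff ℝ 1 ξ →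
      ∫ x in Ω, inner ℝ (∇ q x) (∇ ξ x) =
      (∫ x in frontier Ω, ξ x * inner ℝ (∇ q x) (outerNormal Ω x)
        ∂(Measure.euclideanHausdorffMeasure (d - 1))) - ∫ x in Ω, ξ x * D x := fun ξ hξ => by
    simpa only [one_mul, mul_one, ← hD] using
      hΩ.integral_mul_inner_gradient (a := fun _ => 1) contDiff_const hξ hq
  have int : ∀ {f : EuclideanSpace ℝ (Fin d) → ℝ}, Continuous f → IntegrableOn f Ω :=
    fun hf => hΩ.integrableOn_of_continuousOn_closure hf.continuousOn
  have int2 : ∀ {ξ g : EuclideanSpace ℝ (Fin d) → ℝ}, Continuous ξ → Continuous g →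
      IntegrableOn (fun x => ξ x * g x) Ω := fun h1 h2 => int (h1.mul h2)
  have h1 : ∀ ξ : EuclideanSpace ℝ (Fin d) → ℝ, ContDiff ℝ ∞ ξ → HasCompactSupport ξ →
      (∫ x in Ω, ξ x * (f x - D x)) + ∫ x in frontier Ω, ξ x * inner ℝ (∇ q x) (outerNormal Ω x)
        ∂(Measure.euclideanHausdorffMeasure (d - 1)) = 0 := fun ξ hξ hξc => by
    have e1 := h ξ hξ hξc
    rw [key ξ (hξ.of_le (WithTop.coe_le_coe.2 le_top))] at e1
    simp only [mul_sub]
    rw [integral_sub (int2 hξ.continuous hf) (int2 hξ.continuous hDc)]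
    simp only [mul_comm (f _)] at e1
    linarith
  -- The strong form is recovered: test functions supported in `Ω` give `f = Δq` almost everywhere
  -- there, after which the remaining ones give `∂ₙq = 0` almost everywhere on the boundary.
  -- Integrating by parts again needs only a C¹ test function.
  have hin : ∀ᵐ x, x ∈ Ω → f x - D x = 0 := by
    refine hΩ.isOpen.ae_eq_zero_of_integral_contDiff_smul_eq_zero
      ((hf.sub hDc).locallyIntegrable.locallyIntegrableOn _) fun φ hφ hφc hφs => ?_
    have hφ0 : ∀ x, x ∉ Ω → φ x = 0 := fun x hx =>
      image_eq_zero_of_notMem_tsupport fun h => hx (hφs h)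
    have e1 := h1 φ hφ hφc
    rw [setIntegral_eq_zero_of_forall_eq_zero (t := frontier Ω) (fun x hx => by
      rw [hφ0 x fun h => (hΩ.isOpen.inter_frontier_eq ▸ ⟨h, hx⟩ : x ∈ (∅ : Set _)), zero_mul]),
      add_zero] at e1
    rw [← setIntegral_eq_integral_of_forall_compl_eq_zero fun x hx => by rw [hφ0 x hx, zero_smul]]
    exact e1
  have hin' : ∀ g : EuclideanSpace ℝ (Fin d) → ℝ, ∫ x in Ω, g x * (f x - D x) = 0 := fun g => by
    refine integral_eq_zero_of_ae ?_
    filter_upwards [ae_restrict_of_ae hin, ae_restrict_mem hΩ.isOpen.measurableSet] with x e1 e2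
    simp [e1 e2]
  have hqn : ContinuousOn (fun x => inner ℝ (∇ q x) (outerNormal Ω x)) (frontier Ω) :=
    (hq.continuous_gradient two_ne_zero).continuousOn.inner hΩ.continuousOn_outerNormal
  have hbd : ∀ᵐ x ∂(Measure.euclideanHausdorffMeasure (d - 1)).restrict (frontier Ω),
      inner ℝ (∇ q x) (outerNormal Ω x) = 0 := by
    refine ae_eq_zero_of_integral_contDiff_smul_eq_zero
      (Integrable.locallyIntegrable (hΩ.integrableOn_frontier hqn)) fun φ hφ hφc => ?_
    have e1 := h1 φ hφ hφc
    rw [hin', zero_add] at e1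
    exact e1
  rw [key ξ hξ, integral_eq_zero_of_ae (μ := (Measure.euclideanHausdorffMeasure (d - 1)).restrict
    (frontier Ω)) (by filter_upwards [hbd] with x hx; simp [hx])]
  have e2 := hin' ξ
  simp only [mul_sub] at e2
  rw [integral_sub (int2 hξ.continuous hf) (int2 hξ.continuous hDc)] at e2
  simp only [mul_comm (f _)]
  linarith

end Neumann

/-! ### The rescaled flow -/

section Flow

variable {d : ℕ} {Ω : Set (EuclideanSpace ℝ (Fin d))}

/-- For `s > 0` the substitution `τ = s t` turns the family into a solution of the unscaled
equation. It degenerates at `s = 0`, a case treated separately. -/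
theorem smoothOnNhd_rescale {ρ : ℝ → ℝ → EuclideanSpace ℝ (Fin d) → ℝ}
    (hρ : SmoothOnNhd (fun q : ℝ × ℝ × EuclideanSpace ℝ (Fin d) => ρ q.1 q.2.1 q.2.2)
      (Icc 0 1 ×ˢ Ioi 0 ×ˢ closure Ω)) {s : ℝ} (hs : s ∈ Icc (0 : ℝ) 1) (hs0 : 0 < s) :
    SmoothOnNhd (fun q : ℝ × EuclideanSpace ℝ (Fin d) => ρ s (q.1 / s) q.2)
      (Ioi 0 ×ˢ closure Ω) := by
  obtain ⟨V, hV, hsub, hVρ⟩ := hρ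
  have hg : ContDiff ℝ ∞ fun q : ℝ × EuclideanSpace ℝ (Fin d) => (s, q.1 / s, q.2) :=
    contDiff_const.prodMk ((contDiff_fst.div_const s).prodMk contDiff_snd)
  refine ⟨_, hV.preimage hg.continuous, fun q hq => hsub ⟨hs, div_pos hq.1 hs0, hq.2⟩, ?_⟩
  exact hVρ.comp hg.contDiffOn fun q hq => hq

/-- The flow preserves the bounds of the initial data. -/
theorem flow_mem_Icc (hΩ : IsSmoothBoundedDomain Ω) {M : EReal} (hM : 0 < M) {P : ℝ → ℝ}
    (hP : MonotoneOn P (densityRange M)) (hPc : ContinuousOn P (densityRange M)) (hP0 : 0 ≤ P 0)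
    {m₀ m₁ : ℝ} {ρ₀ : ℝ → EuclideanSpace ℝ (Fin d) → ℝ}
    (hρ₀ : SmoothOnNhd (fun p : ℝ × EuclideanSpace ℝ (Fin d) => ρ₀ p.1 p.2)
      (Icc 0 1 ×ˢ closure Ω))
    (hb : ∀ s ∈ Icc (0 : ℝ) 1, ∀ x ∈ closure Ω, ρ₀ s x ∈ Icc m₀ m₁)
    {ρ : ℝ → ℝ → EuclideanSpace ℝ (Fin d) → ℝ}
    (hflow : ∀ s ∈ Icc (0 : ℝ) 1, ∃ u : ℝ → EuclideanSpace ℝ (Fin d) → ℝ,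
      IsWeakDiffusionSolution M P Ω (ρ₀ s) u ∧
      ∀ t, 0 ≤ t → ρ s t =ᵐ[volume.restrict Ω] u (s * t))
    (hρ : SmoothOnNhd (fun q : ℝ × ℝ × EuclideanSpace ℝ (Fin d) => ρ q.1 q.2.1 q.2.2)
      (Icc 0 1 ×ˢ Ioi 0 ×ˢ closure Ω)) :
    (∀ t, 0 < t → ∀ x ∈ closure Ω, ρ 0 t x = ρ₀ 0 x) ∧
    ∀ s ∈ Icc (0 : ℝ) 1, ∀ t, 0 < t → ∀ x ∈ closure Ω, ρ s t x ∈ Icc m₀ m₁ := by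
  have h0 : (0 : ℝ) ∈ Icc (0 : ℝ) 1 := ⟨le_rfl, zero_le_one⟩
  have hzero : ∀ t, 0 < t → ∀ x ∈ closure Ω, ρ 0 t x = ρ₀ 0 x := by
    intro t ht
    obtain ⟨u, hu, hρu⟩ := hflow 0 h0
    -- For `s = 0` the diffusion is evaluated at time 0 for every `t`, so the density stays at its
    -- initial value.
    have e1 : ρ 0 t =ᵐ[volume.restrict Ω] ρ₀ 0 := by
      filter_upwards [hρu t ht.le, hu.initial] with x k1 k2
      rw [k1, zero_mul, k2]
    have c1 : ContinuousOn (ρ 0 t) (closure Ω) :=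
      hρ.continuousOn.comp (f := fun x => ((0 : ℝ), t, x)) (by fun_prop) fun x hx => ⟨h0, ht, hx⟩
    have c2 : ContinuousOn (ρ₀ 0) (closure Ω) :=
      hρ₀.continuousOn.comp (f := fun x => ((0 : ℝ), x)) (by fun_prop) fun x hx => ⟨h0, hx⟩
    have e2 : EqOn (ρ 0 t) (ρ₀ 0) Ω := Measure.eqOn_open_of_ae_eq e1 hΩ.isOpen
      (c1.mono subset_closure) (c2.mono subset_closure)
    exact fun x hx => e2.of_subset_closure c1 c2 subset_closure Subset.rfl hx
  refine ⟨hzero, fun s hs t ht x hx => ?_⟩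
  rcases hs.1.eq_or_lt with rfl | hs0
  · rw [hzero t ht x hx]
    exact hb 0 h0 x hx
  · obtain ⟨u, hu, hρu⟩ := hflow s hs
    have hm : m₀ ≤ m₁ := (hb s hs x hx).1.trans (hb s hs x hx).2
    have := hu.mem_Icc_of_initial hΩ hM hP hPc hP0 (smoothOnNhd_rescale hρ hs hs0)
      (fun τ hτ => by
        have := hρu (τ / s) (div_pos hτ hs0).le
        rw [mul_div_cancel₀ τ hs0.ne'] at this
        filter_upwards [this] with y hy using hy.symm) hm
      (fun y hy => hb s hs y (subset_closure hy)) (mul_pos hs0 ht) x hx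
    simpa [mul_div_cancel_left₀ t hs0.ne'] using this

/-- The equation `∂ₜρ = s ΔP(ρ)` with no-flux boundary condition, in weak form. -/
theorem flow_integral_eq (hΩ : IsSmoothBoundedDomain Ω) {M : EReal} {P : ℝ → ℝ}
    {ρ₀ : ℝ → EuclideanSpace ℝ (Fin d) → ℝ}
    {ρ : ℝ → ℝ → EuclideanSpace ℝ (Fin d) → ℝ}
    (hflow : ∀ s ∈ Icc (0 : ℝ) 1, ∃ u : ℝ → EuclideanSpace ℝ (Fin d) → ℝ,
      IsWeakDiffusionSolution M P Ω (ρ₀ s) u ∧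
      ∀ t, 0 ≤ t → ρ s t =ᵐ[volume.restrict Ω] u (s * t))
    (hρ : SmoothOnNhd (fun q : ℝ × ℝ × EuclideanSpace ℝ (Fin d) => ρ q.1 q.2.1 q.2.2)
      (Icc 0 1 ×ˢ Ioi 0 ×ˢ closure Ω))
    (hzero : ∀ t, 0 < t → ∀ x ∈ closure Ω, ρ 0 t x = ρ₀ 0 x) {p : ℝ → ℝ} (hp : ContDiff ℝ 1 p)
    (hpP : ∀ s ∈ Icc (0 : ℝ) 1, ∀ t, 0 < t → ∀ x ∈ Ω, p (ρ s t x) = P (ρ s t x))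
    {s t : ℝ} (hs : s ∈ Icc (0 : ℝ) 1) (ht : 0 < t)
    {ξ : EuclideanSpace ℝ (Fin d) → ℝ} (hξ : ContDiff ℝ ∞ ξ) :
    ∫ x in Ω, deriv (fun τ => ρ s τ x) t * ξ x =
      -s * ∫ x in Ω, inner ℝ (∇ (fun y => p (ρ s t y)) x) (∇ ξ x) := by
  rcases hs.1.eq_or_lt with rfl | hs0
  -- For `s = 0` the density does not depend on time, and both sides vanish.
  · rw [neg_zero, zero_mul]
    refine setIntegral_eq_zero_of_forall_eq_zero fun x hx => ?_
    have : (fun τ => ρ 0 τ x) =ᶠ[𝓝 t] fun _ => ρ₀ 0 x := by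
      filter_upwards [Ioi_mem_nhds ht] with τ hτ using hzero τ hτ x (subset_closure hx)
    rw [this.deriv_eq, deriv_const, zero_mul]
  · obtain ⟨u, hu, hρu⟩ := hflow s hs
    have hv := smoothOnNhd_rescale hρ hs hs0
    have := hu.integral_deriv_mul_eq hΩ hv
      (fun τ hτ => by
        have := hρu (τ / s) (div_pos hτ hs0).le
        rw [mul_div_cancel₀ τ hs0.ne'] at this
        filter_upwards [this] with y hy using hy.symm) hp
      (fun τ hτ x hx => hpP s hs _ (div_pos hτ hs0) x hx) (mul_pos hs0 ht) hξ
    simp only [mul_div_cancel_left₀ t hs0.ne'] at this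
    rw [neg_mul, ← mul_neg, ← this, ← integral_const_mul]
    refine setIntegral_congr_fun hΩ.isOpen.measurableSet fun x hx => ?_
    have h1 : DifferentiableAt ℝ (fun q : ℝ × EuclideanSpace ℝ (Fin d) => ρ s (q.1 / s) q.2)
        (s * t, x) :=
      (hv.contDiffAt (x := (s * t, x)) ⟨mem_Ioi.2 (mul_pos hs0 ht), subset_closure hx⟩).differentiableAt (by simp)
    have h2 : HasDerivAt (fun τ : ℝ => (s * τ, x)) (s • ((1 : ℝ), (0 : EuclideanSpace ℝ (Fin d)))) t := by
      have := ((hasDerivAt_id t).const_mul s).prodMk (hasDerivAt_const t x)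
      simpa using this
    have h3 := h1.hasFDerivAt.comp_hasDerivAt t h2
    have h4 : (fun τ => ρ s τ x) = fun τ => ρ s (s * τ / s) x := by
      funext τ
      rw [mul_div_cancel_left₀ τ hs0.ne']
    rw [h4]
    have h5 : deriv (fun τ => ρ s (s * τ / s) x) t = _ := h3.deriv
    rw [h5, map_smul, smul_eq_mul, mul_assoc]

end Flow

/-! ### The derivative of the action along a globally defined smooth flow -/

section ActionFormula

variable {d : ℕ} {Ω : Set (EuclideanSpace ℝ (Fin d))}

theorem fderiv_comp_real_apply {X : Type*} [NormedAddCommGroup X] [NormedSpace ℝ X] {p : ℝ → ℝ}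
    {R : X → ℝ} (hp : Differentiable ℝ p) (hR : Differentiable ℝ R) (q a : X) :
    fderiv ℝ (fun q => p (R q)) q a = deriv p (R q) * fderiv ℝ R q a := by
  have h : fderiv ℝ (fun q => p (R q)) q = _ :=
    ((hp (R q)).hasDerivAt.comp_hasFDerivAt q (hR q).hasFDerivAt).fderiv
  rw [h]
  simp

/-- The derivative of the action consists of the term `∇p(R)·∇Z` and of `s` times the left-hand side
of the identity at a fixed time, once `∂ₛp(R) = p'(R) ∂ₛR` and `∂ₜμ(R) = μ'(R) ∂ₜR` are inserted. -/
theorem IsSmoothBoundedDomain.hasDerivAt_half_action (hΩ : IsSmoothBoundedDomain Ω)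
    {R : ℝ × ℝ × EuclideanSpace ℝ (Fin d) → ℝ} (hR : ContDiff ℝ ∞ R) {p μ h : ℝ → ℝ}
    (hp : ContDiff ℝ 3 p) (hμ : ContDiff ℝ 3 μ) (hh : ContDiff ℝ 1 h)
    (hh' : ∀ r, deriv h r = deriv p r * deriv μ r)
    {s t δ c : ℝ} (hs : s ∈ Icc (0 : ℝ) 1) (hδ : 0 < δ) (hc : 0 < c)
    (hmc : ∀ τ ∈ Metric.ball t δ, ∀ x ∈ Ω, c ≤ μ (R (s, τ, x)))
    {Z : ℝ → EuclideanSpace ℝ (Fin d) → ℝ}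
    (hZ : ∀ τ ∈ Metric.ball t δ, ContDiff ℝ ∞ (Z τ) ∧ HasCompactSupport (Z τ))
    (hZe : ∀ τ ∈ Metric.ball t δ, ∀ x ∈ Ω,
      -divergence (fun y => μ (R (s, τ, y)) • ∇ (Z τ) y) x = fderiv ℝ R (s, τ, x) (1, 0, 0))
    (hZn : ∀ τ ∈ Metric.ball t δ, ∀ x ∈ frontier Ω, inner ℝ (∇ (Z τ) x) (outerNormal Ω x) = 0)
    (hI : ∀ τ ∈ Metric.ball t δ, ∀ ξ : EuclideanSpace ℝ (Fin d) → ℝ, ContDiff ℝ ∞ ξ →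
      ∀ σ ∈ Icc (0 : ℝ) 1, ∫ x in Ω, fderiv ℝ R (σ, τ, x) (0, 1, 0) * ξ x =
        -σ * ∫ x in Ω, inner ℝ (∇ (fun y => p (R (σ, τ, y))) x) (∇ ξ x)) :
    HasDerivAt (fun τ => 1 / 2 * ∫ x in Ω, μ (R (s, τ, x)) * ‖∇ (Z τ) x‖ ^ 2)
      (-(∫ x in Ω, inner ℝ (∇ (fun y => p (R (s, t, y))) x) (∇ (Z t) x))
        - s * (∫ x in Ω, ((deriv p (R (s, t, x)) * μ (R (s, t, x)) - h (R (s, t, x)))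
            * (Δ (Z t) x) ^ 2 + h (R (s, t, x)) * hessianNormSq (Z t) x))
        + s / 2 * (∫ x in Ω, deriv p (R (s, t, x)) * deriv (deriv μ) (R (s, t, x))
            * ‖∇ (fun y => R (s, t, y)) x‖ ^ 2 * ‖∇ (Z t) x‖ ^ 2)
        + s / 2 * (∫ x in frontier Ω, h (R (s, t, x))
            * inner ℝ (∇ (fun y => ‖∇ (Z t) y‖ ^ 2) x) (outerNormal Ω x)
            ∂(Measure.euclideanHausdorffMeasure (d - 1)))) t := by
  have htb : t ∈ Metric.ball t δ := Metric.mem_ball_self hδ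
  have hR3 : ContDiff ℝ 3 R := hR.of_le (WithTop.coe_le_coe.2 le_top)
  have hR2 : ContDiff ℝ 2 R := hR.of_le (WithTop.coe_le_coe.2 le_top)
  have hRd : Differentiable ℝ R := hR.differentiable (by simp)
  have hF : ContDiff ℝ 3 fun q => p (R q) := hp.comp hR3
  have hF2 : ContDiff ℝ 2 fun q => p (R q) := hF.of_le (by norm_num)
  have hFd : Differentiable ℝ fun q => p (R q) := hF.differentiable (by simp)
  have hm : ContDiff ℝ 3 fun q => μ (R q) := hμ.comp hR3
  have hslice : ∀ {n : ℕ∞ω} {G : ℝ × ℝ × EuclideanSpace ℝ (Fin d) → ℝ}, ContDiff ℝ n G →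
      ∀ σ τ, ContDiff ℝ n fun x => G (σ, τ, x) := fun hG σ τ => hG.comp (by fun_prop)
  have hact := hΩ.hasDerivAt_action hR2 hF2 (hm.of_le (by norm_num)) hs hδ hc hmc hZ
    (fun τ hτ ξ hξ => by
      rw [hΩ.integral_mul_inner_gradient ((hslice hm s τ).of_le (by norm_num))
        (hξ.of_le (WithTop.coe_le_coe.2 le_top)) ((hZ τ hτ).1.of_le (WithTop.coe_le_coe.2 le_top)),
        setIntegral_eq_zero_of_forall_eq_zero (t := frontier Ω)
          fun x hx => by rw [hZn τ hτ x hx, mul_zero], zero_sub, ← integral_neg]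
      refine setIntegral_congr_fun hΩ.isOpen.measurableSet fun x hx => ?_
      rw [← hZe τ hτ x hx]
      ring)
    (fun τ hτ ξ hξ _ => by
      filter_upwards [self_mem_nhdsWithin] with σ hσ
      rw [hI τ hτ ξ hξ σ hσ]
      simp only [inner_gradient_slice hFd])
  set r : EuclideanSpace ℝ (Fin d) → ℝ := fun x => R (s, t, x) with hr
  set z := Z t with hz
  set w : EuclideanSpace ℝ (Fin d) → ℝ := fun x => fderiv ℝ R (s, t, x) (1, 0, 0) with hw
  have hrC : ContDiff ℝ ∞ r := hslice hR s t
  have hzC : ContDiff ℝ ∞ z := (hZ t htb).1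
  have hwC : ContDiff ℝ 1 w := hslice (hR2.fderiv_const_apply (by norm_num) _) s t
  have hμ1 : ContDiff ℝ 2 (deriv μ) := by
    have := (contDiff_succ_iff_deriv (n := 2)).1 hμ; exact this.2.2
  have hstat := hΩ.integral_identity (hp.of_le (by norm_num)) (hμ.of_le (by norm_num)) hh
    (hrC.of_le (WithTop.coe_le_coe.2 le_top)) (hzC.of_le (WithTop.coe_le_coe.2 le_top)) hwC
    (hZe t htb) (hZn t htb) fun x _ => hh' (r x)
  -- the three terms of the derivative
  have t1 : ∫ x in Ω, fderiv ℝ (fun q => p (R q)) (s, t, x) (0, 0, ∇ z x) =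
      ∫ x in Ω, inner ℝ (∇ (fun y => p (r y)) x) (∇ z x) := by
    simp only [hr, inner_gradient_slice hFd]
  have t2 : ∫ x in Ω, fderiv ℝ (fun q => fderiv ℝ (fun q => p (R q)) q (1, 0, 0)) (s, t, x)
      (0, 0, ∇ z x) = ∫ x in Ω, inner ℝ (∇ (fun y => deriv p (r y) * w y) x) (∇ z x) := by
    have e1 : Differentiable ℝ fun q => fderiv ℝ (fun q => p (R q)) q (1, 0, 0) :=
      (hF2.fderiv_const_apply (m := 1) (by norm_num) _).differentiable one_ne_zero
    simp only [← inner_gradient_slice e1]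
    simp only [fderiv_comp_real_apply (hp.differentiable (by simp)) hRd, hr, hw]
  -- The equation for `∂ₜR` is tested with `μ'(r) |∇z|²`. The extension `μ` has finite smoothness,
  -- so this test function need not be C^∞ and
  -- `IsSmoothBoundedDomain.integral_mul_eq_of_contDiff_one` is required.
  have t3 : ∫ x in Ω, fderiv ℝ (fun q => μ (R q)) (s, t, x) (0, 1, 0) * ‖∇ z x‖ ^ 2 =
      -s * ∫ x in Ω, inner ℝ (∇ (fun y => p (r y)) x)
        (∇ (fun y => deriv μ (r y) * ‖∇ z y‖ ^ 2) x) := by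
    have e1 : ContDiff ℝ 1 fun y => deriv μ (r y) * ‖∇ z y‖ ^ 2 :=
      ((hμ1.of_le (by norm_num)).comp (hrC.of_le (WithTop.coe_le_coe.2 le_top))).mul
        (contDiff_norm_gradient_sq (n := 2) (hzC.of_le (WithTop.coe_le_coe.2 le_top))
          (by norm_num))
    have e2 : ContDiff ℝ 2 fun y => s * p (r y) := contDiff_const.mul (hslice hF2 s t)
    have e3 : ∀ x, ∇ (fun y => s * p (r y)) x = s • ∇ (fun y => p (r y)) x := fun x => by
      rw [gradient, fderiv_const_mul (((hslice hF2 s t).differentiable two_ne_zero) x), map_smul,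
        gradient]
    have e4 := hΩ.integral_mul_eq_of_contDiff_one
      (f := fun x => fderiv ℝ R (s, t, x) (0, 1, 0)) (q := fun y => s * p (r y))
      (hslice (hR2.fderiv_const_apply (m := 1) (by norm_num) _) s t).continuous e2
      (fun ξ hξ _ => by
        rw [hI t htb ξ hξ s hs]
        simp only [e3, inner_smul_left]
        rw [integral_const_mul, neg_mul]
        rfl) e1
    simp only [e3, inner_smul_left, integral_const_mul] at e4
    rw [neg_mul]
    refine Eq.trans ?_ e4
    refine integral_congr_ae (ae_of_all _ fun x => ?_)
    dsimp only
    rw [fderiv_comp_real_apply (hμ.differentiable (by simp)) hRd]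
    ring
  rw [t1, t2, t3] at hact
  refine (hact.const_mul (1 / 2)).congr_deriv ?_
  linear_combination s * hstat

end ActionFormula

/-! ### Locality of the differential operators -/

section Locality

variable {d : ℕ} {x : EuclideanSpace ℝ (Fin d)}

theorem Filter.EventuallyEq.divergence_eq
    {F G : EuclideanSpace ℝ (Fin d) → EuclideanSpace ℝ (Fin d)} (h : F =ᶠ[𝓝 x] G) :
    divergence F x = divergence G x := by
  simp only [divergence, h.fderiv_eq]

theorem Filter.EventuallyEq.hessianNormSq_eq {f g : EuclideanSpace ℝ (Fin d) → ℝ}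
    (h : f =ᶠ[𝓝 x] g) : hessianNormSq f x = hessianNormSq g x := by
  simp only [hessianNormSq, (h.fderiv (𝕜 := ℝ)).fderiv_eq]

theorem continuous_hessianNormSq {f : EuclideanSpace ℝ (Fin d) → ℝ} (hf : ContDiff ℝ 2 f) :
    Continuous (hessianNormSq f) := by
  refine continuous_finsetSum _ fun i _ => continuous_finsetSum _ fun j _ => ?_
  have h1 : ContDiff ℝ 1 (fderiv ℝ f) := hf.fderiv_right (by norm_num)
  exact (((h1.continuous_fderiv one_ne_zero).clm_apply continuous_const).clm_apply
    continuous_const).pow 2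

theorem continuous_laplacian {f : EuclideanSpace ℝ (Fin d) → ℝ} (hf : ContDiff ℝ 2 f) :
    Continuous (Δ f) := by
  have : Δ f = fun x => ∑ i, pd i (pd i f) x := funext fun x => laplacian_eq_sum hf
  rw [this]
  exact continuous_finsetSum _ fun i _ =>
    ((hf.pd (m := 1) (by norm_num) i).pd (m := 0) (by norm_num) i).continuous

end Locality

end

/-! ### The formula for the rescaled diffusion -/

theorem mainTheorem8 {d : ℕ} (hd : 1 ≤ d)
    -- the smooth bounded open set, the mobility, the energy density and the constant in `H`
    (Ω : Set (EuclideanSpace ℝ (Fin d))) (hΩ : IsSmoothBoundedDomain Ω)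
    (M : EReal) (m U : ℝ → ℝ) (hm : IsMobility M m) (hU : IsEnergyDensity M m U)
    (H₀ : ℝ) (hH₀ : 0 ≤ H₀)
    (m₀ m₁ : ℝ) (hm₀ : 0 < m₀) (hm₁ : (m₁ : EReal) < M)
    (hm_smooth : ContDiffOn ℝ ∞ m (Icc m₀ m₁))
    (hP_smooth : ContDiffOn ℝ ∞ (pressure m U) (Icc m₀ m₁))
    -- the smooth curve of initial densities `ρ_s`
    (ρ₀ : ℝ → EuclideanSpace ℝ (Fin d) → ℝ)
    (hρ₀_smooth : SmoothOnNhd (fun p : ℝ × EuclideanSpace ℝ (Fin d) => ρ₀ p.1 p.2)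
      (Icc 0 1 ×ˢ closure Ω))
    (hρ₀_bounds : ∀ s ∈ Icc (0 : ℝ) 1, ∀ x ∈ closure Ω, ρ₀ s x ∈ Icc m₀ m₁)
    (mass : ℝ) (hρ₀_mass : ∀ s ∈ Icc (0 : ℝ) 1, ∫ x in Ω, ρ₀ s x = mass)
    -- `ρ_{s,t} = S_{st} ρ_s`, smooth on `[0,1] × (0,∞) × closure Ω`
    (ρ : ℝ → ℝ → EuclideanSpace ℝ (Fin d) → ℝ)
    (hρ_flow : ∀ s ∈ Icc (0 : ℝ) 1, ∃ u : ℝ → EuclideanSpace ℝ (Fin d) → ℝ,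
      IsWeakDiffusionSolution M (pressure m U) Ω (ρ₀ s) u ∧
      ∀ t, 0 ≤ t → ρ s t =ᵐ[volume.restrict Ω] u (s * t))
    (hρ_smooth : SmoothOnNhd (fun p : ℝ × ℝ × EuclideanSpace ℝ (Fin d) => ρ p.1 p.2.1 p.2.2)
      (Icc 0 1 ×ˢ Ioi 0 ×ˢ closure Ω))
    -- `ζ_{s,t}` solves the Neumann problem with right-hand side `∂_s ρ_{s,t}`
    (ζ : ℝ → ℝ → EuclideanSpace ℝ (Fin d) → ℝ)
    (hζ : ∀ s ∈ Icc (0 : ℝ) 1, ∀ t, 0 < t →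
      IsNeumannPotential m Ω (ρ s t) (fun x => derivWithin (fun σ => ρ σ t x) (Icc 0 1) s) (ζ s t))
    (s : ℝ) (hs : s ∈ Icc (0 : ℝ) 1) (t : ℝ) (ht : 0 < t) :
    IntegrableOn (fun x => m (ρ s t x) * ‖∇ (ζ s t) x‖ ^ 2) Ω ∧
    IntegrableOn (fun x => inner ℝ (∇ (fun y => pressure m U (ρ s t y)) x) (∇ (ζ s t) x)) Ω ∧
    IntegrableOn (fun x =>
      (derivWithin (pressure m U) (Icc m₀ m₁) (ρ s t x) * m (ρ s t x)
          - auxiliaryH m U H₀ (ρ s t x)) * (Δ (ζ s t) x) ^ 2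
        + auxiliaryH m U H₀ (ρ s t x) * hessianNormSq (ζ s t) x) Ω ∧
    IntegrableOn (fun x =>
      derivWithin (pressure m U) (Icc m₀ m₁) (ρ s t x)
        * iteratedDerivWithin 2 m (Icc m₀ m₁) (ρ s t x)
        * ‖∇ (ρ s t) x‖ ^ 2 * ‖∇ (ζ s t) x‖ ^ 2) Ω ∧
    IntegrableOn (fun x =>
      auxiliaryH m U H₀ (ρ s t x)
        * inner ℝ (∇ (fun y => ‖∇ (ζ s t) y‖ ^ 2) x) (outerNormal Ω x))
      (frontier Ω) (Measure.euclideanHausdorffMeasure (d - 1)) ∧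
    HasDerivAt (fun τ => (1 / 2) * action m Ω (ρ s τ) (ζ s τ))
      (- (∫ x in Ω, inner ℝ (∇ (fun y => pressure m U (ρ s t y)) x) (∇ (ζ s t) x))
        - s * (∫ x in Ω,
            ((derivWithin (pressure m U) (Icc m₀ m₁) (ρ s t x) * m (ρ s t x)
                - auxiliaryH m U H₀ (ρ s t x)) * (Δ (ζ s t) x) ^ 2
              + auxiliaryH m U H₀ (ρ s t x) * hessianNormSq (ζ s t) x))
        + s / 2 * (∫ x in Ω,
            derivWithin (pressure m U) (Icc m₀ m₁) (ρ s t x)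
              * iteratedDerivWithin 2 m (Icc m₀ m₁) (ρ s t x)
              * ‖∇ (ρ s t) x‖ ^ 2 * ‖∇ (ζ s t) x‖ ^ 2)
        + s / 2 * (∫ x in frontier Ω,
            auxiliaryH m U H₀ (ρ s t x)
              * inner ℝ (∇ (fun y => ‖∇ (ζ s t) y‖ ^ 2) x) (outerNormal Ω x)
            ∂(Measure.euclideanHausdorffMeasure (d - 1))))
      t := by
  have hM : 0 < M := hm.threshold_pos
  have hδ : 0 < t / 2 := by linarith
  -- The radius `t / 2` keeps all times positive and inside the compact interval `[t / 2, 2 t]`.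
  have hball : ∀ τ ∈ Metric.ball t (t / 2), τ ∈ Icc (t / 2) (2 * t) ∧ 0 < τ := fun τ hτ => by
    rw [Real.ball_eq_Ioo] at hτ
    exact ⟨⟨by linarith [hτ.1], by linarith [hτ.2]⟩, by linarith [hτ.1]⟩
  obtain ⟨hzero, hmem⟩ := flow_mem_Icc hΩ hM (hU.monotoneOn_pressure hm) hU.continuousOn_pressure
    pressure_zero.ge hρ₀_smooth hρ₀_bounds hρ_flow hρ_smooth
  -- The order `m₀ ≤ m₁` is read off from a value of the density, which requires a point of `Ω`; for
  -- empty `Ω` all integrals vanish.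
  rcases Ω.eq_empty_or_nonempty with rfl | ⟨x₀, hx₀⟩
  · simp [action, hasDerivAt_const]
  have hm₀₁ : m₀ ≤ m₁ :=
    (hmem s hs t ht x₀ (subset_closure hx₀)).1.trans (hmem s hs t ht x₀ (subset_closure hx₀)).2
  -- extensions of the nonlinearities
  obtain ⟨p, hp, hpI⟩ := hP_smooth.exists_contDiff_extension_Icc hm₀₁
  obtain ⟨μ, hμ, hμI⟩ := hm_smooth.exists_contDiff_extension_Icc hm₀₁
  have hp1 : ContDiff ℝ 2 (deriv p) := ((contDiff_succ_iff_deriv (n := 2)).1 hp).2.2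
  have hμ1 : ContDiff ℝ 2 (deriv μ) := ((contDiff_succ_iff_deriv (n := 2)).1 hμ).2.2
  have hpμ : Continuous fun z => deriv p z * deriv μ z := hp1.continuous.mul hμ1.continuous
  -- A C¹ function on ℝ satisfying `h' = p' μ'` everywhere and equal to `H` on `[m₀, m₁]`.
  set h : ℝ → ℝ := fun r => auxiliaryH m U H₀ m₀ + ∫ z in m₀..r, deriv p z * deriv μ z with hh
  have hh' : ∀ r, HasDerivAt h (deriv p r * deriv μ r) r := fun r =>
    (hpμ.integral_hasStrictDerivAt m₀ r).hasDerivAt.const_add _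
  have hhC : ContDiff ℝ 1 h := contDiff_one_iff_deriv.2
    ⟨fun r => (hh' r).differentiableAt, by rwa [funext fun r => (hh' r).deriv]⟩
  have hhI : ∀ r ∈ Icc m₀ m₁, auxiliaryH m U H₀ r = h r := fun r hr =>
    auxiliaryH_eq_of_eqOn hU hm₀ hm₁ (fun y hy => (hpI y hy).1) (fun y hy => (hμI y hy).1) H₀ hr
  -- The minimum of the mobility over the compact interval `[m₀, m₁] ⊂ (0, M)` is the positive lower
  -- bound used in the energy estimate.
  obtain ⟨r₀, hr₀, hmin⟩ := isCompact_Icc.exists_isMinOn (nonempty_Icc.2 hm₀₁)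
    hm_smooth.continuousOn
  have hc : 0 < m r₀ := hm.pos r₀
    ⟨hm₀.trans_le hr₀.1, (EReal.coe_le_coe_iff.2 hr₀.2).trans_lt hm₁⟩
  -- extension of the flow
  obtain ⟨V, hVo, hVsub, hVρ⟩ := hρ_smooth
  obtain ⟨R, hR, -, -, hRρ⟩ := hVρ.exists_contDiff_eventuallyEq_nhdsSet
    (isCompact_Icc.prod ((isCompact_Icc (a := t / 2) (b := 2 * t)).prod hΩ.isCompact_closure)) hVo
    ((prod_mono Subset.rfl (prod_mono (fun τ hτ => hδ.trans_le hτ.1) Subset.rfl)).trans hVsub)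
  have hRe : ∀ σ ∈ Icc (0 : ℝ) 1, ∀ τ ∈ Metric.ball t (t / 2), ∀ x ∈ closure Ω,
      R =ᶠ[𝓝 (σ, τ, x)] fun q => ρ q.1 q.2.1 q.2.2 := fun σ hσ τ hτ x hx =>
    eventually_nhdsSet_iff_forall.1 hRρ (σ, τ, x) ⟨hσ, (hball τ hτ).1, hx⟩
  have hRd : Differentiable ℝ R := hR.differentiable (by simp)
  have hRx : ∀ σ ∈ Icc (0 : ℝ) 1, ∀ τ ∈ Metric.ball t (t / 2), ∀ x ∈ closure Ω,
      (fun y => R (σ, τ, y)) =ᶠ[𝓝 x] ρ σ τ := fun σ hσ τ hτ x hx =>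
    ((by fun_prop : Continuous fun y : EuclideanSpace ℝ (Fin d) => (σ, τ, y)).tendsto x).eventually
      (hRe σ hσ τ hτ x hx)
  have hRI : ∀ σ ∈ Icc (0 : ℝ) 1, ∀ τ ∈ Metric.ball t (t / 2), ∀ x ∈ closure Ω,
      R (σ, τ, x) = ρ σ τ x ∧ ρ σ τ x ∈ Icc m₀ m₁ := fun σ hσ τ hτ x hx =>
    ⟨(hRe σ hσ τ hτ x hx).self_of_nhds, hmem σ hσ τ (hball τ hτ).2 x hx⟩
  have hRs : ∀ τ ∈ Metric.ball t (t / 2), ∀ x ∈ closure Ω,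
      derivWithin (fun σ => ρ σ τ x) (Icc 0 1) s = fderiv ℝ R (s, τ, x) (1, 0, 0) := by
    intro τ hτ x hx
    have e1 : (fun σ => R (σ, τ, x)) =ᶠ[𝓝 s] fun σ => ρ σ τ x :=
      ((by fun_prop : Continuous fun σ : ℝ => (σ, τ, x)).tendsto s).eventually (hRe s hs τ hτ x hx)
    have e2 := (hasDerivAt_slice_fst hRd s τ x).congr_of_eventuallyEq e1.symm
    exact e2.hasDerivWithinAt.derivWithin (uniqueDiffOn_Icc zero_lt_one s hs)
  have hRt : ∀ σ ∈ Icc (0 : ℝ) 1, ∀ τ ∈ Metric.ball t (t / 2), ∀ x ∈ closure Ω,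
      deriv (fun τ => ρ σ τ x) τ = fderiv ℝ R (σ, τ, x) (0, 1, 0) := by
    intro σ hσ τ hτ x hx
    have e1 : (fun τ => R (σ, τ, x)) =ᶠ[𝓝 τ] fun τ => ρ σ τ x :=
      ((by fun_prop : Continuous fun τ : ℝ => (σ, τ, x)).tendsto τ).eventually (hRe σ hσ τ hτ x hx)
    exact ((hasDerivAt_slice_snd hRd σ τ x).congr_of_eventuallyEq e1.symm).deriv
  -- extension of the potentials
  have hZex : ∀ τ, ∃ Z : EuclideanSpace ℝ (Fin d) → ℝ, τ ∈ Metric.ball t (t / 2) →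
      ContDiff ℝ ∞ Z ∧ HasCompactSupport Z ∧ ∀ x ∈ closure Ω, Z =ᶠ[𝓝 x] ζ s τ := by
    intro τ
    by_cases hτ : τ ∈ Metric.ball t (t / 2)
    · obtain ⟨W, hWo, hWsub, hWζ⟩ := (hζ s hs τ (hball τ hτ).2).smooth
      obtain ⟨Z, h1, h2, -, h3⟩ := hWζ.exists_contDiff_eventuallyEq_nhdsSet hΩ.isCompact_closure
        hWo hWsub
      exact ⟨Z, fun _ => ⟨h1, h2, fun x hx => eventually_nhdsSet_iff_forall.1 h3 x hx⟩⟩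
    · exact ⟨0, fun h => absurd h hτ⟩
  -- The extensions are chosen independently for each `τ`, with no regularity in `τ`; none is needed
  -- for the derivative of the action.
  choose Z hZ using hZex
  have hΩn : ∀ x ∈ Ω, ∀ᶠ y in 𝓝 x, y ∈ Ω := fun x hx => hΩ.isOpen.mem_nhds hx
  have hpP : ∀ σ ∈ Icc (0 : ℝ) 1, ∀ τ, 0 < τ → ∀ x ∈ Ω,
      p (ρ σ τ x) = pressure m U (ρ σ τ x) := fun σ hσ τ hτ x hx =>
    (hpI _ (hmem σ hσ τ hτ x (subset_closure hx))).1
  have hmain := hΩ.hasDerivAt_half_action hR hp hμ hhC (fun r => (hh' r).deriv) hs hδ hc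
    (fun τ hτ x hx => by
      obtain ⟨e1, e2⟩ := hRI s hs τ hτ x (subset_closure hx)
      rw [e1, (hμI _ e2).1]
      exact hmin e2)
    (fun τ hτ => ⟨(hZ τ hτ).1, (hZ τ hτ).2.1⟩)
    (fun τ hτ x hx => by
      rw [← hRs τ hτ x (subset_closure hx), ← (hζ s hs τ (hball τ hτ).2).equation x hx]
      congr 1
      refine Filter.EventuallyEq.divergence_eq ?_
      filter_upwards [((hZ τ hτ).2.2 x (subset_closure hx)).gradient, hΩn x hx] with y h1 h2
      obtain ⟨e1, e2⟩ := hRI s hs τ hτ y (subset_closure h2)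
      rw [h1, e1, (hμI _ e2).1])
    (fun τ hτ x hx => by
      rw [((hZ τ hτ).2.2 x (frontier_subset_closure hx)).gradient.self_of_nhds]
      exact (hζ s hs τ (hball τ hτ).2).neumann x hx)
    (fun τ hτ ξ hξ σ hσ => by
      have e1 := flow_integral_eq hΩ hρ_flow ⟨V, hVo, hVsub, hVρ⟩ hzero
        (hp.of_le (by norm_num)) hpP hσ (hball τ hτ).2 hξ
      refine Eq.trans ?_ (e1.trans ?_)
      · refine setIntegral_congr_fun hΩ.isOpen.measurableSet fun x hx => ?_
        rw [hRt σ hσ τ hτ x (subset_closure hx)]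
      · congr 1
        refine setIntegral_congr_fun hΩ.isOpen.measurableSet fun x hx => ?_
        have e2 : (fun y => p (ρ σ τ y)) =ᶠ[𝓝 x] fun y => p (R (σ, τ, y)) := by
          filter_upwards [hRx σ hσ τ hτ x (subset_closure hx)] with y hy
          rw [hy]
        rw [e2.gradient.self_of_nhds])
  -- comparison of the integrands
  have htb : t ∈ Metric.ball t (t / 2) := Metric.mem_ball_self hδ
  obtain ⟨hzC, -, hzζ⟩ := hZ t htb
  set z := Z t
  have hz2 : ContDiff ℝ 2 z := hzC.of_le (WithTop.coe_le_coe.2 le_top)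
  set r : EuclideanSpace ℝ (Fin d) → ℝ := fun x => R (s, t, x) with hr
  have hrC : ContDiff ℝ 2 r := (hR.comp (by fun_prop)).of_le (WithTop.coe_le_coe.2 le_top)
  have hrc : Continuous r := hrC.continuous
  have hrρ : ∀ x ∈ closure Ω, ρ s t x = r x ∧ r x ∈ Icc m₀ m₁ := fun x hx => by
    obtain ⟨e1, e2⟩ := hRI s hs t htb x hx
    exact ⟨e1.symm, by rwa [show r x = ρ s t x from e1]⟩
  have hgrad : ∀ x ∈ closure Ω, ∇ (ζ s t) x = ∇ z x := fun x hx =>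
    (hzζ x hx).gradient.self_of_nhds.symm
  have c1 : ∀ x ∈ Ω, inner ℝ (∇ (fun y => pressure m U (ρ s t y)) x) (∇ (ζ s t) x) =
      inner ℝ (∇ (fun y => p (r y)) x) (∇ z x) := fun x hx => by
    have e1 : (fun y => pressure m U (ρ s t y)) =ᶠ[𝓝 x] fun y => p (r y) := by
      filter_upwards [hΩn x hx] with y hy
      obtain ⟨e2, e3⟩ := hrρ y (subset_closure hy)
      rw [e2, (hpI _ e3).1]
    rw [e1.gradient.self_of_nhds, hgrad x (subset_closure hx)]
  have c2 : ∀ x ∈ Ω, (derivWithin (pressure m U) (Icc m₀ m₁) (ρ s t x) * m (ρ s t x)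
        - auxiliaryH m U H₀ (ρ s t x)) * (Δ (ζ s t) x) ^ 2
        + auxiliaryH m U H₀ (ρ s t x) * hessianNormSq (ζ s t) x =
      (deriv p (r x) * μ (r x) - h (r x)) * (Δ z x) ^ 2 + h (r x) * hessianNormSq z x :=
    fun x hx => by
      obtain ⟨e2, e3⟩ := hrρ x (subset_closure hx)
      have e4 := (hzζ x (subset_closure hx)).symm
      rw [e2, hhI _ e3, (hpI _ e3).2.1, (hμI _ e3).1, e4.hessianNormSq_eq,
        (InnerProductSpace.laplacian_congr_nhds e4).self_of_nhds]
  have c3 : ∀ x ∈ Ω, derivWithin (pressure m U) (Icc m₀ m₁) (ρ s t x)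
        * iteratedDerivWithin 2 m (Icc m₀ m₁) (ρ s t x)
        * ‖∇ (ρ s t) x‖ ^ 2 * ‖∇ (ζ s t) x‖ ^ 2 =
      deriv p (r x) * deriv (deriv μ) (r x) * ‖∇ r x‖ ^ 2 * ‖∇ z x‖ ^ 2 := fun x hx => by
    obtain ⟨e2, e3⟩ := hrρ x (subset_closure hx)
    rw [← (hRx s hs t htb x (subset_closure hx)).gradient.self_of_nhds, e2, (hpI _ e3).2.1,
      (hμI _ e3).2.2, hgrad x (subset_closure hx)]
  have c4 : ∀ x ∈ frontier Ω, auxiliaryH m U H₀ (ρ s t x)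
        * inner ℝ (∇ (fun y => ‖∇ (ζ s t) y‖ ^ 2) x) (outerNormal Ω x) =
      h (r x) * inner ℝ (∇ (fun y => ‖∇ z y‖ ^ 2) x) (outerNormal Ω x) := fun x hx => by
    obtain ⟨e2, e3⟩ := hrρ x (frontier_subset_closure hx)
    have e1 : (fun y => ‖∇ (ζ s t) y‖ ^ 2) =ᶠ[𝓝 x] fun y => ‖∇ z y‖ ^ 2 := by
      filter_upwards [(hzζ x (frontier_subset_closure hx)).gradient] with y hy
      rw [hy]
    rw [e2, hhI _ e3, e1.gradient.self_of_nhds]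
  have hact : ∀ τ ∈ Metric.ball t (t / 2), action m Ω (ρ s τ) (ζ s τ) =
      ∫ x in Ω, μ (R (s, τ, x)) * ‖∇ (Z τ) x‖ ^ 2 := fun τ hτ =>
    setIntegral_congr_fun hΩ.isOpen.measurableSet fun x hx => by
      obtain ⟨e1, e2⟩ := hRI s hs τ hτ x (subset_closure hx)
      rw [e1, (hμI _ e2).1, ((hZ τ hτ).2.2 x (subset_closure hx)).gradient.self_of_nhds]
  -- integrability
  have int : ∀ {f g : EuclideanSpace ℝ (Fin d) → ℝ}, Continuous g → (∀ x ∈ Ω, f x = g x) →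
      IntegrableOn f Ω := fun hg hfg =>
    (hΩ.integrableOn_of_continuousOn_closure hg.continuousOn).congr_fun
      (fun x hx => (hfg x hx).symm) hΩ.isOpen.measurableSet
  have hzg : Continuous (∇ z) := hz2.continuous_gradient two_ne_zero
  have hrg : Continuous (∇ r) := hrC.continuous_gradient two_ne_zero
  have hpr : Continuous (∇ fun y => p (r y)) :=
    ((hp.of_le (by norm_num) : ContDiff ℝ 2 p).comp hrC).continuous_gradient two_ne_zero
  have hμ2 : Continuous (deriv (deriv μ)) :=
    ((contDiff_succ_iff_deriv (n := 1)).1 hμ1).2.2.continuous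
  have hpc := hp1.continuous
  have hμc := hμ.continuous
  have hhc := hhC.continuous
  have hhess := continuous_hessianNormSq hz2
  have hlap := continuous_laplacian hz2
  refine ⟨int (g := fun x => μ (r x) * ‖∇ z x‖ ^ 2) (by fun_prop) fun x hx => ?_,
    int (hpr.inner hzg) c1, int (by fun_prop) c2, int (by fun_prop) c3, ?_, ?_⟩
  · obtain ⟨e2, e3⟩ := hrρ x (subset_closure hx)
    rw [e2, (hμI _ e3).1, hgrad x (subset_closure hx)]
  · have hz3 : ContDiff ℝ 3 z := hzC.of_le (WithTop.coe_le_coe.2 le_top)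
    have hN : Continuous (∇ fun y => ‖∇ z y‖ ^ 2) :=
      (contDiff_norm_gradient_sq (m := 2) hz3 (by norm_num)).continuous_gradient two_ne_zero
    exact (hΩ.integrableOn_frontier ((hhc.comp hrc).continuousOn.mul
      (hN.continuousOn.inner hΩ.continuousOn_outerNormal))).congr_fun
        (fun x hx => (c4 x hx).symm) isClosed_frontier.measurableSet
  · rw [setIntegral_congr_fun hΩ.isOpen.measurableSet c1,
      setIntegral_congr_fun hΩ.isOpen.measurableSet c2,
      setIntegral_congr_fun hΩ.isOpen.measurableSet c3,
      setIntegral_congr_fun isClosed_frontier.measurableSet c4]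
    refine hmain.congr_of_eventuallyEq ?_
    filter_upwards [Metric.ball_mem_nhds t hδ] with τ hτ
    rw [hact τ hτ]
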